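/- **Setting.** Let $G$ be a finite tree with vertex set $V$ and edges $e_1,\dots,e_m$, each parametrized by $x_j\in[0,\pi]$; let $\gamma_j\in\mathbb R$, and let real-valued $\sigma_j\in L_2(0,\pi)$ be given. On $e_j$ consider $-y_j''+\sigma_j'y_j=\lambda y_j$, understood as $-(y_j^{[1]})'-\sigma_j y_j^{[1]}-\sigma_j^2y_j=\lambda y_j$ with the quasi-derivative $y_j^{[1]}=y_j'-\sigma_jy_j$, where $y_j\in W_2^1[0,\pi]$ and $y_j^{[1]}\in W_1^1[0,\pi]$. If $u$ and $v$ are the ends of $e_j$ that correspond to $x_j=0$ and $x_j=\pi$, put $y_j(u)=y_j(0)$, $y_j(v)=y_j(\pi)$, $y_j^{[1]}(u)=-y_j^{[1]}(0)$, $y_j^{[1]}(v)=y_j^{[1]}(\pi)+\gamma_jy_j(\pi)$. Vertices of degree $1$ are called boundary vertices, the others internal. Let $L$ be the boundary value problem given by these equations, the matching conditions ($y_j(v)$ is the same for all $e_j$ incident to $v$, and $\sum_{e_j\ni v}y_j^{[1]}(v)=0$) at the internal vertices $v$, and at each boundary vertex $v$ a prescribed condition, either Dirichlet $y(v)=0$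 or Neumann $y^{[1]}(v)=0$. Let $\tilde L$ be the problem with the same tree, parametrization, $\gamma_j$ and boundary conditions, but with functions $\tilde\sigma_j$ instead of $\sigma_j$. **Characteristic functions.** Let $C_j,S_j$ be the solutions on $e_j$ with $C_j(0)=S_j^{[1]}(0)=1$, $C_j^{[1]}(0)=S_j(0)=0$. The characteristic function of the single edge $e_j$ is $S_j(\pi,\lambda)$ for Dirichlet conditions at both ends, $S_j^{[1]}(\pi,\lambda)+\gamma_jS_j(\pi,\lambda)$ for Dirichlet at $0$ and Neumann at $\pi$, $C_j(\pi,\lambda)$ for Neumann at $0$ and Dirichlet at $\pi$, and $C_j^{[1]}(\pi,\lambda)+\gamma_jC_j(\pi,\lambda)$ for Neumann at both ends. If a tree is split at an internal vertex $u$ into subtrees $G_1,\dots,G_k$, its characteristic function is $\sum_{j}\Delta_j^N\prod_{i\ne j}\Delta_i^D$, where $\Delta_j^D$, $\Delta_j^N$ are the characteristic functions of $G_j$ with the Dirichlet, respectively Neumann, condition at $u$, the other conditions being unchanged. **Splitting.** Let $G$ be divided into two connected subtrees $G_{known}$ and $G_{unknown}$ that have exactly one common vertex $w$, an internal vertex of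 $G$. For each of these two subtrees let $\Delta^K$ be its characteristic function with the matching conditions at $w$ (the Neumann condition, if $w$ has degree $1$ in the subtree), and let $\Delta^\Pi=\prod_j\Delta_j^D$ be the product of the characteristic functions, with the Dirichlet condition at $w$, of the trees into which the subtree falls when $w$ is split; all other conditions are inherited from $L$. Let $l$ be the number of edges of $G_{unknown}$, let $r$ be the number of boundary vertices of $G$ in $G_{unknown}$ with a Dirichlet condition, and assume $r\ge1$. In the real Hilbert space $\mathcal H=L_2(0,l\pi)\oplus L_2(0,l\pi)$ consider, for $\lambda=\rho^2$ with $\rho>0$, $$s(t,\lambda)=\begin{bmatrix}\Delta_{known}^K(\lambda)\,\rho^{-1}\sin\rho t\\ \Delta_{known}^\Pi(\lambda)\cos\rho t\end{bmatrix}\ (r\text{ odd}),\qquad s(t,\lambda)=\begin{bmatrix}\Delta_{known}^K(\lambda)\cos\rho t\\ \Delta_{known}^\Pi(\lambda)\,\rho\sin\rho t\end{bmatrix}\ (r\text{ even}),$$ and, for $0\le j\le r-2$, $s_j(t)=\begin{bmatrix}0\\t^j\end{bmatrix}$ if $r+j$ is odd and $s_j(t)=\begin{bmatrix}t^j\\0\end{bmatrix}$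 if $r+j$ is even. **Theorem.** Suppose that $\sigma_j=\tilde\sigma_j$ in $L_2(0,\pi)$ for every edge $e_j$ of $G_{known}$. Let $\Lambda'$ be a set of positive numbers, each of which is an eigenvalue of $L$ and of $\tilde L$, such that the system $$\mathcal S=\{s(t,\lambda)\}_{\lambda\in\Lambda'}\cup\{s_j(t)\}_{j=0}^{r-2}$$ is complete in $\mathcal H$ (its linear span is dense). Then $\Delta^K_{unknown}(\lambda)=\tilde\Delta^K_{unknown}(\lambda)$ and $\Delta^\Pi_{unknown}(\lambda)=\tilde\Delta^\Pi_{unknown}(\lambda)$ for all $\lambda\in\mathbb C$. -/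

import Mathlib

open MeasureTheory
open scoped Classical

noncomputable section

namespace TreeSL

/-! ### Sturm-Liouville equations with singular potentials on the interval `(0, π)` -/

/-- Lebesgue measure on `(0, a)`. -/
abbrev intervalMeasure (a : ℝ) : Measure ℝ := volume.restrict (Set.Ioo 0 a)

/-- `y` belongs to `W_1^1[0, π]` (it is absolutely continuous on `[0, π]`), with derivative `g`. -/
def HasW11Deriv (y g : ℝ → ℂ) : Prop :=
  IntervalIntegrable g volume 0 Real.pi ∧
    ∀ x ∈ Set.Icc (0 : ℝ) Real.pi, y x = y 0 + ∫ t in (0 : ℝ)..x, g t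

/-- `y` is a solution of `-y'' + σ' y = lam y` on `(0, π)`, with quasi-derivative
`y^{[1]} = y' - σ y = z`, that is, `y' = σ y + z` and
`-z' - σ z - σ ^ 2 y = lam y`, where `y` and `z` are absolutely continuous.
For `σ ∈ L_2(0, π)` the function `y' = σ y + z` is automatically in `L_2(0, π)`. -/
def IsSolution (σ : ℝ → ℝ) (lam : ℂ) (y z : ℝ → ℂ) : Prop :=
  HasW11Deriv y (fun x => (σ x : ℂ) * y x + z x) ∧
    HasW11Deriv z (fun x => -((σ x : ℂ) * z x) - (σ x : ℂ) ^ 2 * y x - lam * y x)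

/-- The solution `(y, y^{[1]})` of the initial value problem `y(0) = a`, `y^{[1]}(0) = b`
(for `σ ∈ L_2(0, π)` it exists, and it is unique on `[0, π]`). -/
def cauchySolution (σ : ℝ → ℝ) (lam a b : ℂ) : (ℝ → ℂ) × (ℝ → ℂ) :=
  Classical.epsilon fun p => IsSolution σ lam p.1 p.2 ∧ p.1 0 = a ∧ p.2 0 = b

/-- `C(π, lam)`. -/
def solC (σ : ℝ → ℝ) (lam : ℂ) : ℂ := (cauchySolution σ lam 1 0).1 Real.pi

/-- `C^{[1]}(π, lam)`. -/
def solC1 (σ : ℝ → ℝ) (lam : ℂ) : ℂ := (cauchySolution σ lam 1 0).2 Real.pi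

/-- `S(π, lam)`. -/
def solS (σ : ℝ → ℝ) (lam : ℂ) : ℂ := (cauchySolution σ lam 0 1).1 Real.pi

/-- `S^{[1]}(π, lam)`. -/
def solS1 (σ : ℝ → ℝ) (lam : ℂ) : ℂ := (cauchySolution σ lam 0 1).2 Real.pi

/-- The two types of boundary conditions. -/
inductive BC : Type
  | dirichlet
  | neumann

/-- The characteristic function of one edge, with the boundary condition `b₀` at `x = 0` and
`b₁` at `x = π`; the Neumann condition at `x = π` is `y^{[1]}(π) + γ y(π) = 0`. -/
def edgeChar (σ : ℝ → ℝ) (γ : ℝ) (lam : ℂ) : BC → BC → ℂ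
  | .dirichlet, .dirichlet => solS σ lam
  | .dirichlet, .neumann => solS1 σ lam + γ * solS σ lam
  | .neumann, .dirichlet => solC σ lam
  | .neumann, .neumann => solC1 σ lam + γ * solC σ lam

/-! ### The tree and the boundary value problem -/

/-- A finite tree whose edges are parametrized by `[0, π]`, with the constants `γ_j` on the edges
and a type of boundary condition for each vertex (only its values at the boundary vertices are
ever used). -/
structure MetricTree (V : Type*) where
  /-- the tree -/
  graph : SimpleGraph V
  isTree : graph.IsTree
  /-- the vertex of the edge that corresponds to `x = 0` -/
  tail : graph.edgeSet → V
  /-- the vertex of the edge that corresponds to `x = π` -/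
  head : graph.edgeSet → V
  ends : ∀ e : graph.edgeSet, s(tail e, head e) = (e : Sym2 V)
  γ : graph.edgeSet → ℝ
  bc : V → BC

namespace MetricTree

variable {V : Type*} [Fintype V] (T : MetricTree V)

/-- The edges of the tree. -/
abbrev Edge : Type _ := T.graph.edgeSet

/-- The set `E_v` of the edges incident to `v`. -/
def star (v : V) : Finset T.Edge := Finset.univ.filter fun e => v ∈ (e : Sym2 V)

/-- Boundary vertices are the vertices of degree `1`; the others are internal. -/
def IsBoundary (v : V) : Prop := (T.star v).card = 1

/-- `y_e(v)`, for an edge `e` incident to `v`. -/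
def vertexValue (y : T.Edge → ℝ → ℂ) (e : T.Edge) (v : V) : ℂ :=
  if v = T.tail e then y e 0 else y e Real.pi

/-- `y_e^{[1]}(v)`, for an edge `e` incident to `v`; here `z` stands for the system of the
quasi-derivatives on the edges. -/
def vertexDeriv (y z : T.Edge → ℝ → ℂ) (e : T.Edge) (v : V) : ℂ :=
  if v = T.tail e then -z e 0 else z e Real.pi + T.γ e * y e Real.pi

/-- `lam` is an eigenvalue of the boundary value problem on the tree with the potentials
`q_e = (σ e)'`, the standard matching conditions in the internal vertices, and the boundary
conditions `bc` in the boundary vertices. -/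
def IsEigenvalue (σ : T.Edge → ℝ → ℝ) (lam : ℂ) : Prop :=
  ∃ y z : T.Edge → ℝ → ℂ,
    (∀ e, IsSolution (σ e) lam (y e) (z e)) ∧
    (∀ v, ¬ T.IsBoundary v →
      (∀ e ∈ T.star v, ∀ e' ∈ T.star v, T.vertexValue y e v = T.vertexValue y e' v) ∧
      ∑ e ∈ T.star v, T.vertexDeriv y z e v = 0) ∧
    (∀ v, T.IsBoundary v → ∀ e ∈ T.star v,
      match T.bc v with
      | .dirichlet => T.vertexValue y e v = 0
      | .neumann => T.vertexDeriv y z e v = 0) ∧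
    ∃ e, ∃ x ∈ Set.Icc (0 : ℝ) Real.pi, y e x ≠ 0

/-! ### Characteristic functions -/

/-- The edge underlying a dart (an edge `u v` with the choice of its first vertex `u`). -/
def dartEdge (d : T.graph.Dart) : T.Edge := ⟨d.edge, d.edge_mem⟩

/-- The characteristic function of the edge of the dart `d = (u, v)`, with the boundary condition
`b` at `u` and `b'` at `v`. -/
def dartChar (σ : T.Edge → ℝ → ℝ) (lam : ℂ) (d : T.graph.Dart) (b b' : BC) : ℂ :=
  if d.fst = T.tail (T.dartEdge d) then
    edgeChar (σ (T.dartEdge d)) (T.γ (T.dartEdge d)) lam b b'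
  else edgeChar (σ (T.dartEdge d)) (T.γ (T.dartEdge d)) lam b' b

/-- For `d = (u, v)`: the darts `(v, x)` with `x ≠ u`. -/
def children (d : T.graph.Dart) : Finset T.graph.Dart :=
  Finset.univ.filter fun d' => d'.fst = d.snd ∧ d'.snd ≠ d.fst

/-- The vertices of the branch of `d = (u, v)`, i.e. of the component of `v` after deletion
of the edge `u v`. -/
def below (d : T.graph.Dart) : Finset V :=
  Finset.univ.filter fun a => T.graph.dist a d.snd < T.graph.dist a d.fst

theorem below_ssubset {d d' : T.graph.Dart} (h : d' ∈ T.children d) : T.below d' ⊂ T.below d := by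
  obtain ⟨⟨u, v⟩, huv⟩ := d
  obtain ⟨⟨v', x⟩, hvx⟩ := d'
  simp only [children, Finset.mem_filter, Finset.mem_univ, true_and] at h
  obtain ⟨rfl, hxu⟩ := h
  refine (Finset.ssubset_iff_of_subset ?_).2 ⟨v', ?_, ?_⟩
  · intro a ha
    simp only [below, Finset.mem_filter, Finset.mem_univ, true_and] at ha ⊢
    by_contra hcon
    have hne := T.isTree.dist_ne_of_adj a huv
    have key : ∀ t (ht : T.graph.Adj t v'), T.graph.dist a t < T.graph.dist a v' →
        ∃ p : T.graph.Walk a v', p.IsPath ∧ p.penultimate = t := by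
      intro t ht hlt
      obtain ⟨p, hp⟩ := T.isTree.connected.exists_walk_length_eq_dist a t
      have h1 : (p.concat ht).length = T.graph.dist a v' := by
        rcases T.isTree.dist_eq_dist_add_one_of_adj a ht with h2 | h2
        · omega
        · rw [SimpleGraph.Walk.length_concat]; omega
      exact ⟨p.concat ht, SimpleGraph.Walk.isPath_of_length_eq_dist _ h1,
        SimpleGraph.Walk.penultimate_concat _ _⟩
    have hlt : T.graph.dist a u < T.graph.dist a v' := by
      simp only at hne hcon
      omega
    obtain ⟨p, hp, hpu⟩ := key u huv hlt
    obtain ⟨q, hq, hqx⟩ := key x hvx.symm ha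
    have hpq := congrArg Subtype.val
      ((T.isTree.isAcyclic.subsingleton_path a v').elim ⟨p, hp⟩ ⟨q, hq⟩)
    simp only at hpq
    exact hxu (by rw [← hqx, ← hpu, hpq])
  · have h1 : T.graph.dist v' u = 1 := SimpleGraph.dist_eq_one_iff_adj.2 huv.symm
    simp [below, h1]
  · simp [below]

/-- The characteristic function of several trees glued at a common vertex, with the standard
matching conditions there: the sum over the trees of the product of the Neumann function of this
tree and the Dirichlet functions of the others. -/
def glue {ι : Type*} [DecidableEq ι] (s : Finset ι) (N D : ι → ℂ) : ℂ :=
  ∑ j ∈ s, N j * ∏ k ∈ s.erase j, D k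

/-- The characteristic function of the branch of `d = (u, v)`, i.e. of the subtree that consists
of the edge `u v` and of everything behind `v`, with the boundary condition `b` at `u`, the
standard matching conditions in the internal vertices, and the conditions `bc` in the other
boundary vertices. If the branch has more than one edge, it is split at the vertex `v` into
the edge `u v` and the branches of the children of `d`. -/
def branchChar (σ : T.Edge → ℝ → ℝ) (lam : ℂ) (d : T.graph.Dart) (b : BC) : ℂ :=
  if T.IsBoundary d.snd then T.dartChar σ lam d b (T.bc d.snd)
  else
    T.dartChar σ lam d b .neumann *
        ∏ d' ∈ (T.children d).attach, branchChar σ lam d'.1 .dirichlet +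
      T.dartChar σ lam d b .dirichlet *
        glue (T.children d).attach (fun d' => branchChar σ lam d'.1 .neumann)
          (fun d' => branchChar σ lam d'.1 .dirichlet)
termination_by (T.below d).card
decreasing_by
  all_goals exact Finset.card_lt_card (T.below_ssubset d'.2)

/-! ### Splitting of the tree into the known and the unknown part -/

/-- A division of the tree into two connected subtrees with exactly one common vertex `w`, which is
an internal vertex of the tree. -/
structure Splitting where
  /-- the known part -/
  known : T.graph.Subgraph
  /-- the unknown part -/
  unknown : T.graph.Subgraph
  /-- the common vertex -/
  w : V
  w_internal : ¬ T.IsBoundary w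
  known_connected : known.Connected
  unknown_connected : unknown.Connected
  cover : known ⊔ unknown = ⊤
  common : known.verts ∩ unknown.verts = {w}

/-- The darts `(w, x)` whose edge belongs to the subtree `H`. They correspond to the trees, into
which `H` falls after splitting its vertex `w`. -/
def rootDarts (H : T.graph.Subgraph) (w : V) : Finset T.graph.Dart :=
  Finset.univ.filter fun d => d.fst = w ∧ H.Adj d.fst d.snd

/-- `Δ^K`: the characteristic function of the subtree `H` with the standard matching conditions
at `w` (if `w` has degree `1` in `H`, this is the Neumann condition at `w`). -/
def charK (σ : T.Edge → ℝ → ℝ) (H : T.graph.Subgraph) (w : V) (lam : ℂ) : ℂ :=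
  glue (T.rootDarts H w) (fun d => T.branchChar σ lam d .neumann)
    (fun d => T.branchChar σ lam d .dirichlet)

/-- `Δ^Π`: the product of the characteristic functions of the trees, into which `H` falls after
splitting `w`, with the Dirichlet condition at `w`. -/
def charPi (σ : T.Edge → ℝ → ℝ) (H : T.graph.Subgraph) (w : V) (lam : ℂ) : ℂ :=
  ∏ d ∈ T.rootDarts H w, T.branchChar σ lam d .dirichlet

/-- The number of edges of the subtree `H`. -/
def numEdges (H : T.graph.Subgraph) : ℕ := H.edgeSet.ncard

/-- The number of Dirichlet conditions among the conditions `bc` at the boundary vertices of the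
tree which belong to the subtree `H`. -/
def numDirichlet (H : T.graph.Subgraph) : ℕ :=
  {v : V | v ∈ H.verts ∧ T.IsBoundary v ∧ T.bc v = .dirichlet}.ncard

end MetricTree

/-! ### The system of vector functions -/

/-- The real Hilbert space `L_2(0, a) ⊕ L_2(0, a)`. -/
abbrev VecL2 (a : ℝ) : Type :=
  WithLp 2 (Lp ℝ 2 (intervalMeasure a) × Lp ℝ 2 (intervalMeasure a))

/-- `h` is the element of `L_2(0, a) ⊕ L_2(0, a)` with the components `f` and `g`. -/
def VecL2.Represents {a : ℝ} (h : VecL2 a) (f g : ℝ → ℝ) : Prop :=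
  h.fst =ᵐ[intervalMeasure a] f ∧ h.snd =ᵐ[intervalMeasure a] g

namespace MetricTree

variable {V : Type*} [Fintype V] (T : MetricTree V)

/-- The vector function `s(t, lam)`, `lam = ρ ^ 2 > 0`; its form depends on the parity of the
number `r` of the Dirichlet conditions on the unknown part. Characteristic functions are real for
real `lam`. -/
def IsSpectralVec (σ : T.Edge → ℝ → ℝ) (P : T.Splitting) (lam : ℝ)
    (h : VecL2 (T.numEdges P.unknown * Real.pi)) : Prop :=
  let ρ := Real.sqrt lam
  let dK := (T.charK σ P.known P.w (lam : ℂ)).re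
  let dPi := (T.charPi σ P.known P.w (lam : ℂ)).re
  if Odd (T.numDirichlet P.unknown) then
    h.Represents (fun t => dK * (Real.sin (ρ * t) / ρ)) (fun t => dPi * Real.cos (ρ * t))
  else
    h.Represents (fun t => dK * Real.cos (ρ * t)) (fun t => dPi * (ρ * Real.sin (ρ * t)))

/-- The vector function `s_j(t)`. For odd `r` it is `(0, t ^ j)` if `j` is even and `(t ^ j, 0)` if
`j` is odd; for even `r` it is the other way round. -/
def IsPowerVec (P : T.Splitting) (j : ℕ) (h : VecL2 (T.numEdges P.unknown * Real.pi)) : Prop :=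
  if (Odd (T.numDirichlet P.unknown) ↔ Even j) then
    h.Represents (fun _ => 0) (fun t => t ^ j)
  else
    h.Represents (fun t => t ^ j) (fun _ => 0)

/-- The system consisting of the `s(t, lam)`, `lam ∈ Λ`, and of the `s_j(t)`, `0 ≤ j ≤ r - 2`. -/
def vecSystem (σ : T.Edge → ℝ → ℝ) (P : T.Splitting) (Λ : Set ℝ) :
    Set (VecL2 (T.numEdges P.unknown * Real.pi)) :=
  {h | ∃ lam ∈ Λ, T.IsSpectralVec σ P lam h} ∪
    {h | ∃ j : ℕ, j + 2 ≤ T.numDirichlet P.unknown ∧ T.IsPowerVec P j h}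

end MetricTree

/-- A system of vectors of a Hilbert space is complete if its linear span is dense. -/
def IsCompleteSystem {a : ℝ} (S : Set (VecL2 a)) : Prop :=
  (Submodule.span ℝ S).topologicalClosure = ⊤

end TreeSL

end

namespace TreeSL

open Set intervalIntegral

/-! ### Absolutely continuous functions -/

/-! Splitting the tree at `w` shows that every eigenvalue `λ` satisfies `Δ^K_known Δ^Π_unknown +
Δ^Π_known Δ^K_unknown = 0` (`IsEigenvalue.charK_mul_charPi_add`). The known factors are the same for
both problems (`Splitting.known_congr`), so subtraction gives `Δ^K_known δΠ + Δ^Π_known δK = 0` on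
`Λ'`, where `δK`, `δΠ` are the differences of the unknown characteristic functions.

The differences have a Fourier representation: `ρ^(r-1) δK(ρ²)` and `ρ^r δΠ(ρ²)` are cosine or sine
transforms, according to parity, of kernels `u`, `v` in `L_2(0, lπ)`. The relation on `Λ'` then says
that `(v, u)` is orthogonal to every `s(t, λ)`. Since `δK(ρ²)` and `δΠ(ρ²)` stay bounded near `ρ =
0`, these transforms vanish at the origin to orders `r - 1` and `r`; hence moments of `u` and `v`
vanish, which is orthogonality to the `s_j`. Completeness forces `u = v = 0`, so the differences
vanish identically.

The Fourier representation is obtained by duality, without transformation operators. A function `F`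
is viewed as the functional `∑ c(ρ) exp(iρs) ↦ ∑ c(ρ) F(ρ)` on exponential sums; if it is bounded in
`L_2(-a, a)`, Riesz's theorem supplies a kernel (`IsBoundedSymbol.exists_kernel`). For one edge,
superpositions of solutions form a hyperbolic system in `(x, s)`, and finite speed of propagation
bounds them on a triangle (`lightCone_bound`). The outcome is a point evaluation at `±π` independent
of the potential, plus an `L_2`-bounded remainder; in the difference of two potentials only the
remainder survives (`admissible_edgeChar`). The class `Admissible` of pairs that are bounded in the
supremum norm, with difference bounded in `L_2`, is stable under the products and sums that build
the characteristic functions; the order is the number of Dirichlet conditions, and the interval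
length adds up over the edges (`Admissible.mul`, `admissible_branchChar`). -/

theorem absolutelyContinuousOnInterval_of_dist_le {E : Type*} [PseudoMetricSpace E] {f : ℝ → E}
    {F : ℝ → ℝ} {a b : ℝ} (hF : AbsolutelyContinuousOnInterval F a b)
    (h : ∀ x ∈ uIcc a b, ∀ y ∈ uIcc a b, dist (f x) (f y) ≤ dist (F x) (F y)) :
    AbsolutelyContinuousOnInterval f a b := by
  rw [absolutelyContinuousOnInterval_iff] at hF ⊢
  intro ε hε
  obtain ⟨δ, hδ, H⟩ := hF ε hε
  refine ⟨δ, hδ, fun E hE hlt => lt_of_le_of_lt (Finset.sum_le_sum fun i hi => ?_) (H E hE hlt)⟩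
  exact h _ (hE.1 i hi).1 _ (hE.1 i hi).2

theorem intervalIntegrable_Icc_pi {E : Type*} [NormedAddCommGroup E] {g : ℝ → E}
    (hg : IntervalIntegrable g volume 0 Real.pi) {x y : ℝ} (hx : x ∈ Icc 0 Real.pi)
    (hy : y ∈ Icc 0 Real.pi) : IntervalIntegrable g volume x y := by
  refine hg.mono_set ?_
  rw [uIcc_of_le Real.pi_pos.le]
  exact uIcc_subset_Icc hx hy

theorem HasW11Deriv.sub_eq {y g : ℝ → ℂ} (h : HasW11Deriv y g) {u v : ℝ}
    (hu : u ∈ Icc 0 Real.pi) (hv : v ∈ Icc 0 Real.pi) : y v - y u = ∫ t in u..v, g t := by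
  have h0 : (0 : ℝ) ∈ Icc 0 Real.pi := ⟨le_rfl, Real.pi_pos.le⟩
  rw [h.2 u hu, h.2 v hv, add_sub_add_left_eq_sub,
    integral_interval_sub_left (intervalIntegrable_Icc_pi h.1 h0 hv)
      (intervalIntegrable_Icc_pi h.1 h0 hu)]

theorem HasW11Deriv.ac {y g : ℝ → ℂ} (h : HasW11Deriv y g) :
    AbsolutelyContinuousOnInterval y 0 Real.pi := by
  have h0 : (0 : ℝ) ∈ Icc 0 Real.pi := ⟨le_rfl, Real.pi_pos.le⟩
  refine absolutelyContinuousOnInterval_of_dist_le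
    (h.1.norm.absolutelyContinuousOnInterval_intervalIntegral (c := 0) (by simp)) ?_
  rw [uIcc_of_le Real.pi_pos.le]
  intro u hu v hv
  rw [dist_comm, dist_comm (∫ t in (0 : ℝ)..u, ‖g t‖), dist_eq_norm, h.sub_eq hu hv, Real.dist_eq,
    integral_interval_sub_left (intervalIntegrable_Icc_pi h.1 h0 hv).norm
      (intervalIntegrable_Icc_pi h.1 h0 hu).norm]
  exact norm_integral_le_abs_integral_norm

theorem HasW11Deriv.continuousOn {y g : ℝ → ℂ} (h : HasW11Deriv y g) :
    ContinuousOn y (Icc 0 Real.pi) := by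
  have := h.ac.continuousOn
  rwa [uIcc_of_le Real.pi_pos.le] at this

theorem HasW11Deriv.ae_hasDerivAt {y g : ℝ → ℂ} (h : HasW11Deriv y g) :
    ∀ᵐ x, x ∈ Ioo 0 Real.pi → HasDerivAt y (g x) x := by
  filter_upwards [h.1.ae_hasDerivAt_integral] with x hx hx0
  have h1 := hx (by rw [uIcc_of_le Real.pi_pos.le]; exact Ioo_subset_Icc_self hx0) 0 (by simp)
  refine (h1.const_add (y 0)).congr_of_eventuallyEq ?_
  filter_upwards [isOpen_Ioo.mem_nhds hx0] with t ht
  exact h.2 t (Ioo_subset_Icc_self ht)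

/-- The difference of `y` and the primitive of `g` is absolutely continuous with derivative zero
almost everywhere, hence constant. This is what makes the product rule available for `HasW11Deriv`.
-/
theorem hasW11Deriv_of_ac {y g : ℝ → ℂ} (hy : AbsolutelyContinuousOnInterval y 0 Real.pi)
    (hg : IntervalIntegrable g volume 0 Real.pi)
    (h : ∀ᵐ x, x ∈ Ioo 0 Real.pi → HasDerivAt y (g x) x) : HasW11Deriv y g := by
  refine ⟨hg, ?_⟩
  have hG : HasW11Deriv (fun x => ∫ t in (0 : ℝ)..x, g t) g := ⟨hg, fun x _ => by simp⟩
  obtain ⟨C, hC⟩ := (hy.sub hG.ac).const_of_ae_hasDerivAt_zero (by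
    have h1 : ∀ᵐ x : ℝ, x ≠ 0 := by simp [ae_iff, measure_singleton]
    have h2 : ∀ᵐ x : ℝ, x ≠ Real.pi := by simp [ae_iff, measure_singleton]
    filter_upwards [h, hG.ae_hasDerivAt, h1, h2] with x hx hx' h1 h2 hmem
    rw [uIcc_of_le Real.pi_pos.le] at hmem
    have hm : x ∈ Ioo 0 Real.pi := ⟨lt_of_le_of_ne hmem.1 h1.symm, lt_of_le_of_ne hmem.2 h2⟩
    simpa using (hx hm).sub (hx' hm))
  rw [uIcc_of_le Real.pi_pos.le] at hC
  intro x hx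
  have e1 := hC x hx
  have e0 := hC 0 ⟨le_rfl, Real.pi_pos.le⟩
  simp only [Pi.sub_apply, integral_same, sub_zero] at e0 e1
  rw [e0, ← e1]; ring

theorem HasW11Deriv.mul {y g z k : ℝ → ℂ} (hy : HasW11Deriv y g) (hz : HasW11Deriv z k) :
    HasW11Deriv (fun x => y x * z x) (fun x => g x * z x + y x * k x) := by
  refine hasW11Deriv_of_ac (hy.ac.smul hz.ac) ?_ ?_
  · exact (hy.1.mul_continuousOn hz.ac.continuousOn).add
      (hz.1.continuousOn_mul hy.ac.continuousOn)
  · filter_upwards [hy.ae_hasDerivAt, hz.ae_hasDerivAt] with x h1 h2 hx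
    exact (h1 hx).mul (h2 hx)

theorem HasW11Deriv.add {y g z k : ℝ → ℂ} (hy : HasW11Deriv y g) (hz : HasW11Deriv z k) :
    HasW11Deriv (fun x => y x + z x) (fun x => g x + k x) := by
  refine ⟨hy.1.add hz.1, fun x hx => ?_⟩
  have h0 : (0 : ℝ) ∈ Icc 0 Real.pi := ⟨le_rfl, Real.pi_pos.le⟩
  beta_reduce
  rw [hy.2 x hx, hz.2 x hx, integral_add (intervalIntegrable_Icc_pi hy.1 h0 hx)
    (intervalIntegrable_Icc_pi hz.1 h0 hx)]
  ring

theorem HasW11Deriv.congr {y g k : ℝ → ℂ} (hy : HasW11Deriv y g)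
    (h : g =ᵐ[intervalMeasure Real.pi] k) : HasW11Deriv y k := by
  have h' : g =ᵐ[volume.restrict (uIoc 0 Real.pi)] k := by
    rw [uIoc_of_le Real.pi_pos.le, ← restrict_Ioo_eq_restrict_Ioc]; exact h
  refine ⟨hy.1.congr_ae h', fun x hx => ?_⟩
  rw [hy.2 x hx]
  congr 1
  refine integral_congr_ae_restrict ?_
  refine ae_restrict_of_ae_restrict_of_subset ?_ h'
  rw [uIoc_of_le Real.pi_pos.le, uIoc_of_le hx.1]
  exact Ioc_subset_Ioc_right hx.2

theorem hasW11Deriv_of_hasDerivAt {y g : ℝ → ℂ} (h : ∀ x, HasDerivAt y (g x) x)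
    (hg : Continuous g) : HasW11Deriv y g := by
  refine ⟨hg.intervalIntegrable _ _, fun x _ => ?_⟩
  rw [integral_eq_sub_of_hasDerivAt (fun t _ => h t) (hg.intervalIntegrable _ _)]
  ring

theorem hasW11Deriv_sum {ι : Type*} (S : Finset ι) {y g : ι → ℝ → ℂ}
    (h : ∀ i ∈ S, HasW11Deriv (y i) (g i)) :
    HasW11Deriv (fun x => ∑ i ∈ S, y i x) (fun x => ∑ i ∈ S, g i x) := by
  induction S using Finset.induction_on with
  | empty => exact ⟨by simp, fun x _ => by simp⟩
  | insert i S hi ih =>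
    simp only [Finset.sum_insert hi]
    exact (h i (by simp)).add (ih fun j hj => h j (by simp [hj]))

/-! ### Exponential weights -/

/-- The weight `exp (2 ∫₀ˣ k)`. -/
noncomputable def expWeight (k : ℝ → ℝ) (x : ℝ) : ℝ := Real.exp (2 * ∫ t in (0 : ℝ)..x, k t)

theorem expWeight_pos (k : ℝ → ℝ) (x : ℝ) : 0 < expWeight k x := Real.exp_pos _

theorem continuousOn_expWeight {k : ℝ → ℝ} (hk : IntervalIntegrable k volume 0 Real.pi) :
    ContinuousOn (expWeight k) (Icc 0 Real.pi) := by
  have h := (hk.absolutelyContinuousOnInterval_intervalIntegral (c := 0) (by simp)).continuousOn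
  rw [uIcc_of_le Real.pi_pos.le] at h
  exact (h.const_smul (2 : ℝ)).rexp

theorem intervalIntegrable_mul_expWeight {k : ℝ → ℝ} (hk : IntervalIntegrable k volume 0 Real.pi) :
    IntervalIntegrable (fun t => k t * expWeight k t) volume 0 Real.pi := by
  refine hk.mul_continuousOn ?_
  rw [uIcc_of_le Real.pi_pos.le]
  exact continuousOn_expWeight hk

/-- The weight `w` satisfies `w' = 2 k w` almost everywhere, so `k w` is half of a derivative; the
factor 2 in the exponent produces the contraction constant 1/2 below. -/
theorem integral_mul_expWeight_le {k : ℝ → ℝ} (hk : IntervalIntegrable k volume 0 Real.pi)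
    (hk0 : ∀ t, 0 ≤ k t) {x : ℝ} (hx : x ∈ Icc 0 Real.pi) :
    ∫ t in (0 : ℝ)..x, k t * expWeight k t ≤ (expWeight k x - 1) / 2 := by
  have h0 : (0 : ℝ) ∈ Icc 0 Real.pi := ⟨le_rfl, Real.pi_pos.le⟩
  have hmono : MonotoneOn (expWeight k) (uIcc 0 x) := by
    rw [uIcc_of_le hx.1]
    intro u hu v hv huv
    refine Real.exp_le_exp.2 (mul_le_mul_of_nonneg_left ?_ two_pos.le)
    rw [← sub_nonneg, integral_interval_sub_left
      (intervalIntegrable_Icc_pi hk h0 ⟨hv.1, hv.2.trans hx.2⟩)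
      (intervalIntegrable_Icc_pi hk h0 ⟨hu.1, hu.2.trans hx.2⟩)]
    exact integral_nonneg huv fun t _ => hk0 t
  -- For a monotone function the integral of the derivative is at most the increment; only this
  -- direction is needed.
  have h1 := hmono.intervalIntegral_deriv_mem_uIcc
  have hle : expWeight k 0 ≤ expWeight k x := hmono (by simp) (by simp) hx.1
  rw [uIcc_of_le (sub_nonneg.2 hle)] at h1
  have h2 : ∫ t in (0 : ℝ)..x, deriv (expWeight k) t
      = ∫ t in (0 : ℝ)..x, 2 * (k t * expWeight k t) := by
    refine intervalIntegral.integral_congr_ae ?_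
    filter_upwards [hk.ae_hasDerivAt_integral] with t ht htx
    rw [uIoc_of_le hx.1] at htx
    have := (((ht (by rw [uIcc_of_le Real.pi_pos.le]; exact ⟨htx.1.le, htx.2.trans hx.2⟩) 0
      (by simp)).const_mul 2).exp).deriv
    exact this.trans (by simp only [expWeight]; ring)
  rw [h2, intervalIntegral.integral_const_mul] at h1
  have h3 : expWeight k 0 = 1 := by simp [expWeight]
  rw [h3] at h1
  linarith [h1.2]

theorem one_le_expWeight {k : ℝ → ℝ} (hk0 : ∀ t, 0 ≤ k t) {x : ℝ} (hx : 0 ≤ x) :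
    1 ≤ expWeight k x :=
  Real.one_le_exp (mul_nonneg two_pos.le (integral_nonneg hx fun t _ => hk0 t))

/-- Integral Gronwall estimate in a weighted supremum norm: if `‖F t‖` is at most
`k t * (m * expWeight k t)`, then the integral of `F` is at most half of the weighted bound. -/
theorem norm_integral_le_expWeight {E : Type*} [NormedAddCommGroup E] [NormedSpace ℝ E]
    {k : ℝ → ℝ} (hk : IntervalIntegrable k volume 0 Real.pi)
    (hk0 : ∀ t, 0 ≤ k t) {x : ℝ} (hx : x ∈ Icc 0 Real.pi) {m : ℝ} (hm : 0 ≤ m) {F : ℝ → E}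
    (hF : ∀ t ∈ Icc 0 x, ‖F t‖ ≤ k t * (m * expWeight k t)) :
    ‖∫ t in (0 : ℝ)..x, F t‖ ≤ m / 2 * expWeight k x := by
  have h0 : (0 : ℝ) ∈ Icc 0 Real.pi := ⟨le_rfl, Real.pi_pos.le⟩
  have e : ∀ t, k t * (m * expWeight k t) = m * (k t * expWeight k t) := fun t => by ring
  simp only [e] at hF
  calc ‖∫ t in (0 : ℝ)..x, F t‖ ≤ ∫ t in (0 : ℝ)..x, m * (k t * expWeight k t) :=
        norm_integral_le_of_norm_le hx.1
          (Filter.Eventually.of_forall fun t ht => hF t ⟨ht.1.le, ht.2⟩)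
          ((intervalIntegrable_Icc_pi (intervalIntegrable_mul_expWeight hk) h0 hx).const_mul m)
    _ = m * ∫ t in (0 : ℝ)..x, k t * expWeight k t := intervalIntegral.integral_const_mul _ _
    _ ≤ m * ((expWeight k x - 1) / 2) :=
        mul_le_mul_of_nonneg_left (integral_mul_expWeight_le hk hk0 hx) hm
    _ ≤ m / 2 * expWeight k x := by linarith

end TreeSL

namespace TreeSL

open Set intervalIntegral

/-! ### The initial value problem -/

theorem intervalIntegrable_of_memLp {σ : ℝ → ℝ} (hσ : MemLp σ 2 (intervalMeasure Real.pi)) :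
    IntervalIntegrable σ volume 0 Real.pi ∧ IntervalIntegrable (fun x => σ x ^ 2) volume 0 Real.pi := by
  constructor
  · rw [intervalIntegrable_iff_integrableOn_Ioo_of_le Real.pi_pos.le]
    exact hσ.integrable (by norm_num)
  · rw [intervalIntegrable_iff_integrableOn_Ioo_of_le Real.pi_pos.le]
    exact hσ.integrable_sq

/-- Picard iteration in a supremum norm weighted by `w`: the weight makes the integral operator a
contraction with constant 1/2 on all of `[0, π]`, although the coefficients are only integrable. -/
theorem exists_isSolution {σ : ℝ → ℝ} (hσ : MemLp σ 2 (intervalMeasure Real.pi)) (lam a b : ℂ) :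
    ∃ y z, IsSolution σ lam y z ∧ y 0 = a ∧ z 0 = b := by
  have h0 : (0 : ℝ) ∈ Icc 0 Real.pi := ⟨le_rfl, Real.pi_pos.le⟩
  obtain ⟨hs1, hs2⟩ := intervalIntegrable_of_memLp hσ
  -- `k` dominates the norm of the coefficient matrix `A`; the summand 1 is the entry in `y' = σ y +
  -- z`.
  set k : ℝ → ℝ := fun t => |σ t| + σ t ^ 2 + (‖lam‖ + 1) with hk_def
  have hk : IntervalIntegrable k volume 0 Real.pi := (hs1.abs.add hs2).add (by simp)
  have hk0 : ∀ t, 0 ≤ k t := fun t => by positivity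
  set w := expWeight k with hw_def
  have hw : ContinuousOn w (Icc 0 Real.pi) := continuousOn_expWeight hk
  have hwpos : ∀ x, 0 < w x := expWeight_pos k
  let A : ℝ → ℂ × ℂ → ℂ × ℂ := fun t p =>
    ((σ t : ℂ) * p.1 + p.2, -((σ t : ℂ) * p.2) - (σ t : ℂ) ^ 2 * p.1 - lam * p.1)
  have hA : ∀ t p, ‖A t p‖ ≤ k t * ‖p‖ := by
    intro t p
    have h1 : ‖p.1‖ ≤ ‖p‖ := norm_fst_le p
    have h2 : ‖p.2‖ ≤ ‖p‖ := norm_snd_le p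
    have hp := norm_nonneg p
    refine (norm_prod_le_iff).2 ⟨?_, ?_⟩
    · calc ‖(σ t : ℂ) * p.1 + p.2‖ ≤ |σ t| * ‖p.1‖ + ‖p.2‖ := by
            refine (norm_add_le _ _).trans ?_
            rw [norm_mul, Complex.norm_real, Real.norm_eq_abs]
        _ ≤ |σ t| * ‖p‖ + ‖p‖ := by gcongr
        _ ≤ k t * ‖p‖ := by
            have : 0 ≤ (σ t ^ 2 + ‖lam‖) * ‖p‖ := by positivity
            simp only [hk_def]; linarith
    · calc ‖-((σ t : ℂ) * p.2) - (σ t : ℂ) ^ 2 * p.1 - lam * p.1‖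
          ≤ |σ t| * ‖p.2‖ + σ t ^ 2 * ‖p.1‖ + ‖lam‖ * ‖p.1‖ := by
            refine (norm_sub_le _ _).trans (add_le_add ((norm_sub_le _ _).trans ?_) (norm_mul_le _ _))
            rw [norm_neg, norm_mul, norm_mul, norm_pow, Complex.norm_real, Real.norm_eq_abs, sq_abs]
        _ ≤ |σ t| * ‖p‖ + σ t ^ 2 * ‖p‖ + ‖lam‖ * ‖p‖ := by gcongr
        _ ≤ k t * ‖p‖ := by simp only [hk_def]; linarith
  have hAsub : ∀ t p q, A t p - A t q = A t (p - q) := by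
    intro t p q
    ext <;> simp [A] <;> ring
  have hAint : ∀ p : ℝ → ℂ × ℂ, ContinuousOn p (Icc 0 Real.pi) →
      IntervalIntegrable (fun t => A t (p t)) volume 0 Real.pi := by
    intro p hp
    rw [← uIcc_of_le Real.pi_pos.le] at hp
    have c1 : ContinuousOn (fun t => (p t).1) (uIcc 0 Real.pi) := continuous_fst.comp_continuousOn hp
    have c2 : ContinuousOn (fun t => (p t).2) (uIcc 0 Real.pi) := continuous_snd.comp_continuousOn hp
    have hs1' : IntervalIntegrable (fun t => (σ t : ℂ)) volume 0 Real.pi :=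
      ⟨hs1.1.ofReal, hs1.2.ofReal⟩
    have hs2' : IntervalIntegrable (fun t => (σ t : ℂ) ^ 2) volume 0 Real.pi := by
      have : IntervalIntegrable (fun t => ((σ t ^ 2 : ℝ) : ℂ)) volume 0 Real.pi :=
        ⟨hs2.1.ofReal, hs2.2.ofReal⟩
      simpa using this
    have i1 := (hs1'.mul_continuousOn c1).add c2.intervalIntegrable
    have i2 := ((hs1'.mul_continuousOn c2).neg.sub (hs2'.mul_continuousOn c1)).sub
      (c1.intervalIntegrable.const_mul lam)
    rw [intervalIntegrable_iff] at i1 i2 ⊢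
    exact i1.prodMk i2
  have hprim : ∀ p : ℝ → ℂ × ℂ, ContinuousOn p (Icc 0 Real.pi) →
      ContinuousOn (fun x => ∫ t in (0 : ℝ)..x, A t (p t)) (Icc 0 Real.pi) := by
    intro p hp
    have := continuousOn_primitive_interval' (hAint p hp) (a := 0) (by simp)
    rwa [uIcc_of_le Real.pi_pos.le] at this
  -- The fixed point is sought as solution divided by `w`, so that the ordinary supremum norm of `u`
  -- is the weighted norm of `ext u`.
  let ext : C(Icc 0 Real.pi, ℂ × ℂ) → ℝ → ℂ × ℂ := fun u x =>
    w x • IccExtend Real.pi_pos.le u x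
  have hext : ∀ u, ContinuousOn (ext u) (Icc 0 Real.pi) := fun u =>
    hw.smul (u.continuous.Icc_extend').continuousOn
  let T : C(Icc 0 Real.pi, ℂ × ℂ) → C(Icc 0 Real.pi, ℂ × ℂ) := fun u =>
    ⟨fun x => (w x)⁻¹ • ((a, b) + ∫ t in (0 : ℝ)..x, A t (ext u t)),
      continuousOn_iff_continuous_domRestrict.1
        ((hw.inv₀ fun x _ => (hwpos x).ne').smul (continuousOn_const.add (hprim _ (hext u))))⟩
  have hT : ContractingWith (1 / 2) T := by
    refine ⟨by norm_num, LipschitzWith.of_dist_le_mul fun u v => ?_⟩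
    rw [ContinuousMap.dist_le (by positivity)]
    intro x
    have hsub : T u x - T v x = (w x)⁻¹ • ∫ t in (0 : ℝ)..x, A t (ext u t - ext v t) := by
      have e : ∀ u, T u x = (w x)⁻¹ • ((a, b) + ∫ t in (0 : ℝ)..x, A t (ext u t)) := fun u => rfl
      rw [e, e, ← smul_sub, add_sub_add_left_eq_sub, ← integral_sub
        (intervalIntegrable_Icc_pi (hAint _ (hext u)) h0 x.2)
        (intervalIntegrable_Icc_pi (hAint _ (hext v)) h0 x.2)]
      simp only [hAsub]
    rw [dist_eq_norm, hsub, norm_smul, norm_inv, Real.norm_of_nonneg (hwpos _).le]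
    have key := norm_integral_le_expWeight hk hk0 x.2 (m := dist u v) dist_nonneg
      (F := fun t => A t (ext u t - ext v t)) (by
        intro t ht
        refine (hA _ _).trans (mul_le_mul_of_nonneg_left ?_ (hk0 t))
        have htm : t ∈ Icc 0 Real.pi := ⟨ht.1, ht.2.trans x.2.2⟩
        have : ext u t - ext v t = w t • (u ⟨t, htm⟩ - v ⟨t, htm⟩) := by
          simp only [ext, IccExtend_of_mem _ _ htm, smul_sub]
        rw [this, norm_smul, Real.norm_of_nonneg (hwpos _).le, mul_comm, ← dist_eq_norm]
        exact mul_le_mul_of_nonneg_right (ContinuousMap.dist_apply_le_dist _) (hwpos t).le)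
    calc (w x)⁻¹ * ‖∫ t in (0 : ℝ)..x, A t (ext u t - ext v t)‖
        ≤ (w x)⁻¹ * (dist u v / 2 * w x) :=
          mul_le_mul_of_nonneg_left key (inv_nonneg.2 (hwpos _).le)
      _ = (1 / 2 : NNReal) * dist u v := by
          have := (hwpos x).ne'
          push_cast
          field_simp
  obtain ⟨u, hu⟩ : ∃ u, T u = u := ⟨_, hT.fixedPoint_isFixedPt⟩
  have hfix : ∀ x ∈ Icc 0 Real.pi, ext u x = (a, b) + ∫ t in (0 : ℝ)..x, A t (ext u t) := by
    intro x hx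
    have h1 : u ⟨x, hx⟩ = (w x)⁻¹ • ((a, b) + ∫ t in (0 : ℝ)..x, A t (ext u t)) := by
      conv_lhs => rw [← hu]
      rfl
    have h2 : ext u x = w x • u ⟨x, hx⟩ := by simp only [ext, IccExtend_of_mem _ _ hx]
    rw [h2, h1, smul_inv_smul₀ (hwpos x).ne']
  have hz0 : ext u 0 = (a, b) := by rw [hfix 0 h0]; simp
  have hi := hAint _ (hext u)
  have comm1 : ∀ x ∈ Icc 0 Real.pi, (∫ t in (0 : ℝ)..x, A t (ext u t)).1
      = ∫ t in (0 : ℝ)..x, (A t (ext u t)).1 := fun x hx =>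
    ((ContinuousLinearMap.fst ℝ ℂ ℂ).intervalIntegral_comp_comm
      (intervalIntegrable_Icc_pi hi h0 hx)).symm
  have comm2 : ∀ x ∈ Icc 0 Real.pi, (∫ t in (0 : ℝ)..x, A t (ext u t)).2
      = ∫ t in (0 : ℝ)..x, (A t (ext u t)).2 := fun x hx =>
    ((ContinuousLinearMap.snd ℝ ℂ ℂ).intervalIntegral_comp_comm
      (intervalIntegrable_Icc_pi hi h0 hx)).symm
  have hi1 : IntervalIntegrable (fun t => (A t (ext u t)).1) volume 0 Real.pi := by
    rw [intervalIntegrable_iff] at hi ⊢; exact hi.fst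
  have hi2 : IntervalIntegrable (fun t => (A t (ext u t)).2) volume 0 Real.pi := by
    rw [intervalIntegrable_iff] at hi ⊢; exact hi.snd
  refine ⟨fun x => (ext u x).1, fun x => (ext u x).2, ⟨⟨hi1, fun x hx => ?_⟩, ⟨hi2, fun x hx => ?_⟩⟩,
    by simp [hz0], by simp [hz0]⟩
  · beta_reduce
    rw [hz0, hfix x hx, Prod.fst_add, comm1 x hx]
  · beta_reduce
    rw [hz0, hfix x hx, Prod.snd_add, comm2 x hx]

theorem cauchySolution_spec {σ : ℝ → ℝ} (hσ : MemLp σ 2 (intervalMeasure Real.pi)) (lam a b : ℂ) :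
    IsSolution σ lam (cauchySolution σ lam a b).1 (cauchySolution σ lam a b).2 ∧
      (cauchySolution σ lam a b).1 0 = a ∧ (cauchySolution σ lam a b).2 0 = b := by
  obtain ⟨y, z, h⟩ := exists_isSolution hσ lam a b
  exact Classical.epsilon_spec
    (p := fun p : (ℝ → ℂ) × (ℝ → ℂ) => IsSolution σ lam p.1 p.2 ∧ p.1 0 = a ∧ p.2 0 = b)
    ⟨(y, z), h⟩

theorem isSolution_congr {σ τ : ℝ → ℝ} (h : σ =ᵐ[intervalMeasure Real.pi] τ) (lam : ℂ)
    (y z : ℝ → ℂ) : IsSolution σ lam y z ↔ IsSolution τ lam y z := by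
  have aux : ∀ {σ τ : ℝ → ℝ}, σ =ᵐ[intervalMeasure Real.pi] τ →
      IsSolution σ lam y z → IsSolution τ lam y z := by
    intro σ τ h hs
    refine ⟨hs.1.congr ?_, hs.2.congr ?_⟩
    · filter_upwards [h] with x hx
      rw [hx]
    · filter_upwards [h] with x hx
      rw [hx]
  exact ⟨aux h, aux h.symm⟩

/-- A genuine equality of functions: the choice operator is applied to the same predicate. -/
theorem cauchySolution_congr {σ τ : ℝ → ℝ} (h : σ =ᵐ[intervalMeasure Real.pi] τ) (lam a b : ℂ) :
    cauchySolution σ lam a b = cauchySolution τ lam a b := by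
  simp only [cauchySolution, isSolution_congr h]

/-- The coefficient matrix of the first-order system has trace zero; both products have the same
derivative. -/
theorem IsSolution.wronskian {σ : ℝ → ℝ} {lam : ℂ} {y z y' z' : ℝ → ℂ} (h : IsSolution σ lam y z)
    (h' : IsSolution σ lam y' z') {x : ℝ} (hx : x ∈ Icc 0 Real.pi) :
    y x * z' x - z x * y' x = y 0 * z' 0 - z 0 * y' 0 := by
  have h1 := (h.1.mul h'.2).2 x hx
  have h2 := (h.2.mul h'.1).2 x hx
  beta_reduce at h1 h2
  rw [h1, h2]
  have : ∀ t : ℝ, ((σ t : ℂ) * y t + z t) * z' t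
      + y t * (-((σ t : ℂ) * z' t) - (σ t : ℂ) ^ 2 * y' t - lam * y' t)
      = (-((σ t : ℂ) * z t) - (σ t : ℂ) ^ 2 * y t - lam * y t) * y' t
        + z t * ((σ t : ℂ) * y' t + z' t) := fun t => by ring
  simp only [this]
  ring

/-- Cramer's rule with the constant Wronskians of `y`, `C`, `S`. Uniqueness for the initial value
problem is a consequence, so no Gronwall argument is needed. -/
theorem IsSolution.eq_cauchySolution {σ : ℝ → ℝ} (hσ : MemLp σ 2 (intervalMeasure Real.pi))
    {lam : ℂ} {y z : ℝ → ℂ} (h : IsSolution σ lam y z) {x : ℝ} (hx : x ∈ Icc 0 Real.pi) :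
    y x = y 0 * (cauchySolution σ lam 1 0).1 x + z 0 * (cauchySolution σ lam 0 1).1 x ∧
      z x = y 0 * (cauchySolution σ lam 1 0).2 x + z 0 * (cauchySolution σ lam 0 1).2 x := by
  obtain ⟨hC, hC0, hC1⟩ := cauchySolution_spec hσ lam 1 0
  obtain ⟨hS, hS0, hS1⟩ := cauchySolution_spec hσ lam 0 1
  have w1 := h.wronskian hC hx
  have w2 := h.wronskian hS hx
  have w3 := hC.wronskian hS hx
  rw [hC0, hC1] at w1
  rw [hS0, hS1] at w2
  rw [hC0, hC1, hS0, hS1] at w3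
  constructor
  · linear_combination (-y x) * w3 + (cauchySolution σ lam 1 0).1 x * w2
      - (cauchySolution σ lam 0 1).1 x * w1
  · linear_combination (-z x) * w3 + (cauchySolution σ lam 1 0).2 x * w2
      - (cauchySolution σ lam 0 1).2 x * w1

theorem solC_mul_solS1_sub {σ : ℝ → ℝ} (hσ : MemLp σ 2 (intervalMeasure Real.pi)) (lam : ℂ) :
    solC σ lam * solS1 σ lam - solC1 σ lam * solS σ lam = 1 := by
  obtain ⟨hC, hC0, hC1⟩ := cauchySolution_spec hσ lam 1 0
  obtain ⟨hS, hS0, hS1⟩ := cauchySolution_spec hσ lam 0 1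
  have w3 := hC.wronskian hS ⟨Real.pi_pos.le, le_rfl⟩
  rw [hC0, hC1, hS0, hS1] at w3
  rw [solC, solS1, solC1, solS, w3]; ring

theorem HasW11Deriv.conj {y g : ℝ → ℂ} (h : HasW11Deriv y g) :
    HasW11Deriv (fun x => starRingEnd ℂ (y x)) (fun x => starRingEnd ℂ (g x)) := by
  have h0 : (0 : ℝ) ∈ Icc 0 Real.pi := ⟨le_rfl, Real.pi_pos.le⟩
  refine ⟨?_, fun x hx => ?_⟩
  · have := h.1
    rw [intervalIntegrable_iff] at this ⊢
    exact (Complex.conjCLE.toContinuousLinearMap).integrable_comp this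
  · beta_reduce
    rw [h.2 x hx, map_add]
    congr 1
    exact ((Complex.conjCLE.toContinuousLinearMap).intervalIntegral_comp_comm
      (intervalIntegrable_Icc_pi h.1 h0 hx)).symm

/-- For real `σ` and `lam` conjugation preserves the equation and the real initial data; uniqueness
does the rest. -/
theorem conj_cauchySolution {σ : ℝ → ℝ} (hσ : MemLp σ 2 (intervalMeasure Real.pi)) (lam a b : ℝ)
    {x : ℝ} (hx : x ∈ Icc 0 Real.pi) :
    starRingEnd ℂ ((cauchySolution σ lam a b).1 x) = (cauchySolution σ lam a b).1 x ∧
      starRingEnd ℂ ((cauchySolution σ lam a b).2 x) = (cauchySolution σ lam a b).2 x := by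
  obtain ⟨h, h0, h1⟩ := cauchySolution_spec hσ lam a b
  have hc : IsSolution σ lam (fun x => starRingEnd ℂ ((cauchySolution σ lam a b).1 x))
      (fun x => starRingEnd ℂ ((cauchySolution σ lam a b).2 x)) := by
    constructor
    · simpa using h.1.conj
    · simpa using h.2.conj
  have e := h.eq_cauchySolution hσ hx
  have e' := hc.eq_cauchySolution hσ hx
  rw [h0, h1] at e
  rw [h0, h1, Complex.conj_ofReal, Complex.conj_ofReal] at e'
  exact ⟨e'.1.trans e.1.symm, e'.2.trans e.2.symm⟩

theorem edgeChar_congr {σ τ : ℝ → ℝ} (h : σ =ᵐ[intervalMeasure Real.pi] τ) (γ : ℝ) (lam : ℂ)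
    (b b' : BC) : edgeChar σ γ lam b b' = edgeChar τ γ lam b b' := by
  cases b <;> cases b' <;>
    simp only [edgeChar, solS, solS1, solC, solC1, cauchySolution_congr h]

theorem conj_edgeChar {σ : ℝ → ℝ} (hσ : MemLp σ 2 (intervalMeasure Real.pi)) (γ lam : ℝ)
    (b b' : BC) : starRingEnd ℂ (edgeChar σ γ lam b b') = edgeChar σ γ lam b b' := by
  have hpi : Real.pi ∈ Icc 0 Real.pi := ⟨Real.pi_pos.le, le_rfl⟩
  have hC := conj_cauchySolution hσ lam 1 0 hpi
  have hS := conj_cauchySolution hσ lam 0 1 hpi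
  simp only [Complex.ofReal_one, Complex.ofReal_zero] at hC hS
  cases b <;> cases b' <;>
    simp only [edgeChar, solS, solS1, solC, solC1, map_add, map_mul, Complex.conj_ofReal,
      hC.1, hC.2, hS.1, hS.2]

end TreeSL

namespace TreeSL

open Set intervalIntegral

/-! ### Estimates on the light cone -/

theorem norm_integral_le_expWeight_add {E : Type*} [NormedAddCommGroup E] [NormedSpace ℝ E]
    {k : ℝ → ℝ} (hk : IntervalIntegrable k volume 0 Real.pi)
    (hk0 : ∀ t, 0 ≤ k t) {x : ℝ} (hx : x ∈ Icc 0 Real.pi) {m : ℝ} (hm : 0 ≤ m) {F : ℝ → E}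
    {e : ℝ → ℝ} (he : IntervalIntegrable e volume 0 x)
    (hF : ∀ t ∈ Icc 0 x, ‖F t‖ ≤ k t * (m * expWeight k t) + e t) :
    ‖∫ t in (0 : ℝ)..x, F t‖ ≤ m / 2 * expWeight k x + ∫ t in (0 : ℝ)..x, e t := by
  have h0 : (0 : ℝ) ∈ Icc 0 Real.pi := ⟨le_rfl, Real.pi_pos.le⟩
  have e1 : ∀ t, k t * (m * expWeight k t) = m * (k t * expWeight k t) := fun t => by ring
  simp only [e1] at hF
  have hi := (intervalIntegrable_Icc_pi (intervalIntegrable_mul_expWeight hk) h0 hx).const_mul m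
  calc ‖∫ t in (0 : ℝ)..x, F t‖ ≤ ∫ t in (0 : ℝ)..x, (m * (k t * expWeight k t) + e t) :=
        norm_integral_le_of_norm_le hx.1
          (Filter.Eventually.of_forall fun t ht => hF t ⟨ht.1.le, ht.2⟩) (hi.add he)
    _ = m * (∫ t in (0 : ℝ)..x, k t * expWeight k t) + ∫ t in (0 : ℝ)..x, e t := by
        rw [integral_add hi he, intervalIntegral.integral_const_mul]
    _ ≤ m * ((expWeight k x - 1) / 2) + ∫ t in (0 : ℝ)..x, e t := by
        gcongr
        exact integral_mul_expWeight_le hk hk0 hx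
    _ ≤ m / 2 * expWeight k x + ∫ t in (0 : ℝ)..x, e t := by linarith

/-- The supremum `m` satisfies `m ≤ A + m / 2`, and the last term is absorbed. This requires the
supremum to be finite beforehand, which is the role of `hbdd`. -/
theorem le_two_mul_of_half_bound {ι : Type*} {f : ι → ℝ} {A : ℝ} (hA : 0 ≤ A)
    (hbdd : ∃ m, ∀ i, f i ≤ m)
    (h : ∀ m, 0 ≤ m → (∀ i, f i ≤ m) → ∀ i, f i ≤ A + m / 2) (i : ι) : f i ≤ 2 * A := by
  obtain ⟨m, hm⟩ := hbdd
  have hb : BddAbove (range f) := ⟨m, by rintro _ ⟨j, rfl⟩; exact hm j⟩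
  have : Nonempty ι := ⟨i⟩
  have h1 := h (max 0 (⨆ j, f j)) (le_max_left _ _)
    fun j => (le_ciSup hb j).trans (le_max_right _ _)
  have h2 : (⨆ j, f j) ≤ A + max 0 (⨆ j, f j) / 2 := ciSup_le h1
  have h3 := le_ciSup hb i
  rcases le_total 0 (⨆ j, f j) with h4 | h4
  · rw [max_eq_right h4] at h2; linarith
  · linarith

/-- Substitution along a characteristic line: since `|d| ≥ 1`, the Jacobian is at most 1, and the
line stays inside `[-a, a]` because its ends do. -/
theorem integral_sq_comp_le {φ : ℝ → ℂ} (hφ : Continuous φ) {a B c x : ℝ}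
    (hB : ∫ s in -a..a, ‖φ s‖ ^ 2 ≤ B) {d : ℝ} (hd : 1 ≤ |d|) (hx : 0 ≤ x)
    (h1 : |c| ≤ a) (h2 : |c + d * x| ≤ a) :
    ∫ t in (0 : ℝ)..x, ‖φ (c + d * t)‖ ^ 2 ≤ B := by
  have hd0 : d ≠ 0 := by rintro rfl; simp at hd; linarith
  have hc : Continuous fun s => ‖φ s‖ ^ 2 := by fun_prop
  have key := intervalIntegral.integral_comp_add_mul (fun s => ‖φ s‖ ^ 2) hd0 c (a := 0) (b := x)
  beta_reduce at key
  rw [key, mul_zero, add_zero, smul_eq_mul]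
  rw [abs_le] at h1 h2
  have hnn : ∀ u v : ℝ, u ≤ v → -a ≤ u → v ≤ a →
      0 ≤ ∫ s in u..v, ‖φ s‖ ^ 2 ∧ ∫ s in u..v, ‖φ s‖ ^ 2 ≤ B := fun u v huv hu hv =>
    ⟨integral_nonneg huv fun s _ => by positivity,
      (integral_mono_interval hu huv hv (Filter.Eventually.of_forall fun s => by positivity)
        (hc.intervalIntegrable _ _)).trans hB⟩
  rcases le_or_gt 0 d with hd' | hd'
  · rw [abs_of_nonneg hd'] at hd
    obtain ⟨h3, h4⟩ := hnn c (c + d * x) (by nlinarith) h1.1 h2.2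
    exact (mul_le_of_le_one_left h3 (inv_le_one_of_one_le₀ hd)).trans h4
  · rw [abs_of_neg hd'] at hd
    obtain ⟨h3, h4⟩ := hnn (c + d * x) c (by nlinarith) h2.1 h1.2
    rw [integral_symm, mul_neg, ← neg_mul, ← inv_neg]
    exact (mul_le_of_le_one_left h3 (inv_le_one_of_one_le₀ hd)).trans h4

/-- The integral of `|f| |φ|` along a line is estimated by the `L_2`-norms. -/
theorem integral_mul_norm_comp_le {f : ℝ → ℝ} {φ : ℝ → ℂ} (hφ : Continuous φ) {a B c x I : ℝ}
    (hB0 : 0 < B) (hB : ∫ s in -a..a, ‖φ s‖ ^ 2 ≤ B ^ 2) {d : ℝ} (hd : 1 ≤ |d|) (hx : 0 ≤ x)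
    (h1 : |c| ≤ a) (h2 : |c + d * x| ≤ a) (hf : IntervalIntegrable f volume 0 x)
    (hf2 : IntervalIntegrable (fun t => f t ^ 2) volume 0 x)
    (hI : ∫ t in (0 : ℝ)..x, f t ^ 2 ≤ I) :
    IntervalIntegrable (fun t => |f t| * ‖φ (c + d * t)‖) volume 0 x ∧
      ∫ t in (0 : ℝ)..x, |f t| * ‖φ (c + d * t)‖ ≤ (I + 1) * B := by
  have hc : Continuous fun t => ‖φ (c + d * t)‖ := by fun_prop
  have hi : IntervalIntegrable (fun t => |f t| * ‖φ (c + d * t)‖) volume 0 x :=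
    hf.abs.mul_continuousOn hc.continuousOn
  have hi2 : IntervalIntegrable (fun t => ‖φ (c + d * t)‖ ^ 2) volume 0 x :=
    (hc.pow 2).intervalIntegrable _ _
  refine ⟨hi, ?_⟩
  have hI0 : 0 ≤ ∫ t in (0 : ℝ)..x, f t ^ 2 := integral_nonneg hx fun t _ => by positivity
  calc ∫ t in (0 : ℝ)..x, |f t| * ‖φ (c + d * t)‖
      ≤ ∫ t in (0 : ℝ)..x, (B * f t ^ 2 + B⁻¹ * ‖φ (c + d * t)‖ ^ 2) := by
        refine integral_mono_on hx hi ((hf2.const_mul B).add (hi2.const_mul B⁻¹)) fun t _ => ?_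
        -- Weighted arithmetic-geometric inequality; the weights `B` and `B⁻¹` make the result
        -- linear in `B`.
        have h3 : 0 ≤ B * (|f t| - B⁻¹ * ‖φ (c + d * t)‖) ^ 2 := by positivity
        have h4 : 0 ≤ |f t| * ‖φ (c + d * t)‖ := by positivity
        have h5 : B * (|f t| - B⁻¹ * ‖φ (c + d * t)‖) ^ 2 = B * f t ^ 2
            + B⁻¹ * ‖φ (c + d * t)‖ ^ 2 - 2 * (|f t| * ‖φ (c + d * t)‖) := by
          rw [← sq_abs (f t)]
          field_simp
          ring
        linarith
    _ = B * (∫ t in (0 : ℝ)..x, f t ^ 2) + B⁻¹ * ∫ t in (0 : ℝ)..x, ‖φ (c + d * t)‖ ^ 2 := by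
        rw [integral_add (hf2.const_mul B) (hi2.const_mul B⁻¹),
          intervalIntegral.integral_const_mul, intervalIntegral.integral_const_mul]
    _ ≤ B * I + B⁻¹ * B ^ 2 := by
        gcongr
        exact integral_sq_comp_le hφ hB hd hx h1 h2
    _ = (I + 1) * B := by field_simp

/-- A priori estimate for a hyperbolic system with the coefficient `σ ∈ L_2(0, π)`: up to a
remainder, which is bounded by the `L_2`-norms of the initial data of `P` and `Q` and by the supremum
of the initial data of `U`, the solution is the one of the system without `σ`. -/
theorem lightCone_bound {σ : ℝ → ℝ} (hσ : MemLp σ 2 (intervalMeasure Real.pi)) :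
    ∃ M, 0 ≤ M ∧ ∀ (P Q U : ℝ → ℝ → ℂ) (B : ℝ), 0 < B →
      (∀ x ∈ Icc 0 Real.pi, ∀ s, P x s = P 0 (s + x) + ∫ t in (0 : ℝ)..x,
        ((σ t : ℂ) * Q t (s + x - t) - (σ t : ℂ) ^ 2 * U t (s + x - t))) →
      (∀ x ∈ Icc 0 Real.pi, ∀ s, Q x s = Q 0 (s - x) + ∫ t in (0 : ℝ)..x,
        ((σ t : ℂ) * P t (s - x + t) + (σ t : ℂ) ^ 2 * U t (s - x + t))) →
      (∀ x ∈ Icc 0 Real.pi, ∀ s, U x s = U 0 s + ∫ t in (0 : ℝ)..x,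
        ((σ t : ℂ) * U t s + (P t s - Q t s) / 2)) →
      (∃ m, ∀ x ∈ Icc 0 Real.pi, ∀ s ∈ Icc (-Real.pi) Real.pi,
        ‖P x s‖ ≤ m ∧ ‖Q x s‖ ≤ m ∧ ‖U x s‖ ≤ m) →
      Continuous (P 0) → Continuous (Q 0) →
      ∫ s in -Real.pi..Real.pi, ‖P 0 s‖ ^ 2 ≤ B ^ 2 →
      ∫ s in -Real.pi..Real.pi, ‖Q 0 s‖ ^ 2 ≤ B ^ 2 →
      (∀ s ∈ Icc (-Real.pi) Real.pi, ‖U 0 s‖ ≤ B) →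
      ‖P Real.pi 0 - P 0 Real.pi‖ ≤ M * B ∧ ‖Q Real.pi 0 - Q 0 (-Real.pi)‖ ≤ M * B ∧
        ‖U Real.pi 0‖ ≤ M * B := by
  have h0 : (0 : ℝ) ∈ Icc 0 Real.pi := ⟨le_rfl, Real.pi_pos.le⟩
  have hpi0 := Real.pi_pos
  obtain ⟨hs1, hs2⟩ := intervalIntegrable_of_memLp hσ
  set k : ℝ → ℝ := fun t => |σ t| + σ t ^ 2 + 1 with hk_def
  have hk : IntervalIntegrable k volume 0 Real.pi := (hs1.abs.add hs2).add (by simp)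
  have hk0 : ∀ t, 0 ≤ k t := fun t => by positivity
  set w := expWeight k with hw_def
  have hwpos : ∀ x, 0 < w x := expWeight_pos k
  set I := ∫ t in (0 : ℝ)..Real.pi, σ t ^ 2 with hI_def
  have hI0 : 0 ≤ I := integral_nonneg hpi0.le fun t _ => by positivity
  -- The free waves contribute at most `(I + 1) B` to the remainders of `P` and `Q`, and at most `B
  -- + (π + 1) B` to `U`; `A B` covers both.
  set A := I + Real.pi + 3 with hA_def
  have hA0 : 0 < A := by positivity
  refine ⟨2 * A * w Real.pi, (mul_pos (mul_pos two_pos hA0) (hwpos _)).le, ?_⟩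
  intro P Q U B hB hP hQ hU hbdd hPc hQc hPB hQB hUB
  -- The triangle of dependence of the point `(π, 0)`: the lines `s ± x = const` and `s = const`,
  -- followed back to `x = 0`, stay in it and reach the initial data inside `[-π, π]`.
  let Z := {p : ℝ × ℝ // p.1 ∈ Icc 0 Real.pi ∧ |p.2| ≤ Real.pi - p.1}
  -- For `P` and `Q` only the deviation from the free wave is measured: point values of the initial
  -- data are not controlled by their `L_2`-norms, whereas integrals of them against `σ` are.
  let f : Z → ℝ := fun p => (w p.1.1)⁻¹ * max (‖P p.1.1 p.1.2 - P 0 (p.1.2 + p.1.1)‖)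
    (max (‖Q p.1.1 p.1.2 - Q 0 (p.1.2 - p.1.1)‖) ‖U p.1.1 p.1.2‖)
  have main : ∀ p : Z, f p ≤ 2 * (A * B) := by
    refine le_two_mul_of_half_bound (by positivity) ?_ ?_
    · obtain ⟨m, hm⟩ := hbdd
      refine ⟨2 * m, ?_⟩
      rintro ⟨⟨x, s⟩, hx, hs⟩
      simp only at hx hs
      rw [abs_le] at hs
      have m1 := hm x hx s ⟨by linarith [hx.1], by linarith [hx.1]⟩
      have m2 := hm 0 h0 (s + x) ⟨by linarith [hx.1], by linarith [hx.1]⟩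
      have m3 := hm 0 h0 (s - x) ⟨by linarith [hx.1], by linarith [hx.1]⟩
      have hmnn : 0 ≤ m := (norm_nonneg _).trans m1.1
      have hw1 : (w x)⁻¹ ≤ 1 := inv_le_one_of_one_le₀ (one_le_expWeight hk0 hx.1)
      have hmax : max (‖P x s - P 0 (s + x)‖) (max (‖Q x s - Q 0 (s - x)‖) ‖U x s‖) ≤ 2 * m := by
        refine max_le ?_ (max_le ?_ ?_)
        · exact (norm_sub_le _ _).trans (by linarith [m1.1, m2.1])
        · exact (norm_sub_le _ _).trans (by linarith [m1.2.1, m3.2.1])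
        · linarith [m1.2.2]
      calc f ⟨(x, s), hx, by rw [abs_le]; exact hs⟩ ≤ 1 * (2 * m) :=
            mul_le_mul hw1 hmax (by positivity) zero_le_one
        _ = 2 * m := one_mul _
    · intro m hm hf
      have hf' : ∀ x ∈ Icc 0 Real.pi, ∀ s, |s| ≤ Real.pi - x →
          ‖P x s - P 0 (s + x)‖ ≤ m * w x ∧ ‖Q x s - Q 0 (s - x)‖ ≤ m * w x ∧
            ‖U x s‖ ≤ m * w x := by
        intro x hx s hs
        have h1 := hf ⟨(x, s), hx, hs⟩
        simp only [f] at h1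
        rw [inv_mul_le_iff₀ (hwpos x), mul_comm] at h1
        exact ⟨(le_max_left _ _).trans h1, (le_max_left _ _).trans ((le_max_right _ _).trans h1),
          (le_max_right _ _).trans ((le_max_right _ _).trans h1)⟩
      rintro ⟨⟨x, s⟩, hx, hs⟩
      simp only at hx hs
      have hs' := abs_le.1 hs
      have hi1 := intervalIntegrable_Icc_pi hs1 h0 hx
      have hi2 := intervalIntegrable_Icc_pi hs2 h0 hx
      have hIx : ∫ t in (0 : ℝ)..x, σ t ^ 2 ≤ I :=
        integral_mono_interval le_rfl hx.1 hx.2 (Filter.Eventually.of_forall fun s => by positivity)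
          hs2
      have h1x : IntervalIntegrable (fun _ : ℝ => (1 : ℝ)) volume 0 x := by simp
      have h1x' : ∫ t in (0 : ℝ)..x, (fun _ : ℝ => (1 : ℝ)) t ^ 2 ≤ Real.pi := by
        simpa using hx.2
      simp only [f]
      rw [inv_mul_le_iff₀ (hwpos x)]
      have hw1 : 1 ≤ w x := one_le_expWeight hk0 hx.1
      have fin : ∀ r : ℝ, r ≤ m / 2 * w x + A * B → r ≤ w x * (A * B + m / 2) := by
        intro r hr
        have : A * B ≤ w x * (A * B) := le_mul_of_one_le_left (by positivity) hw1
        linarith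
      refine max_le (fin _ ?_) (max_le (fin _ ?_) (fin _ ?_))
      · rw [hP x hx s, add_sub_cancel_left]
        -- On the characteristic `s + x - t` of `P` the free part of `Q` is `Q 0 (s + x - 2 t)`,
        -- hence the slope `-2`; for `Q` the slope is `2`.
        obtain ⟨e1, e2⟩ := integral_mul_norm_comp_le (f := σ) hQc hB hQB (c := s + x) (d := -2)
          (by norm_num) hx.1 (abs_le.2 ⟨by linarith [hx.1], by linarith [hx.1]⟩)
          (abs_le.2 ⟨by linarith [hx.1], by linarith [hx.1]⟩) hi1 hi2 hIx
        refine (norm_integral_le_expWeight_add hk hk0 hx hm e1 fun t ht => ?_).trans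
          (add_le_add le_rfl (e2.trans ?_))
        · have ht' : t ∈ Icc 0 Real.pi := ⟨ht.1, ht.2.trans hx.2⟩
          obtain ⟨-, q1, q2⟩ := hf' t ht' (s + x - t)
            (abs_le.2 ⟨by linarith [ht.1, ht.2], by linarith [ht.1, ht.2]⟩)
          rw [show s + x - t - t = s + x + -2 * t by ring] at q1
          have q3 : ‖Q t (s + x - t)‖ ≤ m * w t + ‖Q 0 (s + x + -2 * t)‖ := by
            have := norm_sub_norm_le (Q t (s + x - t)) (Q 0 (s + x + -2 * t))
            linarith
          calc ‖(σ t : ℂ) * Q t (s + x - t) - (σ t : ℂ) ^ 2 * U t (s + x - t)‖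
              ≤ |σ t| * ‖Q t (s + x - t)‖ + σ t ^ 2 * ‖U t (s + x - t)‖ := by
                refine (norm_sub_le _ _).trans (le_of_eq ?_)
                rw [norm_mul, norm_mul, norm_pow, Complex.norm_real, Real.norm_eq_abs, sq_abs]
            _ ≤ |σ t| * (m * w t + ‖Q 0 (s + x + -2 * t)‖) + σ t ^ 2 * (m * w t) := by gcongr
            _ ≤ k t * (m * w t) + |σ t| * ‖Q 0 (s + x + -2 * t)‖ := by
                have : 0 ≤ m * w t := by have := hwpos t; positivity
                simp only [hk_def]
                linarith
        · exact mul_le_mul_of_nonneg_right (by linarith) hB.le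
      · rw [hQ x hx s, add_sub_cancel_left]
        obtain ⟨e1, e2⟩ := integral_mul_norm_comp_le (f := σ) hPc hB hPB (c := s - x) (d := 2)
          (by norm_num) hx.1 (abs_le.2 ⟨by linarith [hx.1], by linarith [hx.1]⟩)
          (abs_le.2 ⟨by linarith [hx.1], by linarith [hx.1]⟩) hi1 hi2 hIx
        refine (norm_integral_le_expWeight_add hk hk0 hx hm e1 fun t ht => ?_).trans
          (add_le_add le_rfl (e2.trans ?_))
        · have ht' : t ∈ Icc 0 Real.pi := ⟨ht.1, ht.2.trans hx.2⟩
          obtain ⟨q1, -, q2⟩ := hf' t ht' (s - x + t)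
            (abs_le.2 ⟨by linarith [ht.1, ht.2], by linarith [ht.1, ht.2]⟩)
          rw [show s - x + t + t = s - x + 2 * t by ring] at q1
          have q3 : ‖P t (s - x + t)‖ ≤ m * w t + ‖P 0 (s - x + 2 * t)‖ := by
            have := norm_sub_norm_le (P t (s - x + t)) (P 0 (s - x + 2 * t))
            linarith
          calc ‖(σ t : ℂ) * P t (s - x + t) + (σ t : ℂ) ^ 2 * U t (s - x + t)‖
              ≤ |σ t| * ‖P t (s - x + t)‖ + σ t ^ 2 * ‖U t (s - x + t)‖ := by
                refine (norm_add_le _ _).trans (le_of_eq ?_)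
                rw [norm_mul, norm_mul, norm_pow, Complex.norm_real, Real.norm_eq_abs, sq_abs]
            _ ≤ |σ t| * (m * w t + ‖P 0 (s - x + 2 * t)‖) + σ t ^ 2 * (m * w t) := by gcongr
            _ ≤ k t * (m * w t) + |σ t| * ‖P 0 (s - x + 2 * t)‖ := by
                have : 0 ≤ m * w t := by have := hwpos t; positivity
                simp only [hk_def]
                linarith
        · exact mul_le_mul_of_nonneg_right (by linarith) hB.le
      · rw [hU x hx s]
        obtain ⟨e1, e2⟩ := integral_mul_norm_comp_le (f := fun _ => 1) hPc hB hPB (c := s) (d := 1)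
          (by norm_num) hx.1 (abs_le.2 ⟨by linarith [hx.1], by linarith [hx.1]⟩)
          (abs_le.2 ⟨by linarith [hx.1], by linarith [hx.1]⟩) h1x (by simp) h1x'
        obtain ⟨e3, e4⟩ := integral_mul_norm_comp_le (f := fun _ => 1) hQc hB hQB (c := s) (d := -1)
          (by norm_num) hx.1 (abs_le.2 ⟨by linarith [hx.1], by linarith [hx.1]⟩)
          (abs_le.2 ⟨by linarith [hx.1], by linarith [hx.1]⟩) h1x (by simp) h1x'
        simp only [abs_one, one_mul, neg_one_mul] at e1 e2 e3 e4
        have e5 := (e1.add e3).div_const 2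
        have key := norm_integral_le_expWeight_add hk hk0 hx hm e5
          (F := fun t => (σ t : ℂ) * U t s + (P t s - Q t s) / 2) (fun t ht => by
          have ht' : t ∈ Icc 0 Real.pi := ⟨ht.1, ht.2.trans hx.2⟩
          obtain ⟨q1, q2, q3⟩ := hf' t ht' s
            (abs_le.2 ⟨by linarith [ht.1, ht.2], by linarith [ht.1, ht.2]⟩)
          have q4 : ‖P t s‖ ≤ m * w t + ‖P 0 (s + t)‖ := by
            have := norm_sub_norm_le (P t s) (P 0 (s + t))
            linarith
          have q5 : ‖Q t s‖ ≤ m * w t + ‖Q 0 (s + -t)‖ := by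
            have := norm_sub_norm_le (Q t s) (Q 0 (s - t))
            rw [← sub_eq_add_neg]
            linarith
          calc ‖(σ t : ℂ) * U t s + (P t s - Q t s) / 2‖
              ≤ |σ t| * ‖U t s‖ + (‖P t s‖ + ‖Q t s‖) / 2 := by
                refine (norm_add_le _ _).trans (add_le_add (le_of_eq ?_) ?_)
                · rw [norm_mul, Complex.norm_real, Real.norm_eq_abs]
                · rw [norm_div, Complex.norm_ofNat]
                  gcongr
                  exact norm_sub_le _ _
            _ ≤ |σ t| * (m * w t)
                + (m * w t + ‖P 0 (s + t)‖ + (m * w t + ‖Q 0 (s + -t)‖)) / 2 := by gcongr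
            _ ≤ k t * (m * w t) + (‖P 0 (s + t)‖ + ‖Q 0 (s + -t)‖) / 2 := by
                have : 0 ≤ σ t ^ 2 * (m * w t) := by have := hwpos t; positivity
                simp only [hk_def]
                linarith)
        have e6 : ∫ t in (0 : ℝ)..x, (‖P 0 (s + t)‖ + ‖Q 0 (s + -t)‖) / 2 ≤ (Real.pi + 1) * B := by
          rw [intervalIntegral.integral_div, integral_add e1 e3]
          linarith
        have e7 := hUB s ⟨by linarith [hx.1], by linarith [hx.1]⟩
        refine (norm_add_le _ _).trans ?_
        have : 0 ≤ I * B := by positivity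
        simp only [hA_def]
        linarith
  have hfin := main ⟨(Real.pi, 0), ⟨hpi0.le, le_rfl⟩, by simp⟩
  simp only [f] at hfin
  rw [inv_mul_le_iff₀ (hwpos _), zero_add, zero_sub] at hfin
  have e : w Real.pi * (2 * (A * B)) = 2 * A * w Real.pi * B := by ring
  rw [e] at hfin
  exact ⟨(le_max_left _ _).trans hfin, (le_max_left _ _).trans ((le_max_right _ _).trans hfin),
    (le_max_right _ _).trans ((le_max_right _ _).trans hfin)⟩

end TreeSL

/-! ### Superpositions of solutions as a hyperbolic system -/

namespace TreeSL

open Set intervalIntegral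

/-- Estimates for superpositions `∑ y(x, lam) g(s)` of solutions with the same initial data, where
`g'' = -lam g`. -/
theorem cauchySolution_sum_bound {σ : ℝ → ℝ} (hσ : MemLp σ 2 (intervalMeasure Real.pi)) :
    ∃ M, 0 ≤ M ∧ ∀ (S : Finset ℂ) (lam : ℂ → ℂ) (a b : ℂ) (g h : ℂ → ℝ → ℂ) (B : ℝ), 0 < B →
      (∀ ρ ∈ S, ∀ s, HasDerivAt (g ρ) (h ρ s) s) →
      (∀ ρ ∈ S, ∀ s, HasDerivAt (h ρ) (-(lam ρ * g ρ s)) s) →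
      ∫ s in -Real.pi..Real.pi, ‖a * ∑ ρ ∈ S, h ρ s + b * ∑ ρ ∈ S, g ρ s‖ ^ 2 ≤ B ^ 2 →
      ∫ s in -Real.pi..Real.pi, ‖a * ∑ ρ ∈ S, h ρ s - b * ∑ ρ ∈ S, g ρ s‖ ^ 2 ≤ B ^ 2 →
      (∀ s ∈ Icc (-Real.pi) Real.pi, ‖a * ∑ ρ ∈ S, g ρ s‖ ≤ B) →
      ‖∑ ρ ∈ S, (cauchySolution σ (lam ρ) a b).1 Real.pi * h ρ 0
          - (a * (∑ ρ ∈ S, h ρ Real.pi + ∑ ρ ∈ S, h ρ (-Real.pi))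
            + b * (∑ ρ ∈ S, g ρ Real.pi - ∑ ρ ∈ S, g ρ (-Real.pi))) / 2‖ ≤ M * B ∧
      ‖∑ ρ ∈ S, (cauchySolution σ (lam ρ) a b).2 Real.pi * g ρ 0
          - (a * (∑ ρ ∈ S, h ρ Real.pi - ∑ ρ ∈ S, h ρ (-Real.pi))
            + b * (∑ ρ ∈ S, g ρ Real.pi + ∑ ρ ∈ S, g ρ (-Real.pi))) / 2‖ ≤ M * B ∧
      ‖∑ ρ ∈ S, (cauchySolution σ (lam ρ) a b).1 Real.pi * g ρ 0‖ ≤ M * B := by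
  obtain ⟨M, hM, key⟩ := lightCone_bound hσ
  refine ⟨M, hM, ?_⟩
  intro S lam a b g h B hB hg hh hPB hQB hUB
  set y : ℂ → ℝ → ℂ := fun ρ => (cauchySolution σ (lam ρ) a b).1 with hy_def
  set z : ℂ → ℝ → ℂ := fun ρ => (cauchySolution σ (lam ρ) a b).2 with hz_def
  have hsol : ∀ ρ, IsSolution σ (lam ρ) (y ρ) (z ρ) := fun ρ => (cauchySolution_spec hσ _ _ _).1
  have hy0 : ∀ ρ, y ρ 0 = a := fun ρ => (cauchySolution_spec hσ _ _ _).2.1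
  have hz0 : ∀ ρ, z ρ 0 = b := fun ρ => (cauchySolution_spec hσ _ _ _).2.2
  have hgc : ∀ ρ ∈ S, Continuous (g ρ) := fun ρ hρ =>
    continuous_iff_continuousAt.2 fun s => (hg ρ hρ s).continuousAt
  have hhc : ∀ ρ ∈ S, Continuous (h ρ) := fun ρ hρ =>
    continuous_iff_continuousAt.2 fun s => (hh ρ hρ s).continuousAt
  -- Riemann invariants: `P` propagates along `s + x`, `Q` along `s - x`. Because `g'' = -lam g`,
  -- the spectral parameter cancels from their equations, so one constant `M` serves all sums,
  -- whatever the frequencies.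
  let P : ℝ → ℝ → ℂ := fun x s => ∑ ρ ∈ S, (y ρ x * h ρ s + z ρ x * g ρ s)
  let Q : ℝ → ℝ → ℂ := fun x s => ∑ ρ ∈ S, (y ρ x * h ρ s + (-1) * (z ρ x * g ρ s))
  let U : ℝ → ℝ → ℂ := fun x s => ∑ ρ ∈ S, y ρ x * g ρ s
  have hP0 : P 0 = fun s => a * ∑ ρ ∈ S, h ρ s + b * ∑ ρ ∈ S, g ρ s := by
    funext s
    simp only [P, hy0, hz0, Finset.sum_add_distrib, Finset.mul_sum]
  have hQ0 : Q 0 = fun s => a * ∑ ρ ∈ S, h ρ s - b * ∑ ρ ∈ S, g ρ s := by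
    funext s
    simp only [Q, hy0, hz0, Finset.sum_add_distrib, Finset.mul_sum, sub_eq_add_neg, neg_one_mul,
      Finset.sum_neg_distrib]
  have hU0 : U 0 = fun s => a * ∑ ρ ∈ S, g ρ s := by
    funext s
    simp only [U, hy0, Finset.mul_sum]
  have hsumc : ∀ f : ℂ → ℝ → ℂ, (∀ ρ ∈ S, Continuous (f ρ)) →
      Continuous fun s => ∑ ρ ∈ S, f ρ s := fun f hf => continuous_finsetSum _ hf
  have hP : ∀ x ∈ Icc 0 Real.pi, ∀ s, P x s = P 0 (s + x) + ∫ t in (0 : ℝ)..x,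
      ((σ t : ℂ) * Q t (s + x - t) - (σ t : ℂ) ^ 2 * U t (s + x - t)) := by
    intro x hx s
    have d1 : ∀ ρ ∈ S, HasW11Deriv (fun t => h ρ (s + x - t)) (fun t => lam ρ * g ρ (s + x - t)) := by
      intro ρ hρ
      have := hgc ρ hρ
      refine hasW11Deriv_of_hasDerivAt (fun t => ?_) (by fun_prop)
      simpa using HasDerivAt.comp_const_sub (s + x) t (hh ρ hρ (s + x - t))
    have d2 : ∀ ρ ∈ S, HasW11Deriv (fun t => g ρ (s + x - t)) (fun t => -h ρ (s + x - t)) := by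
      intro ρ hρ
      have := hhc ρ hρ
      refine hasW11Deriv_of_hasDerivAt (fun t => ?_) (by fun_prop)
      exact HasDerivAt.comp_const_sub (s + x) t (hg ρ hρ (s + x - t))
    have d3 := hasW11Deriv_sum S fun ρ hρ =>
      ((hsol ρ).1.mul (d1 ρ hρ)).add ((hsol ρ).2.mul (d2 ρ hρ))
    have d4 := d3.2 x hx
    simp only [add_sub_cancel_right, sub_zero] at d4
    refine d4.trans (congrArg₂ _ rfl (integral_congr fun t _ => ?_))
    simp only [Q, U, Finset.mul_sum, ← Finset.sum_sub_distrib]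
    exact Finset.sum_congr rfl fun ρ _ => by ring
  have hQ : ∀ x ∈ Icc 0 Real.pi, ∀ s, Q x s = Q 0 (s - x) + ∫ t in (0 : ℝ)..x,
      ((σ t : ℂ) * P t (s - x + t) + (σ t : ℂ) ^ 2 * U t (s - x + t)) := by
    intro x hx s
    have d1 : ∀ ρ ∈ S,
        HasW11Deriv (fun t => h ρ (s - x + t)) (fun t => -(lam ρ * g ρ (s - x + t))) := by
      intro ρ hρ
      have := hgc ρ hρ
      refine hasW11Deriv_of_hasDerivAt (fun t => ?_) (by fun_prop)
      exact HasDerivAt.comp_const_add (s - x) t (hh ρ hρ (s - x + t))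
    have d2 : ∀ ρ ∈ S, HasW11Deriv (fun t => g ρ (s - x + t)) (fun t => h ρ (s - x + t)) := by
      intro ρ hρ
      have := hhc ρ hρ
      refine hasW11Deriv_of_hasDerivAt (fun t => ?_) (by fun_prop)
      exact HasDerivAt.comp_const_add (s - x) t (hg ρ hρ (s - x + t))
    have d0 : HasW11Deriv (fun _ => -1) (fun _ => 0) :=
      hasW11Deriv_of_hasDerivAt (fun t => hasDerivAt_const t _) continuous_const
    have d3 := hasW11Deriv_sum S fun ρ hρ =>
      ((hsol ρ).1.mul (d1 ρ hρ)).add (d0.mul ((hsol ρ).2.mul (d2 ρ hρ)))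
    have d4 := d3.2 x hx
    simp only [sub_add_cancel, add_zero] at d4
    refine d4.trans (congrArg₂ _ rfl (integral_congr fun t _ => ?_))
    simp only [P, U, Finset.mul_sum, ← Finset.sum_add_distrib]
    exact Finset.sum_congr rfl fun ρ _ => by ring
  have hU : ∀ x ∈ Icc 0 Real.pi, ∀ s, U x s = U 0 s + ∫ t in (0 : ℝ)..x,
      ((σ t : ℂ) * U t s + (P t s - Q t s) / 2) := by
    intro x hx s
    have d0 : ∀ ρ, HasW11Deriv (fun _ => g ρ s) (fun _ => 0) := fun ρ =>
      hasW11Deriv_of_hasDerivAt (fun t => hasDerivAt_const t _) continuous_const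
    have d4 := (hasW11Deriv_sum S fun ρ _ => (hsol ρ).1.mul (d0 ρ)).2 x hx
    refine d4.trans (congrArg₂ _ rfl (integral_congr fun t _ => ?_))
    simp only [P, Q, U, Finset.mul_sum, ← Finset.sum_sub_distrib, Finset.sum_div,
      ← Finset.sum_add_distrib]
    exact Finset.sum_congr rfl fun ρ _ => by ring
  have hbdd : ∃ m, ∀ x ∈ Icc 0 Real.pi, ∀ s ∈ Icc (-Real.pi) Real.pi,
      ‖P x s‖ ≤ m ∧ ‖Q x s‖ ≤ m ∧ ‖U x s‖ ≤ m := by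
    have c0 : ∀ f k : ℝ → ℂ, ContinuousOn f (Icc 0 Real.pi) → Continuous k →
        ContinuousOn (fun p : ℝ × ℝ => f p.1 * k p.2)
          (Icc 0 Real.pi ×ˢ Icc (-Real.pi) Real.pi) := by
      intro f k hf hk
      exact (hf.comp continuousOn_fst fun p hp => hp.1).mul (hk.comp continuous_snd).continuousOn
    have cy : ∀ ρ, ContinuousOn (y ρ) (Icc 0 Real.pi) := fun ρ => (hsol ρ).1.continuousOn
    have cz : ∀ ρ, ContinuousOn (z ρ) (Icc 0 Real.pi) := fun ρ => (hsol ρ).2.continuousOn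
    have hK : IsCompact (Icc 0 Real.pi ×ˢ Icc (-Real.pi) Real.pi) :=
      isCompact_Icc.prod isCompact_Icc
    obtain ⟨m1, h1⟩ := hK.exists_bound_of_continuousOn (f := fun p : ℝ × ℝ => P p.1 p.2)
      (continuousOn_finsetSum _ fun ρ hρ =>
        (c0 _ _ (cy ρ) (hhc ρ hρ)).add (c0 _ _ (cz ρ) (hgc ρ hρ)))
    obtain ⟨m2, h2⟩ := hK.exists_bound_of_continuousOn (f := fun p : ℝ × ℝ => Q p.1 p.2)
      (continuousOn_finsetSum _ fun ρ hρ =>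
        (c0 _ _ (cy ρ) (hhc ρ hρ)).add (continuousOn_const.mul (c0 _ _ (cz ρ) (hgc ρ hρ))))
    obtain ⟨m3, h3⟩ := hK.exists_bound_of_continuousOn (f := fun p : ℝ × ℝ => U p.1 p.2)
      (continuousOn_finsetSum _ fun ρ hρ => c0 _ _ (cy ρ) (hgc ρ hρ))
    refine ⟨max m1 (max m2 m3), fun x hx s hs => ⟨?_, ?_, ?_⟩⟩
    · exact (h1 (x, s) ⟨hx, hs⟩).trans (le_max_left _ _)
    · exact (h2 (x, s) ⟨hx, hs⟩).trans ((le_max_left _ _).trans (le_max_right _ _))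
    · exact (h3 (x, s) ⟨hx, hs⟩).trans ((le_max_right _ _).trans (le_max_right _ _))
  obtain ⟨r1, r2, r3⟩ := key P Q U B hB hP hQ hU hbdd
    (by rw [hP0]; have := hsumc g hgc; have := hsumc h hhc; fun_prop)
    (by rw [hQ0]; have := hsumc g hgc; have := hsumc h hhc; fun_prop)
    (by rw [hP0]; exact hPB) (by rw [hQ0]; exact hQB) (by rw [hU0]; exact hUB)
  rw [hP0] at r1
  rw [hQ0] at r2
  have e1 : P Real.pi 0 = ∑ ρ ∈ S, y ρ Real.pi * h ρ 0 + ∑ ρ ∈ S, z ρ Real.pi * g ρ 0 := by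
    simp only [P, Finset.sum_add_distrib]
  have e2 : Q Real.pi 0 = ∑ ρ ∈ S, y ρ Real.pi * h ρ 0 - ∑ ρ ∈ S, z ρ Real.pi * g ρ 0 := by
    simp only [Q, Finset.sum_add_distrib, neg_one_mul, Finset.sum_neg_distrib, sub_eq_add_neg]
  -- At `(π, 0)` the two sums of interest are half the sum and half the difference of `P` and `Q`.
  have half : ∀ u v w : ℂ, ‖u‖ ≤ M * B → ‖v‖ ≤ M * B → 2 * w = u + v → ‖w‖ ≤ M * B := by
    intro u v w hu hv hw
    have h1 : 2 * ‖w‖ = ‖u + v‖ := by rw [← hw, norm_mul, Complex.norm_ofNat]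
    have h2 := norm_add_le u v
    linarith
  refine ⟨half _ _ _ r1 r2 ?_, half _ _ _ r1 ((norm_neg _).trans_le r2) ?_, r3⟩
  · rw [e1, e2]; ring
  · rw [e1, e2]; ring

end TreeSL

namespace TreeSL

open Set intervalIntegral

/-! ### Functionals on exponential sums -/

/-- The exponential sum `∑ c(ρ) exp(i ρ s)`. -/
noncomputable def expSum (S : Finset ℂ) (c : ℂ → ℂ) (s : ℝ) : ℂ :=
  ∑ ρ ∈ S, c ρ * Complex.exp (Complex.I * ρ * s)

theorem continuous_expSum (S : Finset ℂ) (c : ℂ → ℂ) : Continuous (expSum S c) := by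
  unfold expSum; fun_prop

theorem expSum_add (S : Finset ℂ) (c : ℂ → ℂ) (s t : ℝ) :
    expSum S c (s + t) = expSum S (fun ρ => c ρ * Complex.exp (Complex.I * ρ * s)) t := by
  simp only [expSum, Complex.ofReal_add, mul_add, Complex.exp_add, mul_assoc]

/-- The two ways of measuring the size of a function on `[-a, a]`. -/
inductive Gauge : Type
  | sup
  | l2

/-- The supremum, or the `L_2`-norm, of `φ` over `[-a, a]` is at most `B`. -/
def Gauge.Le : Gauge → ℝ → (ℝ → ℂ) → ℝ → Prop
  | .sup, a, φ, B => ∀ s ∈ Icc (-a) a, ‖φ s‖ ≤ B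
  | .l2, a, φ, B => ∫ s in -a..a, ‖φ s‖ ^ 2 ≤ B ^ 2

theorem Gauge.Le.mono {n : Gauge} {a : ℝ} {φ : ℝ → ℂ} {B B' : ℝ} (h : n.Le a φ B) (hB : 0 ≤ B)
    (hBB : B ≤ B') : n.Le a φ B' := by
  cases n with
  | sup => exact fun s hs => (h s hs).trans hBB
  | l2 => exact le_trans (show _ ≤ _ from h) (by gcongr)

theorem integral_sq_mono {φ : ℝ → ℂ} (hφ : Continuous φ) {u v u' v' B : ℝ} (h1 : u' ≤ u)
    (h2 : u ≤ v) (h3 : v ≤ v') (h : ∫ s in u'..v', ‖φ s‖ ^ 2 ≤ B) :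
    ∫ s in u..v, ‖φ s‖ ^ 2 ≤ B :=
  (integral_mono_interval h1 h2 h3 (Filter.Eventually.of_forall fun s => by positivity)
    ((by fun_prop : Continuous fun s => ‖φ s‖ ^ 2).intervalIntegrable _ _)).trans h

theorem Gauge.Le.translate {n : Gauge} {a b : ℝ} (hb : 0 ≤ b) {S : Finset ℂ} {c : ℂ → ℂ} {B : ℝ}
    (h : n.Le (a + b) (expSum S c) B) {s : ℝ} (hs : s ∈ Icc (-a) a) :
    n.Le b (expSum S fun ρ => c ρ * Complex.exp (Complex.I * ρ * s)) B := by
  cases n with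
  | sup =>
    intro t ht
    rw [← expSum_add]
    exact h _ ⟨by linarith [hs.1, ht.1], by linarith [hs.2, ht.2]⟩
  | l2 =>
    simp only [Gauge.Le, ← expSum_add] at h ⊢
    rw [intervalIntegral.integral_comp_add_left (fun t => ‖expSum S c t‖ ^ 2)]
    exact integral_sq_mono (continuous_expSum S c) (by linarith [hs.1]) (by linarith)
      (by linarith [hs.2]) h

theorem Gauge.Le.restrict {n : Gauge} {a b : ℝ} (ha : 0 ≤ a) (hab : a ≤ b) {S : Finset ℂ}
    {c : ℂ → ℂ} {B : ℝ} (h : n.Le b (expSum S c) B) : n.Le a (expSum S c) B := by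
  cases n with
  | sup => exact fun s hs => h s ⟨by linarith [hs.1], by linarith [hs.2]⟩
  | l2 =>
    exact integral_sq_mono (continuous_expSum S c) (by linarith) (by linarith) hab h

/-- The functional `∑ c(ρ) exp(i ρ s) ↦ ∑ c(ρ) F(ρ)` is bounded. -/
def IsBoundedSymbol (n : Gauge) (a : ℝ) (F : ℂ → ℂ) : Prop :=
  ∃ M, 0 < M ∧ ∀ (S : Finset ℂ) (c : ℂ → ℂ) (B : ℝ), 0 < B → n.Le a (expSum S c) B →
    ‖∑ ρ ∈ S, c ρ * F ρ‖ ≤ M * B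

/-- The multiplier with the symbol `G` is bounded, with a loss of `b` in the interval. -/
def IsMultiplier (n' n : Gauge) (b : ℝ) (G : ℂ → ℂ) : Prop :=
  ∃ M, 0 < M ∧ ∀ (a : ℝ) (S : Finset ℂ) (c : ℂ → ℂ) (B : ℝ), 0 ≤ a → 0 < B →
    n'.Le (a + b) (expSum S c) B → n.Le a (expSum S fun ρ => c ρ * G ρ) (M * B)

/-- The value at `s` of the transformed sum is the functional applied to the translate by `s`, which
sees only the window `[s - b, s + b]`. -/
theorem IsBoundedSymbol.isMultiplier_sup {n : Gauge} {b : ℝ} (hb : 0 ≤ b) {G : ℂ → ℂ}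
    (hG : IsBoundedSymbol n b G) : IsMultiplier n .sup b G := by
  obtain ⟨M, hM, h⟩ := hG
  refine ⟨M, hM, fun a S c B _ hB hle s hs => ?_⟩
  have := h S _ B hB (hle.translate hb hs)
  refine le_of_eq_of_le (congrArg _ (Finset.sum_congr rfl fun ρ _ => ?_)) this
  ring

theorem norm_integral_mul_le {φ ψ : ℝ → ℂ} (hφ : Continuous φ) (hψ : Continuous ψ) {a X Y : ℝ}
    (ha : 0 ≤ a) (hX : 0 < X) (hY : 0 < Y) (h1 : ∫ s in -a..a, ‖φ s‖ ^ 2 ≤ X ^ 2)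
    (h2 : ∫ s in -a..a, ‖ψ s‖ ^ 2 ≤ Y ^ 2) :
    ‖∫ s in -a..a, φ s * starRingEnd ℂ (ψ s)‖ ≤ X * Y := by
  have c1 : Continuous fun s => ‖φ s‖ ^ 2 := by fun_prop
  have c2 : Continuous fun s => ‖ψ s‖ ^ 2 := by fun_prop
  have i1 := c1.intervalIntegrable (μ := volume) (-a) a
  have i2 := c2.intervalIntegrable (μ := volume) (-a) a
  calc ‖∫ s in -a..a, φ s * starRingEnd ℂ (ψ s)‖
      ≤ ∫ s in -a..a, (Y / (2 * X) * ‖φ s‖ ^ 2 + X / (2 * Y) * ‖ψ s‖ ^ 2) := by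
        refine norm_integral_le_of_norm_le (by linarith) (Filter.Eventually.of_forall fun s _ => ?_)
          ((i1.const_mul _).add (i2.const_mul _))
        rw [norm_mul, RCLike.norm_conj]
        have h3 : 0 ≤ Y / (2 * X) * (‖φ s‖ - X / Y * ‖ψ s‖) ^ 2 := by positivity
        have h4 : Y / (2 * X) * (‖φ s‖ - X / Y * ‖ψ s‖) ^ 2 = Y / (2 * X) * ‖φ s‖ ^ 2
            + X / (2 * Y) * ‖ψ s‖ ^ 2 - ‖φ s‖ * ‖ψ s‖ := by
          field_simp
          ring
        linarith
    _ = Y / (2 * X) * (∫ s in -a..a, ‖φ s‖ ^ 2) + X / (2 * Y) * ∫ s in -a..a, ‖ψ s‖ ^ 2 := by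
        rw [integral_add (i1.const_mul _) (i2.const_mul _), intervalIntegral.integral_const_mul,
          intervalIntegral.integral_const_mul]
    _ ≤ Y / (2 * X) * X ^ 2 + X / (2 * Y) * Y ^ 2 := by gcongr
    _ = X * Y := by field_simp; ring

/-- By duality, a symbol which is bounded in the supremum norm gives a multiplier in `L_2`. -/
theorem IsBoundedSymbol.isMultiplier_l2 {b : ℝ} {G : ℂ → ℂ}
    (hG : IsBoundedSymbol .sup b G) : IsMultiplier .l2 .l2 b G := by
  obtain ⟨M, hM, h⟩ := hG
  refine ⟨M, hM, fun a S c B ha hB hle => ?_⟩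
  set ψ := expSum S fun ρ => c ρ * G ρ with hψ
  have hψc : Continuous ψ := continuous_expSum _ _
  have hψc' : Continuous fun s => starRingEnd ℂ (ψ s) := Complex.continuous_conj.comp hψc
  change ∫ s in -a..a, ‖ψ s‖ ^ 2 ≤ (M * B) ^ 2
  set D := ∫ s in -a..a, ‖ψ s‖ ^ 2 with hD
  have hD0 : 0 ≤ D := integral_nonneg (by linarith) fun s _ => by positivity
  rcases hD0.eq_or_lt with hD1 | hD1
  · rw [← hD1]; positivity
  have hsq : 0 < √D := Real.sqrt_pos.2 hD1
  have hint : ∀ ρ : ℂ, IntervalIntegrable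
      (fun s : ℝ => Complex.exp (Complex.I * ρ * s) * starRingEnd ℂ (ψ s)) volume (-a) a :=
    fun ρ => Continuous.intervalIntegrable (by fun_prop) _ _
  -- The sum with coefficients `c'` is the correlation of `expSum S c` with `ψ`; by Cauchy-Schwarz
  -- its supremum is at most `B √D`. On it the functional takes the value `∫ |ψ|² = D`, so `D ≤ M B
  -- √D`.
  let c' : ℂ → ℂ := fun ρ =>
    c ρ * ∫ s in -a..a, Complex.exp (Complex.I * ρ * s) * starRingEnd ℂ (ψ s)
  have hconv : ∀ d : ℂ → ℂ, ∑ ρ ∈ S, d ρ *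
      (∫ s in -a..a, Complex.exp (Complex.I * ρ * s) * starRingEnd ℂ (ψ s))
      = ∫ s in -a..a, expSum S d s * starRingEnd ℂ (ψ s) := by
    intro d
    simp only [expSum, Finset.sum_mul, mul_assoc]
    rw [intervalIntegral.integral_finsetSum]
    · simp only [intervalIntegral.integral_const_mul]
    · intro ρ _
      simpa only [mul_assoc] using (hint ρ).const_mul (d ρ)
  have hc' : Gauge.sup.Le b (expSum S c') (B * √D) := by
    intro t ht
    have e1 : expSum S c' t = ∫ s in -a..a, expSum S c (t + s) * starRingEnd ℂ (ψ s) := by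
      simp only [expSum_add]
      rw [← hconv]
      refine Finset.sum_congr rfl fun ρ _ => ?_
      simp only [c']; ring
    rw [e1]
    refine norm_integral_mul_le ?_ hψc ha hB hsq ?_ ?_
    · have := continuous_expSum S c; fun_prop
    · simp only [expSum_add]
      rw [add_comm] at hle
      exact hle.translate ha ht
    · rw [Real.sq_sqrt hD0]
  have h1 := h S c' _ (by positivity) hc'
  have h2 : ∑ ρ ∈ S, c' ρ * G ρ = (D : ℂ) := by
    have : ∀ ρ, c' ρ * G ρ = (c ρ * G ρ) *
      (∫ s in -a..a, Complex.exp (Complex.I * ρ * s) * starRingEnd ℂ (ψ s)) := fun ρ => by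
        simp only [c']; ring
    simp only [this]
    rw [hconv, hD, ← intervalIntegral.integral_ofReal]
    refine integral_congr fun s _ => ?_
    simp only [← hψ, Complex.mul_conj, Complex.normSq_eq_norm_sq]
  rw [h2, Complex.norm_real, Real.norm_of_nonneg hD0] at h1
  have h3 : √D ≤ M * B := by
    have : √D * √D ≤ M * B * √D := by rw [Real.mul_self_sqrt hD0]; linarith
    exact le_of_mul_le_mul_right this hsq
  calc D = √D ^ 2 := (Real.sq_sqrt hD0).symm
    _ ≤ (M * B) ^ 2 := by gcongr

/-! ### Calculus of orders -/

/-- `Δ(ρ²)` is a function of the order `ρ^(1 - d)`: for `d ≥ 1` the symbols `ρ^j Δ(ρ²)`, `j < d`,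
are bounded, and for `d = 0` the symbol `Δ(ρ²)` is bounded in the presence of one derivative. -/
def HasOrder (n : Gauge) (a : ℝ) : ℕ → (ℂ → ℂ) → Prop
  | 0, Δ => ∃ M, 0 < M ∧ ∀ (S : Finset ℂ) (c : ℂ → ℂ) (B : ℝ), 0 < B → n.Le a (expSum S c) B →
      n.Le a (expSum S fun ρ => c ρ * ρ) B → ‖∑ ρ ∈ S, c ρ * Δ (ρ ^ 2)‖ ≤ M * B
  | d + 1, Δ => ∀ j ≤ d, IsBoundedSymbol n a fun ρ => ρ ^ j * Δ (ρ ^ 2)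

/-- The powers of `ρ` are distributed between the factors. As order `d` means size `ρ^(1 - d)`, the
orders `p` and `q + 1` combine to `p + q`. -/
theorem HasOrder.mul {n' n : Gauge} {a b : ℝ} (ha : 0 ≤ a) {p q : ℕ} {F G : ℂ → ℂ}
    (hF : HasOrder n a p F) (hG : ∀ j ≤ q, IsMultiplier n' n b fun ρ => ρ ^ j * G (ρ ^ 2)) :
    HasOrder n' (a + b) (p + q) fun lam => F lam * G lam := by
  rcases p with _ | p
  · obtain ⟨M, hM, hF⟩ := hF
    rcases q with _ | q
    · obtain ⟨M1, hM1, h1⟩ := hG 0 le_rfl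
      refine ⟨M * M1, by positivity, fun S c B hB h2 h3 => ?_⟩
      have h4 := hF S (fun ρ => c ρ * G (ρ ^ 2)) (M1 * B) (by positivity)
        (by simpa using h1 a S _ B ha hB h2)
        (by simpa [mul_right_comm] using h1 a S _ B ha hB h3)
      rw [mul_assoc]
      refine le_of_eq_of_le (congrArg _ (Finset.sum_congr rfl fun ρ _ => ?_)) h4
      ring
    · rw [show 0 + (q + 1) = q + 1 by ring]
      intro j hj
      obtain ⟨M1, hM1, h1⟩ := hG j (by omega)
      -- `F` of order 0 costs one derivative, that is one more factor `ρ`; it is taken from `G`,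
      -- which is why `j + 1 ≤ q` is needed.
      obtain ⟨M2, hM2, h2⟩ := hG (j + 1) (by omega)
      refine ⟨M * max M1 M2, by positivity, fun S c B hB h3 => ?_⟩
      have h4 := hF S (fun ρ => c ρ * (ρ ^ j * G (ρ ^ 2))) (max M1 M2 * B) (by positivity)
        ((h1 a S _ B ha hB h3).mono (by positivity) (by gcongr; exact le_max_left _ _))
        (by
          have e : (fun ρ => c ρ * (ρ ^ j * G (ρ ^ 2)) * ρ)
              = fun ρ => c ρ * (ρ ^ (j + 1) * G (ρ ^ 2)) := by funext ρ; ring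
          rw [e]
          exact (h2 a S _ B ha hB h3).mono (by positivity) (by gcongr; exact le_max_right _ _))
      rw [mul_assoc]
      refine le_of_eq_of_le (congrArg _ (Finset.sum_congr rfl fun ρ _ => ?_)) h4
      ring
  · rw [show p + 1 + q = (p + q) + 1 by ring]
    intro j hj
    -- `F` takes as many powers as it can, at most `p`; the remaining `j - min j p ≤ q` go to `G`.
    obtain ⟨M, hM, hF⟩ := hF (min j p) (min_le_right _ _)
    obtain ⟨M1, hM1, h1⟩ := hG (j - min j p) (by omega)
    refine ⟨M * M1, by positivity, fun S c B hB h2 => ?_⟩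
    have h4 := hF S _ (M1 * B) (by positivity) (h1 a S _ B ha hB h2)
    rw [mul_assoc]
    refine le_of_eq_of_le (congrArg _ (Finset.sum_congr rfl fun ρ _ => ?_)) h4
    have : ρ ^ j = ρ ^ (min j p) * ρ ^ (j - min j p) := by rw [← pow_add]; congr 1; omega
    beta_reduce
    rw [this]
    ring

theorem HasOrder.isBoundedSymbol {n : Gauge} {a : ℝ} {d j : ℕ} {F : ℂ → ℂ}
    (hF : HasOrder n a (d + 1) F) (hj : j ≤ d) :
    IsBoundedSymbol n a fun ρ => ρ ^ j * F (ρ ^ 2) := hF j hj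

theorem IsBoundedSymbol.add {n : Gauge} {a : ℝ} {F G : ℂ → ℂ} (hF : IsBoundedSymbol n a F)
    (hG : IsBoundedSymbol n a G) : IsBoundedSymbol n a fun ρ => F ρ + G ρ := by
  obtain ⟨M, hM, h⟩ := hF
  obtain ⟨M', hM', h'⟩ := hG
  refine ⟨M + M', by positivity, fun S c B hB hle => ?_⟩
  simp only [mul_add, Finset.sum_add_distrib]
  rw [add_mul]
  exact (norm_add_le _ _).trans (add_le_add (h S c B hB hle) (h' S c B hB hle))

theorem HasOrder.add {n : Gauge} {a : ℝ} {d : ℕ} {F G : ℂ → ℂ} (hF : HasOrder n a d F)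
    (hG : HasOrder n a d G) : HasOrder n a d fun lam => F lam + G lam := by
  rcases d with _ | d
  · obtain ⟨M, hM, h⟩ := hF
    obtain ⟨M', hM', h'⟩ := hG
    refine ⟨M + M', by positivity, fun S c B hB hle hle' => ?_⟩
    simp only [mul_add, Finset.sum_add_distrib]
    rw [add_mul]
    exact (norm_add_le _ _).trans (add_le_add (h S c B hB hle hle') (h' S c B hB hle hle'))
  · intro j hj
    simpa only [mul_add] using (hF j hj).add (hG j hj)

theorem hasOrder_zero (n : Gauge) (a : ℝ) (d : ℕ) : HasOrder n a d fun _ => 0 := by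
  rcases d with _ | d
  · exact ⟨1, one_pos, fun S c B hB _ _ => by simpa using hB.le⟩
  · exact fun j _ => ⟨1, one_pos, fun S c B hB _ => by simpa using hB.le⟩

theorem HasOrder.mono {n : Gauge} {a b : ℝ} (ha : 0 ≤ a) (hab : a ≤ b) {d : ℕ} {F : ℂ → ℂ}
    (hF : HasOrder n a d F) : HasOrder n b d F := by
  rcases d with _ | d
  · obtain ⟨M, hM, h⟩ := hF
    exact ⟨M, hM, fun S c B hB h1 h2 => h S c B hB (h1.restrict ha hab) (h2.restrict ha hab)⟩
  · intro j hj
    obtain ⟨M, hM, h⟩ := hF j hj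
    exact ⟨M, hM, fun S c B hB h1 => h S c B hB (h1.restrict ha hab)⟩

/-! ### Pairs with an `L_2` difference -/

/-- A pair of functions of the same order, whose difference is of the same order in `L_2`. -/
structure Admissible (a : ℝ) (d : ℕ) (F F' : ℂ → ℂ) : Prop where
  left : HasOrder .sup a d F
  right : HasOrder .sup a d F'
  diff : HasOrder .l2 a d fun lam => F lam - F' lam

/-- The difference is `(F - F') G + F' (G - G')`. In the first term `G` acts from `L_2` to `L_2` by
duality, then `F - F'` is applied; in the second `G - G'` maps `L_2` to the supremum norm, where
`F'` is bounded. -/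
theorem Admissible.mul {a b : ℝ} (ha : 0 ≤ a) (hb : 0 ≤ b) {p q : ℕ} {F F' G G' : ℂ → ℂ}
    (hF : Admissible a p F F') (hG : Admissible b (q + 1) G G') :
    Admissible (a + b) (p + q) (fun lam => F lam * G lam) (fun lam => F' lam * G' lam) := by
  have l := hF.left.mul (n' := .sup) ha fun j hj =>
    (hG.left.isBoundedSymbol hj).isMultiplier_sup hb
  have r := hF.right.mul (n' := .sup) ha fun j hj =>
    (hG.right.isBoundedSymbol hj).isMultiplier_sup hb
  have h1 := hF.diff.mul (n' := .l2) ha fun j hj => (hG.left.isBoundedSymbol hj).isMultiplier_l2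
  have h2 := hF.right.mul (n' := .l2) (G := fun lam => G lam - G' lam) ha fun j hj =>
    (hG.diff.isBoundedSymbol hj).isMultiplier_sup hb
  have e : (fun lam => F lam * G lam - F' lam * G' lam)
      = fun lam => (F lam - F' lam) * G lam + F' lam * (G lam - G' lam) := by funext lam; ring
  have d := h1.add h2
  rw [← e] at d
  exact ⟨l, r, d⟩

theorem Admissible.add {a : ℝ} {d : ℕ} {F F' G G' : ℂ → ℂ}
    (hF : Admissible a d F F') (hG : Admissible a d G G') :
    Admissible a d (fun lam => F lam + G lam) (fun lam => F' lam + G' lam) where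
  left := hF.left.add hG.left
  right := hF.right.add hG.right
  diff := by
    have e : (fun lam => F lam + G lam - (F' lam + G' lam))
        = fun lam => (F lam - F' lam) + (G lam - G' lam) := by funext lam; ring
    rw [e]
    exact hF.diff.add hG.diff

theorem admissible_zero (a : ℝ) (d : ℕ) : Admissible a d (fun _ => 0) (fun _ => 0) where
  left := hasOrder_zero _ _ _
  right := hasOrder_zero _ _ _
  diff := by simpa using hasOrder_zero _ _ _

/-- The symbol 1 is evaluation at the origin, which needs an interval of length zero only. -/
theorem admissible_one : Admissible 0 1 (fun _ => 1) (fun _ => 1) := by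
  have h : HasOrder .sup 0 1 fun _ => 1 := by
    intro j hj
    obtain rfl : j = 0 := Nat.le_zero.1 hj
    refine ⟨1, one_pos, fun S c B hB h => ?_⟩
    simpa [expSum] using h 0 (by simp)
  exact ⟨h, h, by simpa using hasOrder_zero _ _ _⟩

theorem Admissible.sum {ι : Type*} (s : Finset ι) {a : ℝ} {d : ℕ} {F F' : ι → ℂ → ℂ}
    (h : ∀ i ∈ s, Admissible a d (F i) (F' i)) :
    Admissible a d (fun lam => ∑ i ∈ s, F i lam) (fun lam => ∑ i ∈ s, F' i lam) := by
  induction s using Finset.induction_on with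
  | empty => simpa using admissible_zero a d
  | insert i s hi ih =>
    simp only [Finset.sum_insert hi]
    exact (h i (by simp)).add (ih fun j hj => h j (by simp [hj]))

theorem Admissible.prod {ι : Type*} (s : Finset ι) {a : ι → ℝ} (ha : ∀ i ∈ s, 0 ≤ a i)
    {r : ι → ℕ} {F F' : ι → ℂ → ℂ} (h : ∀ i ∈ s, Admissible (a i) (r i + 1) (F i) (F' i)) :
    Admissible (∑ i ∈ s, a i) (∑ i ∈ s, r i + 1) (fun lam => ∏ i ∈ s, F i lam)
      (fun lam => ∏ i ∈ s, F' i lam) := by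
  induction s using Finset.induction_on with
  | empty => simpa using admissible_one
  | insert i s hi ih =>
    simp only [Finset.sum_insert hi, Finset.prod_insert hi]
    have h1 := ih (fun j hj => ha j (by simp [hj])) fun j hj => h j (by simp [hj])
    have := (h i (by simp)).mul (ha i (by simp))
      (Finset.sum_nonneg fun j hj => ha j (by simp [hj])) h1
    rwa [show r i + 1 + ∑ j ∈ s, r j = r i + ∑ j ∈ s, r j + 1 by ring] at this

/-- Each summand contains exactly one Neumann factor, and this lowers the order of the Dirichlet
product by one. -/
theorem Admissible.glue {ι : Type*} [DecidableEq ι] (s : Finset ι) {a : ι → ℝ}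
    (ha : ∀ i ∈ s, 0 ≤ a i) {r : ι → ℕ} {N N' D D' : ι → ℂ → ℂ}
    (hN : ∀ i ∈ s, Admissible (a i) (r i) (N i) (N' i))
    (hD : ∀ i ∈ s, Admissible (a i) (r i + 1) (D i) (D' i)) :
    Admissible (∑ i ∈ s, a i) (∑ i ∈ s, r i)
      (fun lam => MetricTree.glue s (fun i => N i lam) (fun i => D i lam))
      (fun lam => MetricTree.glue s (fun i => N' i lam) (fun i => D' i lam)) := by
  refine Admissible.sum s fun i hi => ?_
  rw [← Finset.add_sum_erase _ _ hi, ← Finset.add_sum_erase _ r hi]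
  have he : ∀ j ∈ s.erase i, j ∈ s := fun j hj => Finset.mem_of_mem_erase hj
  exact (hN i hi).mul (ha i hi) (Finset.sum_nonneg fun j hj => ha j (he j hj))
    (Admissible.prod _ (fun j hj => ha j (he j hj)) fun j hj => hD j (he j hj))

theorem Admissible.mono {a b : ℝ} (ha : 0 ≤ a) (hab : a ≤ b) {d : ℕ} {F F' : ℂ → ℂ}
    (h : Admissible a d F F') : Admissible b d F F' :=
  ⟨h.left.mono ha hab, h.right.mono ha hab, h.diff.mono ha hab⟩

end TreeSL

namespace TreeSL

open Set intervalIntegral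

/-! ### The characteristic functions of one edge -/

theorem integral_norm_le_of_integral_sq_le {φ : ℝ → ℂ} (hφ : Continuous φ) {a B : ℝ} (ha : 0 ≤ a)
    (hB : 0 < B) (h : ∫ s in -a..a, ‖φ s‖ ^ 2 ≤ B ^ 2) :
    ∫ s in -a..a, ‖φ s‖ ≤ (2 * a + 1) * B := by
  have i2 : IntervalIntegrable (fun s => B⁻¹ * ‖φ s‖ ^ 2) volume (-a) a :=
    Continuous.intervalIntegrable (by fun_prop) _ _
  calc ∫ s in -a..a, ‖φ s‖ ≤ ∫ s in -a..a, (B + B⁻¹ * ‖φ s‖ ^ 2) := by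
        refine integral_mono_on (by linarith) (hφ.norm.intervalIntegrable _ _)
          (intervalIntegrable_const.add i2) fun s _ => ?_
        have h1 : 0 ≤ B⁻¹ * (‖φ s‖ - B) ^ 2 := by positivity
        have h2 : B⁻¹ * (‖φ s‖ - B) ^ 2 = B + B⁻¹ * ‖φ s‖ ^ 2 - 2 * ‖φ s‖ := by
          field_simp
          ring
        linarith [norm_nonneg (φ s)]
    _ = 2 * a * B + B⁻¹ * ∫ s in -a..a, ‖φ s‖ ^ 2 := by
        rw [integral_add intervalIntegrable_const i2, intervalIntegral.integral_const_mul,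
          intervalIntegral.integral_const, smul_eq_mul]
        ring
    _ ≤ 2 * a * B + B⁻¹ * B ^ 2 := by gcongr
    _ = (2 * a + 1) * B := by field_simp

theorem norm_sub_le_integral_norm_deriv {f f' : ℝ → ℂ} (hf : ∀ s, HasDerivAt f (f' s) s)
    (hc : Continuous f') {a s t : ℝ} (hs : s ∈ Icc (-a) a) (ht : t ∈ Icc (-a) a) :
    ‖f s - f t‖ ≤ ∫ u in -a..a, ‖f' u‖ := by
  wlog hts : t ≤ s generalizing s t
  · rw [norm_sub_rev]; exact this ht hs (le_of_not_ge hts)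
  rw [← integral_eq_sub_of_hasDerivAt (fun u _ => hf u) (hc.intervalIntegrable _ _)]
  exact (intervalIntegral.norm_integral_le_integral_norm hts).trans
    (integral_mono_interval ht.1 hts hs.2 (Filter.Eventually.of_forall fun _ => norm_nonneg _)
      (hc.norm.intervalIntegrable _ _))

/-- Sobolev embedding: `|f(s)|` is compared with the mean of `|f|` over `[-a, a]`, up to the
integral of `|f'|`. -/
theorem norm_le_of_integral_sq_le {f f' : ℝ → ℂ} (hf : ∀ s, HasDerivAt f (f' s) s)
    (hc : Continuous f') {a B : ℝ} (ha : 0 < a) (hB : 0 < B)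
    (h : ∫ s in -a..a, ‖f s‖ ^ 2 ≤ B ^ 2) (h' : ∫ s in -a..a, ‖f' s‖ ^ 2 ≤ B ^ 2) {s : ℝ}
    (hs : s ∈ Icc (-a) a) : ‖f s‖ ≤ (2 * a + 1) * (1 + (2 * a)⁻¹) * B := by
  have hfc : Continuous f := continuous_iff_continuousAt.2 fun s => (hf s).continuousAt
  have h1 := integral_norm_le_of_integral_sq_le hfc ha.le hB h
  have h2 := integral_norm_le_of_integral_sq_le hc ha.le hB h'
  have h3 : ∫ t in -a..a, (‖f s‖ - (2 * a + 1) * B) ≤ ∫ t in -a..a, ‖f t‖ := by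
    refine integral_mono_on (by linarith) intervalIntegrable_const
      (hfc.norm.intervalIntegrable _ _) fun t ht => ?_
    have h4 := norm_sub_le_integral_norm_deriv hf hc hs ht
    have h5 := norm_sub_norm_le (f s) (f t)
    linarith
  rw [intervalIntegral.integral_const, smul_eq_mul] at h3
  have h6 : (2 * a) * (‖f s‖ - (2 * a + 1) * B) ≤ (2 * a + 1) * B := by linarith
  have h7 : ‖f s‖ - (2 * a + 1) * B ≤ (2 * a)⁻¹ * ((2 * a + 1) * B) := by
    rwa [le_inv_mul_iff₀ (by positivity)]
  linarith

theorem hasDerivAt_exp_mul (ρ : ℂ) (s : ℝ) :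
    HasDerivAt (fun s : ℝ => Complex.exp (Complex.I * ρ * s))
      (Complex.I * ρ * Complex.exp (Complex.I * ρ * s)) s := by
  have h1 : HasDerivAt (fun s : ℝ => Complex.I * ρ * (s : ℂ)) (Complex.I * ρ) s := by
    simpa using (Complex.ofRealCLM.hasDerivAt (x := s)).const_mul (Complex.I * ρ)
  simpa [mul_comm] using h1.cexp

theorem hasDerivAt_expSum (S : Finset ℂ) (c : ℂ → ℂ) (s : ℝ) :
    HasDerivAt (expSum S c) (Complex.I * expSum S (fun ρ => c ρ * ρ) s) s := by
  have := HasDerivAt.fun_sum fun ρ (_ : ρ ∈ S) => (hasDerivAt_exp_mul ρ s).const_mul (c ρ)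
  refine this.congr_deriv ?_
  simp only [expSum, Finset.mul_sum]
  exact Finset.sum_congr rfl fun ρ _ => by ring

/-! ### Asymptotics of the symbols of one edge -/

/-- Up to a remainder, which is bounded in `L_2(-π, π)`, the functional with the symbol `F` is
`φ ↦ α φ(π) + β φ(-π)`. -/
def NearBoundary (F : ℂ → ℂ) (α β : ℂ) : Prop :=
  ∃ M, 0 < M ∧ ∀ (S : Finset ℂ) (c : ℂ → ℂ) (B : ℝ), 0 < B →
    Gauge.l2.Le Real.pi (expSum S c) B → ‖∑ ρ ∈ S, c ρ * F ρ
      - (α * expSum S c Real.pi + β * expSum S c (-Real.pi))‖ ≤ M * B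

/-- The analogue of `NearBoundary` for the order `0`. -/
def NearBoundaryDeriv (F : ℂ → ℂ) (α β : ℂ) : Prop :=
  ∃ M, 0 < M ∧ ∀ (S : Finset ℂ) (c : ℂ → ℂ) (B : ℝ), 0 < B →
    Gauge.l2.Le Real.pi (expSum S c) B → Gauge.l2.Le Real.pi (expSum S fun ρ => c ρ * ρ) B →
      ‖∑ ρ ∈ S, c ρ * F ρ - (α * expSum S (fun ρ => c ρ * ρ) Real.pi
        + β * expSum S (fun ρ => c ρ * ρ) (-Real.pi))‖ ≤ M * B

/-- The point evaluations, which are not bounded in `L_2`, do not depend on the potential and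
cancel. This is the source of the `L_2` bound in `Admissible`. -/
theorem NearBoundary.diff {F F' : ℂ → ℂ} {α β : ℂ} (h : NearBoundary F α β)
    (h' : NearBoundary F' α β) : IsBoundedSymbol .l2 Real.pi fun ρ => F ρ - F' ρ := by
  obtain ⟨M, hM, h⟩ := h
  obtain ⟨M', hM', h'⟩ := h'
  refine ⟨M + M', by positivity, fun S c B hB hle => ?_⟩
  have := (norm_sub_le _ _).trans (add_le_add (h S c B hB hle) (h' S c B hB hle))
  rw [sub_sub_sub_cancel_right, ← Finset.sum_sub_distrib, ← add_mul] at this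
  simpa only [mul_sub] using this

theorem NearBoundaryDeriv.diff {F F' : ℂ → ℂ} {α β : ℂ} (h : NearBoundaryDeriv F α β)
    (h' : NearBoundaryDeriv F' α β) : ∃ M, 0 < M ∧ ∀ (S : Finset ℂ) (c : ℂ → ℂ) (B : ℝ), 0 < B →
      Gauge.l2.Le Real.pi (expSum S c) B → Gauge.l2.Le Real.pi (expSum S fun ρ => c ρ * ρ) B →
      ‖∑ ρ ∈ S, c ρ * (F ρ - F' ρ)‖ ≤ M * B := by
  obtain ⟨M, hM, h⟩ := h
  obtain ⟨M', hM', h'⟩ := h'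
  refine ⟨M + M', by positivity, fun S c B hB hle hle' => ?_⟩
  have := (norm_sub_le _ _).trans (add_le_add (h S c B hB hle hle') (h' S c B hB hle hle'))
  rw [sub_sub_sub_cancel_right, ← Finset.sum_sub_distrib, ← add_mul] at this
  simpa only [mul_sub] using this

theorem Gauge.Le.l2_of_sup {S : Finset ℂ} {c : ℂ → ℂ} {B : ℝ} (hB : 0 < B)
    (h : Gauge.sup.Le Real.pi (expSum S c) B) :
    Gauge.l2.Le Real.pi (expSum S c) ((2 * Real.pi + 1) * B) := by
  have hpi := Real.pi_pos
  have hc := continuous_expSum S c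
  calc ∫ s in -Real.pi..Real.pi, ‖expSum S c s‖ ^ 2 ≤ ∫ s in -Real.pi..Real.pi, B ^ 2 := by
        refine integral_mono_on (by linarith) (Continuous.intervalIntegrable (by fun_prop) _ _)
          intervalIntegrable_const fun s hs => ?_
        have := h s hs
        gcongr
    _ = 2 * Real.pi * B ^ 2 := by
        rw [intervalIntegral.integral_const, smul_eq_mul]; ring
    _ ≤ ((2 * Real.pi + 1) * B) ^ 2 := by
        have h1 : 0 ≤ (4 * Real.pi ^ 2 + 2 * Real.pi + 1) * B ^ 2 := by positivity
        nlinarith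

theorem norm_boundary_le {φ : ℝ → ℂ} {B : ℝ} (h : Gauge.sup.Le Real.pi φ B) (α β : ℂ) :
    ‖α * φ Real.pi + β * φ (-Real.pi)‖ ≤ (‖α‖ + ‖β‖) * B := by
  have hpi := Real.pi_pos
  have h1 := h Real.pi ⟨by linarith, le_rfl⟩
  have h2 := h (-Real.pi) ⟨le_rfl, by linarith⟩
  rw [add_mul]
  refine (norm_add_le _ _).trans ?_
  rw [norm_mul, norm_mul]
  gcongr

theorem NearBoundary.isBoundedSymbol {F : ℂ → ℂ} {α β : ℂ} (h : NearBoundary F α β) :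
    IsBoundedSymbol .sup Real.pi F := by
  have hpi := Real.pi_pos
  obtain ⟨M, hM, h⟩ := h
  refine ⟨M * (2 * Real.pi + 1) + (‖α‖ + ‖β‖), by positivity, fun S c B hB hle => ?_⟩
  have h1 := h S c _ (by positivity) (hle.l2_of_sup hB)
  have h2 := norm_boundary_le hle α β
  have h3 := norm_sub_norm_le (∑ ρ ∈ S, c ρ * F ρ)
    (α * expSum S c Real.pi + β * expSum S c (-Real.pi))
  linarith

theorem NearBoundaryDeriv.bound {F : ℂ → ℂ} {α β : ℂ} (h : NearBoundaryDeriv F α β) :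
    ∃ M, 0 < M ∧ ∀ (S : Finset ℂ) (c : ℂ → ℂ) (B : ℝ), 0 < B →
      Gauge.sup.Le Real.pi (expSum S c) B → Gauge.sup.Le Real.pi (expSum S fun ρ => c ρ * ρ) B →
      ‖∑ ρ ∈ S, c ρ * F ρ‖ ≤ M * B := by
  have hpi := Real.pi_pos
  obtain ⟨M, hM, h⟩ := h
  refine ⟨M * (2 * Real.pi + 1) + (‖α‖ + ‖β‖), by positivity, fun S c B hB hle hle' => ?_⟩
  have h1 := h S c _ (by positivity) (hle.l2_of_sup hB) (hle'.l2_of_sup hB)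
  have h2 := norm_boundary_le hle' α β
  have h3 := norm_sub_norm_le (∑ ρ ∈ S, c ρ * F ρ)
    (α * expSum S (fun ρ => c ρ * ρ) Real.pi + β * expSum S (fun ρ => c ρ * ρ) (-Real.pi))
  linarith

theorem NearBoundary.add_smul {F G : ℂ → ℂ} {α β : ℂ} (h : NearBoundary F α β)
    (h' : NearBoundary G 0 0) (γ : ℝ) : NearBoundary (fun ρ => F ρ + γ * G ρ) α β := by
  obtain ⟨M, hM, h⟩ := h
  obtain ⟨M', hM', h'⟩ := h'
  refine ⟨M + |γ| * M', by positivity, fun S c B hB hle => ?_⟩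
  have h1 := h S c B hB hle
  have h2 := h' S c B hB hle
  rw [zero_mul, zero_mul, add_zero, sub_zero] at h2
  have e : ∑ ρ ∈ S, c ρ * (F ρ + γ * G ρ) - (α * expSum S c Real.pi + β * expSum S c (-Real.pi))
      = (∑ ρ ∈ S, c ρ * F ρ - (α * expSum S c Real.pi + β * expSum S c (-Real.pi)))
        + γ * ∑ ρ ∈ S, c ρ * G ρ := by
    simp only [mul_add, Finset.sum_add_distrib, Finset.mul_sum]
    rw [add_sub_right_comm]
    exact congrArg₂ _ rfl (Finset.sum_congr rfl fun ρ _ => by ring)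
  rw [e]
  refine (norm_add_le _ _).trans ?_
  rw [norm_mul, Complex.norm_real, Real.norm_eq_abs, add_mul, mul_assoc]
  gcongr

/-- For the data `(0, 1)` the initial values of `P` and `Q` are `±φ`, with `φ` the exponential sum,
and `U` starts from zero, so the `L_2`-norm of `φ` suffices. The derivative `h` at `s = 0` supplies
the extra factor `iρ`. -/
theorem sum_solS_bound {σ : ℝ → ℝ} (hσ : MemLp σ 2 (intervalMeasure Real.pi)) :
    ∃ M, 0 < M ∧ ∀ (S : Finset ℂ) (c : ℂ → ℂ) (B : ℝ), 0 < B →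
    Gauge.l2.Le Real.pi (expSum S c) B →
      ‖∑ ρ ∈ S, c ρ * solS σ (ρ ^ 2)‖ ≤ M * B ∧
      ‖∑ ρ ∈ S, c ρ * (ρ * solS σ (ρ ^ 2))
        - (-Complex.I / 2 * expSum S c Real.pi + Complex.I / 2 * expSum S c (-Real.pi))‖ ≤ M * B ∧
      ‖∑ ρ ∈ S, c ρ * solS1 σ (ρ ^ 2)
        - (1 / 2 * expSum S c Real.pi + 1 / 2 * expSum S c (-Real.pi))‖ ≤ M * B := by
  obtain ⟨M, hM, key⟩ := cauchySolution_sum_bound hσ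
  refine ⟨M + 1, by positivity, fun S c B hB hle => ?_⟩
  have hle' : ∫ s in -Real.pi..Real.pi, ‖expSum S c s‖ ^ 2 ≤ B ^ 2 := hle
  obtain ⟨h1, h2, h3⟩ := key S (fun ρ => ρ ^ 2) 0 1
    (fun ρ s => c ρ * Complex.exp (Complex.I * ρ * s))
    (fun ρ s => c ρ * (Complex.I * ρ * Complex.exp (Complex.I * ρ * s))) B hB
    (fun ρ _ s => (hasDerivAt_exp_mul ρ s).const_mul (c ρ))
    (fun ρ _ s => by
      refine (((hasDerivAt_exp_mul ρ s).const_mul (Complex.I * ρ)).const_mul (c ρ)).congr_deriv ?_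
      linear_combination (c ρ * ρ ^ 2 * Complex.exp (Complex.I * ρ * s)) * Complex.I_mul_I)
    (by simpa [expSum] using hle') (by simpa [expSum] using hle') (by simp [hB.le])
  have hMB : M * B ≤ (M + 1) * B := by gcongr; linarith
  simp only [zero_mul, one_mul, zero_add, Complex.ofReal_zero, mul_zero, Complex.exp_zero,
    mul_one] at h1 h2 h3
  refine ⟨?_, ?_, ?_⟩
  · refine (le_of_eq (congrArg _ (Finset.sum_congr rfl fun ρ _ => ?_))).trans (h3.trans hMB)
    rw [mul_comm]; rfl
  · have e : ∑ ρ ∈ S, c ρ * (ρ * solS σ (ρ ^ 2))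
        - (-Complex.I / 2 * expSum S c Real.pi + Complex.I / 2 * expSum S c (-Real.pi))
        = -Complex.I * (∑ ρ ∈ S, (cauchySolution σ (ρ ^ 2) 0 1).1 Real.pi * (c ρ * (Complex.I * ρ))
          - (expSum S c Real.pi - expSum S c (-Real.pi)) / 2) := by
      rw [mul_sub, Finset.mul_sum]
      have : ∀ ρ ∈ S, -Complex.I * ((cauchySolution σ (ρ ^ 2) 0 1).1 Real.pi
          * (c ρ * (Complex.I * ρ))) = c ρ * (ρ * solS σ (ρ ^ 2)) := fun ρ _ => by
        rw [solS]
        linear_combination (-(cauchySolution σ (ρ ^ 2) 0 1).1 Real.pi * c ρ * ρ) * Complex.I_mul_I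
      rw [Finset.sum_congr rfl this]
      ring
    rw [e, norm_mul, norm_neg, Complex.norm_I, one_mul]
    exact h1.trans hMB
  · refine (le_of_eq (congrArg _ ?_)).trans (h2.trans hMB)
    have : ∀ ρ ∈ S, c ρ * solS1 σ (ρ ^ 2) = (cauchySolution σ (ρ ^ 2) 0 1).2 Real.pi * c ρ :=
      fun ρ _ => by rw [mul_comm]; rfl
    rw [Finset.sum_congr rfl this]
    simp only [expSum]
    ring

/-- For the data `(1, 0)` the waves start from the derivative of the exponential sum and `U` from
the sum itself; hence the control of one derivative. -/
theorem nearBoundaryDeriv_solC1 {σ : ℝ → ℝ} (hσ : MemLp σ 2 (intervalMeasure Real.pi)) :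
    NearBoundaryDeriv (fun ρ => solC1 σ (ρ ^ 2)) (Complex.I / 2) (-Complex.I / 2) := by
  have hpi := Real.pi_pos
  obtain ⟨M, hM, key⟩ := cauchySolution_sum_bound hσ
  -- The Sobolev constant of `norm_le_of_integral_sq_le` for `a = π`, needed for the supremum bound
  -- on `U`.
  set K := (2 * Real.pi + 1) * (1 + (2 * Real.pi)⁻¹) with hK
  have hK1 : 1 ≤ K := by
    have : 0 ≤ (2 * Real.pi)⁻¹ := by positivity
    nlinarith
  refine ⟨(M + 1) * K, by positivity, fun S c B hB hle hle' => ?_⟩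
  have hl : ∫ s in -Real.pi..Real.pi, ‖expSum S c s‖ ^ 2 ≤ B ^ 2 := hle
  have hl' : ∫ s in -Real.pi..Real.pi, ‖Complex.I * expSum S (fun ρ => c ρ * ρ) s‖ ^ 2 ≤ B ^ 2 := by
    simpa using (show ∫ s in -Real.pi..Real.pi, ‖expSum S (fun ρ => c ρ * ρ) s‖ ^ 2 ≤ B ^ 2 from hle')
  have hBK : B ^ 2 ≤ (K * B) ^ 2 := by gcongr; nlinarith
  have hh : ∀ s : ℝ, ∑ ρ ∈ S, c ρ * (Complex.I * ρ * Complex.exp (Complex.I * ρ * s))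
      = Complex.I * expSum S (fun ρ => c ρ * ρ) s := fun s => by
    simp only [expSum, Finset.mul_sum]
    exact Finset.sum_congr rfl fun ρ _ => by ring
  obtain ⟨-, h2, -⟩ := key S (fun ρ => ρ ^ 2) 1 0
    (fun ρ s => c ρ * Complex.exp (Complex.I * ρ * s))
    (fun ρ s => c ρ * (Complex.I * ρ * Complex.exp (Complex.I * ρ * s))) (K * B) (by positivity)
    (fun ρ _ s => (hasDerivAt_exp_mul ρ s).const_mul (c ρ))
    (fun ρ _ s => by
      refine (((hasDerivAt_exp_mul ρ s).const_mul (Complex.I * ρ)).const_mul (c ρ)).congr_deriv ?_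
      linear_combination (c ρ * ρ ^ 2 * Complex.exp (Complex.I * ρ * s)) * Complex.I_mul_I)
    (by simp only [hh, one_mul, zero_mul, add_zero]; exact hl'.trans hBK)
    (by simp only [hh, one_mul, zero_mul, sub_zero]; exact hl'.trans hBK)
    (fun s hs => by
      rw [one_mul]
      exact norm_le_of_integral_sq_le (hasDerivAt_expSum S c)
        (by have := continuous_expSum S fun ρ => c ρ * ρ; fun_prop) hpi hB hl hl' hs)
  have hMB : M * (K * B) ≤ (M + 1) * K * B := by nlinarith [mul_pos (one_pos.trans_le hK1) hB]
  simp only [hh, zero_mul, one_mul, add_zero, Complex.ofReal_zero, mul_zero, Complex.exp_zero,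
    mul_one] at h2
  refine (le_of_eq (congrArg _ ?_)).trans (h2.trans hMB)
  have : ∀ ρ ∈ S, c ρ * solC1 σ (ρ ^ 2) = (cauchySolution σ (ρ ^ 2) 1 0).2 Real.pi * c ρ :=
    fun ρ _ => by rw [mul_comm]; rfl
  rw [Finset.sum_congr rfl this]
  ring

/-- The solution `sin(ρ s) / ρ` of `g'' = -ρ² g`. -/
noncomputable def sinDiv (ρ : ℂ) (s : ℝ) : ℂ :=
  if ρ = 0 then (s : ℂ) else Complex.sin (ρ * s) / ρ

theorem hasDerivAt_sinDiv (ρ : ℂ) (s : ℝ) : HasDerivAt (sinDiv ρ) (Complex.cos (ρ * s)) s := by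
  have h1 : HasDerivAt (fun s : ℝ => (s : ℂ)) 1 s := Complex.ofRealCLM.hasDerivAt (x := s)
  unfold sinDiv
  split_ifs with h
  · simpa [h] using h1
  · have h2 : HasDerivAt (fun w : ℂ => Complex.sin (ρ * w) / ρ) (Complex.cos (ρ * s) * (ρ * 1) / ρ) s :=
      (((hasDerivAt_id (s : ℂ)).const_mul ρ).csin).div_const ρ
    refine h2.comp_ofReal.congr_deriv ?_
    field_simp

theorem hasDerivAt_cos_mul (ρ : ℂ) (s : ℝ) :
    HasDerivAt (fun s : ℝ => Complex.cos (ρ * s)) (-(ρ ^ 2 * sinDiv ρ s)) s := by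
  have h2 : HasDerivAt (fun w : ℂ => Complex.cos (ρ * w)) (-Complex.sin (ρ * s) * (ρ * 1)) s :=
    ((hasDerivAt_id (s : ℂ)).const_mul ρ).ccos
  refine h2.comp_ofReal.congr_deriv ?_
  unfold sinDiv
  split_ifs with h
  · simp [h]
  · field_simp

/-- Here no derivative may be lost, so the superposition uses `h = cos ρs` and `g = sin ρs / ρ`,
regular at `ρ = 0`. The sum of the cosines is the even part of the exponential sum, and the sum of
the `g` is its primitive vanishing at 0, bounded by an `L_1`-norm. -/
theorem nearBoundary_solC {σ : ℝ → ℝ} (hσ : MemLp σ 2 (intervalMeasure Real.pi)) :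
    NearBoundary (fun ρ => solC σ (ρ ^ 2)) (1 / 2) (1 / 2) := by
  have hpi := Real.pi_pos
  obtain ⟨M, hM, key⟩ := cauchySolution_sum_bound hσ
  refine ⟨(M + 1) * (2 * Real.pi + 1), by positivity, fun S c B hB hle => ?_⟩
  have hl : ∫ s in -Real.pi..Real.pi, ‖expSum S c s‖ ^ 2 ≤ B ^ 2 := hle
  have hφ := continuous_expSum S c
  have hh : ∀ s : ℝ, ∑ ρ ∈ S, c ρ * Complex.cos (ρ * s) = (expSum S c s + expSum S c (-s)) / 2 := by
    intro s
    simp only [expSum, ← Finset.sum_add_distrib, Finset.sum_div]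
    refine Finset.sum_congr rfl fun ρ _ => ?_
    rw [Complex.cos, Complex.ofReal_neg]
    ring_nf
  have hl' : ∫ s in -Real.pi..Real.pi, ‖∑ ρ ∈ S, c ρ * Complex.cos (ρ * s)‖ ^ 2 ≤ B ^ 2 := by
    have c1 : Continuous fun s => ‖expSum S c s‖ ^ 2 := by fun_prop
    have c2 : Continuous fun s => ‖expSum S c (-s)‖ ^ 2 := by fun_prop
    have e2 : ∫ s in -Real.pi..Real.pi, ‖expSum S c (-s)‖ ^ 2
        = ∫ s in -Real.pi..Real.pi, ‖expSum S c s‖ ^ 2 := by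
      rw [intervalIntegral.integral_comp_neg (fun s => ‖expSum S c s‖ ^ 2), neg_neg]
    calc ∫ s in -Real.pi..Real.pi, ‖∑ ρ ∈ S, c ρ * Complex.cos (ρ * s)‖ ^ 2
        ≤ ∫ s in -Real.pi..Real.pi, (‖expSum S c s‖ ^ 2 + ‖expSum S c (-s)‖ ^ 2) / 2 := by
          simp only [hh]
          refine integral_mono_on (by linarith) (Continuous.intervalIntegrable (by fun_prop) _ _)
            (Continuous.intervalIntegrable (by fun_prop) _ _) fun s _ => ?_
          rw [norm_div, Complex.norm_ofNat]
          have h1 := norm_add_le (expSum S c s) (expSum S c (-s))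
          have h2 := norm_nonneg (expSum S c s + expSum S c (-s))
          have h3 := sq_nonneg (‖expSum S c s‖ - ‖expSum S c (-s)‖)
          nlinarith
      _ ≤ B ^ 2 := by
          rw [intervalIntegral.integral_div, integral_add (c1.intervalIntegrable _ _)
            (c2.intervalIntegrable _ _), e2]
          linarith
  have hcc : Continuous fun s : ℝ => ∑ ρ ∈ S, c ρ * Complex.cos (ρ * s) := by fun_prop
  have hBK : B ^ 2 ≤ ((2 * Real.pi + 1) * B) ^ 2 := by gcongr; nlinarith
  obtain ⟨h1, -, -⟩ := key S (fun ρ => ρ ^ 2) 1 0 (fun ρ s => c ρ * sinDiv ρ s)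
    (fun ρ s => c ρ * Complex.cos (ρ * s)) ((2 * Real.pi + 1) * B) (by positivity)
    (fun ρ _ s => (hasDerivAt_sinDiv ρ s).const_mul (c ρ))
    (fun ρ _ s => ((hasDerivAt_cos_mul ρ s).const_mul (c ρ)).congr_deriv (by ring))
    (by simp only [one_mul, zero_mul, add_zero]; exact hl'.trans hBK)
    (by simp only [one_mul, zero_mul, sub_zero]; exact hl'.trans hBK)
    (fun s hs => by
      rw [one_mul]
      have h2 := norm_sub_le_integral_norm_deriv (fun t => HasDerivAt.fun_sum fun ρ (_ : ρ ∈ S) =>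
        (hasDerivAt_sinDiv ρ t).const_mul (c ρ)) hcc hs (t := 0) ⟨by linarith, by linarith⟩
      have h3 : ∑ ρ ∈ S, c ρ * sinDiv ρ 0 = 0 :=
        Finset.sum_eq_zero fun ρ _ => by simp [sinDiv]
      rw [h3, sub_zero] at h2
      exact h2.trans (integral_norm_le_of_integral_sq_le hcc hpi.le hB hl'))
  have hMB : M * ((2 * Real.pi + 1) * B) ≤ (M + 1) * (2 * Real.pi + 1) * B := by
    have : 0 ≤ (2 * Real.pi + 1) * B := by positivity
    linarith
  simp only [hh, zero_mul, one_mul, add_zero, Complex.ofReal_zero, mul_zero, Complex.cos_zero,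
    mul_one, neg_neg] at h1
  refine (le_of_eq (congrArg _ ?_)).trans (h1.trans hMB)
  have : ∀ ρ ∈ S, c ρ * solC σ (ρ ^ 2) = (cauchySolution σ (ρ ^ 2) 1 0).1 Real.pi * c ρ :=
    fun ρ _ => by rw [mul_comm]; rfl
  rw [Finset.sum_congr rfl this]
  ring

theorem HasOrder.add_const_mul {n : Gauge} {a : ℝ} {F G : ℂ → ℂ} (hF : HasOrder n a 0 F)
    (hG : IsBoundedSymbol n a fun ρ => G (ρ ^ 2)) (γ : ℂ) :
    HasOrder n a 0 fun lam => F lam + γ * G lam := by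
  obtain ⟨M, hM, h⟩ := hF
  obtain ⟨M', hM', h'⟩ := hG
  refine ⟨M + ‖γ‖ * M', by positivity, fun S c B hB hle hle' => ?_⟩
  have e : ∑ ρ ∈ S, c ρ * (F (ρ ^ 2) + γ * G (ρ ^ 2))
      = ∑ ρ ∈ S, c ρ * F (ρ ^ 2) + γ * ∑ ρ ∈ S, c ρ * G (ρ ^ 2) := by
    rw [Finset.mul_sum, ← Finset.sum_add_distrib]
    exact Finset.sum_congr rfl fun ρ _ => by ring
  rw [e, add_mul, mul_assoc]
  refine (norm_add_le _ _).trans ?_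
  rw [norm_mul]
  have h1 := h S c B hB hle hle'
  have h2 := h' S c B hB hle
  gcongr

/-- The number of Dirichlet conditions. -/
def BC.order : BC → ℕ
  | .dirichlet => 1
  | .neumann => 0

theorem admissible_edgeChar {σ σ' : ℝ → ℝ} (hσ : MemLp σ 2 (intervalMeasure Real.pi))
    (hσ' : MemLp σ' 2 (intervalMeasure Real.pi)) (γ : ℝ) (b b' : BC) :
    Admissible Real.pi (b.order + b'.order) (fun lam => edgeChar σ γ lam b b')
      (fun lam => edgeChar σ' γ lam b b') := by
  have nS : ∀ {σ : ℝ → ℝ}, MemLp σ 2 (intervalMeasure Real.pi) →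
      NearBoundary (fun ρ => solS σ (ρ ^ 2)) 0 0 := fun hσ => by
    obtain ⟨M, hM, h⟩ := sum_solS_bound hσ
    exact ⟨M, hM, fun S c B hB hle => by simpa using (h S c B hB hle).1⟩
  have nS' : ∀ {σ : ℝ → ℝ}, MemLp σ 2 (intervalMeasure Real.pi) →
      NearBoundary (fun ρ => ρ * solS σ (ρ ^ 2)) (-Complex.I / 2) (Complex.I / 2) := fun hσ => by
    obtain ⟨M, hM, h⟩ := sum_solS_bound hσ
    exact ⟨M, hM, fun S c B hB hle => (h S c B hB hle).2.1⟩
  have nS1 : ∀ {σ : ℝ → ℝ}, MemLp σ 2 (intervalMeasure Real.pi) →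
      NearBoundary (fun ρ => solS1 σ (ρ ^ 2) + γ * solS σ (ρ ^ 2)) (1 / 2) (1 / 2) := fun hσ => by
    obtain ⟨M, hM, h⟩ := sum_solS_bound hσ
    exact NearBoundary.add_smul ⟨M, hM, fun S c B hB hle => (h S c B hB hle).2.2⟩ (nS hσ) γ
  have one : ∀ {F F' : ℂ → ℂ} {α β : ℂ}, NearBoundary (fun ρ => F (ρ ^ 2)) α β →
      NearBoundary (fun ρ => F' (ρ ^ 2)) α β → Admissible Real.pi 1 F F' := by
    intro F F' α β h h'
    refine ⟨fun j hj => ?_, fun j hj => ?_, fun j hj => ?_⟩ <;>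
      (obtain rfl := Nat.le_zero.1 hj; simp only [pow_zero, one_mul])
    exacts [h.isBoundedSymbol, h'.isBoundedSymbol, h.diff h']
  cases b <;> cases b' <;> simp only [BC.order, edgeChar, zero_add, add_zero]
  -- Two Dirichlet ends give order 2, so both `S` and `ρ S` have to be bounded.
  · refine ⟨fun j hj => ?_, fun j hj => ?_, fun j hj => ?_⟩ <;>
      (obtain rfl | rfl : j = 0 ∨ j = 1 := by have : j ≤ 1 := hj; omega) <;>
      simp only [pow_zero, pow_one, one_mul, mul_sub]
    exacts [(nS hσ).isBoundedSymbol, (nS' hσ).isBoundedSymbol, (nS hσ').isBoundedSymbol,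
      (nS' hσ').isBoundedSymbol, (nS hσ).diff (nS hσ'), (nS' hσ).diff (nS' hσ')]
  · exact one (nS1 hσ) (nS1 hσ')
  · exact one (nearBoundary_solC hσ) (nearBoundary_solC hσ')
  · have h1 : HasOrder .l2 Real.pi 0 fun lam => (solC1 σ lam - solC1 σ' lam)
        + γ * (solC σ lam - solC σ' lam) :=
      HasOrder.add_const_mul (F := fun lam => solC1 σ lam - solC1 σ' lam)
        (G := fun lam => solC σ lam - solC σ' lam) ((nearBoundaryDeriv_solC1 hσ).diff (nearBoundaryDeriv_solC1 hσ'))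
        ((nearBoundary_solC hσ).diff (nearBoundary_solC hσ')) γ
    have e : (fun lam => (solC1 σ lam - solC1 σ' lam) + γ * (solC σ lam - solC σ' lam))
        = fun lam => solC1 σ lam + γ * solC σ lam - (solC1 σ' lam + γ * solC σ' lam) := by
      funext lam; ring
    rw [e] at h1
    exact ⟨HasOrder.add_const_mul (F := solC1 σ) (G := solC σ) (nearBoundaryDeriv_solC1 hσ).bound
        (nearBoundary_solC hσ).isBoundedSymbol γ,
      HasOrder.add_const_mul (F := solC1 σ') (G := solC σ') (nearBoundaryDeriv_solC1 hσ').bound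
        (nearBoundary_solC hσ').isBoundedSymbol γ, h1⟩

end TreeSL

namespace TreeSL

namespace MetricTree

set_option linter.unusedSectionVars false

/-! ### Branches of a tree -/

theorem glue_attach {ι : Type*} [DecidableEq ι] (s : Finset ι) [DecidableEq {x // x ∈ s}]
    (N D : ι → ℂ) : glue s.attach (fun i => N i.1) (fun i => D i.1) = glue s N D := by
  unfold glue
  rw [← Finset.sum_attach s]
  refine Finset.sum_congr rfl fun i _ => ?_
  congr 1
  refine Finset.prod_bij (fun k _ => k.1) ?_ ?_ ?_ ?_
  · intro k hk
    simp only [Finset.mem_erase, Finset.mem_attach, and_true] at hk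
    exact Finset.mem_erase.2 ⟨fun h => hk (Subtype.ext h), k.2⟩
  · intro k _ k' _ h
    exact Subtype.ext h
  · intro k hk
    rw [Finset.mem_erase] at hk
    exact ⟨⟨k, hk.2⟩, by simpa [Subtype.ext_iff] using hk.1, rfl⟩
  · intro k _
    rfl

variable {V : Type*} [Fintype V] (T : MetricTree V)

theorem branchChar_of_isBoundary (σ : T.Edge → ℝ → ℝ) (lam : ℂ) {d : T.graph.Dart} (b : BC)
    (h : T.IsBoundary d.snd) :
    T.branchChar σ lam d b = T.dartChar σ lam d b (T.bc d.snd) := by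
  rw [branchChar, if_pos h]

theorem branchChar_of_not_isBoundary (σ : T.Edge → ℝ → ℝ) (lam : ℂ) {d : T.graph.Dart} (b : BC)
    (h : ¬ T.IsBoundary d.snd) :
    T.branchChar σ lam d b = T.dartChar σ lam d b .neumann *
        ∏ d' ∈ T.children d, T.branchChar σ lam d' .dirichlet +
      T.dartChar σ lam d b .dirichlet *
        glue (T.children d) (fun d' => T.branchChar σ lam d' .neumann)
          (fun d' => T.branchChar σ lam d' .dirichlet) := by
  rw [branchChar, if_neg h]
  congr 2
  · exact Finset.prod_attach _ fun d' => T.branchChar σ lam d' .dirichlet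
  · exact glue_attach _ (fun d' => T.branchChar σ lam d' .neumann)
      fun d' => T.branchChar σ lam d' .dirichlet

theorem dart_induction {p : T.graph.Dart → Prop} (h : ∀ d, (∀ d' ∈ T.children d, p d') → p d)
    (d : T.graph.Dart) : p d := by
  induction hn : (T.below d).card using Nat.strong_induction_on generalizing d with
  | _ n ih =>
    exact h d fun d' hd' => ih _ (hn ▸ Finset.card_lt_card (T.below_ssubset hd')) d' rfl

theorem mem_below {d : T.graph.Dart} {a : V} :
    a ∈ T.below d ↔ T.graph.dist a d.snd < T.graph.dist a d.fst := by simp [below]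

theorem mem_children {d d' : T.graph.Dart} :
    d' ∈ T.children d ↔ d'.fst = d.snd ∧ d'.snd ≠ d.fst := by simp [children]

/-- A neighbour of `v` which is closer to `a`. -/
theorem exists_adj_dist_lt {a v : V} (h : a ≠ v) :
    ∃ x, T.graph.Adj v x ∧ T.graph.dist a x < T.graph.dist a v := by
  obtain ⟨p, hp⟩ := T.isTree.connected.exists_walk_length_eq_dist v a
  cases p with
  | nil => exact absurd rfl h
  | cons hadj q =>
    refine ⟨_, hadj, ?_⟩
    rw [SimpleGraph.dist_comm, SimpleGraph.dist_comm (u := a), ← hp, SimpleGraph.Walk.length_cons]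
    exact Nat.lt_succ_of_le (SimpleGraph.dist_le q)

/-- Shortest paths from `a` to `x` and `x'`, prolonged to `v`, are both the unique path from `a` to
`v`, so they have the same penultimate vertex. -/
theorem eq_of_dist_lt {a v x x' : V} (h : T.graph.Adj v x) (h' : T.graph.Adj v x')
    (hx : T.graph.dist a x < T.graph.dist a v) (hx' : T.graph.dist a x' < T.graph.dist a v) :
    x = x' := by
  have key : ∀ t, T.graph.Adj v t → T.graph.dist a t < T.graph.dist a v →
      ∃ p : T.graph.Walk a v, p.IsPath ∧ p.penultimate = t := by
    intro t ht hlt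
    obtain ⟨p, hp⟩ := T.isTree.connected.exists_walk_length_eq_dist a t
    have h1 : (p.concat ht.symm).length = T.graph.dist a v := by
      rw [SimpleGraph.Walk.length_concat]
      rcases T.isTree.dist_eq_dist_add_one_of_adj a ht with h2 | h2 <;> omega
    exact ⟨p.concat ht.symm, SimpleGraph.Walk.isPath_of_length_eq_dist _ h1,
      SimpleGraph.Walk.penultimate_concat _ _⟩
  obtain ⟨p, hp, rfl⟩ := key x h hx
  obtain ⟨q, hq, rfl⟩ := key x' h' hx'
  have := (T.isTree.isAcyclic.subsingleton_path a v).elim ⟨p, hp⟩ ⟨q, hq⟩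
  exact congrArg SimpleGraph.Walk.penultimate (congrArg Subtype.val this)

theorem below_pairwiseDisjoint (v : V) (s : Finset T.graph.Dart) (hs : ∀ d ∈ s, d.fst = v) :
    (s : Set T.graph.Dart).PairwiseDisjoint T.below := by
  intro d hd d' hd' hne
  rw [Function.onFun, Finset.disjoint_left]
  intro a ha ha'
  have h1 := hs d hd
  have h2 := hs d' hd'
  rw [mem_below, h1] at ha
  rw [mem_below, h2] at ha'
  refine hne (SimpleGraph.Dart.ext _ _ (Prod.ext (h1.trans h2.symm) ?_))
  exact T.eq_of_dist_lt (h1 ▸ d.adj) (h2 ▸ d'.adj) ha ha'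

theorem snd_mem_below (d : T.graph.Dart) : d.snd ∈ T.below d := by
  rw [mem_below, SimpleGraph.dist_self]
  exact T.isTree.connected.pos_dist_of_ne d.adj.ne'

theorem fst_notMem_below (d : T.graph.Dart) : d.fst ∉ T.below d := by
  rw [mem_below, SimpleGraph.dist_self]
  exact Nat.not_lt_zero _

theorem below_eq (d : T.graph.Dart) :
    T.below d = insert d.snd ((T.children d).biUnion T.below) := by
  ext a
  simp only [Finset.mem_insert, Finset.mem_biUnion]
  constructor
  · intro ha
    refine or_iff_not_imp_left.2 fun hne => ?_
    obtain ⟨x, hx, hlt⟩ := T.exists_adj_dist_lt hne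
    refine ⟨⟨(d.snd, x), hx⟩, T.mem_children.2 ⟨rfl, ?_⟩, T.mem_below.2 hlt⟩
    rintro rfl
    exact lt_asymm hlt (T.mem_below.1 ha)
  · rintro (rfl | ⟨d', hd', ha⟩)
    · exact T.snd_mem_below d
    · exact (T.below_ssubset hd').1 ha

theorem snd_notMem_biUnion (d : T.graph.Dart) : d.snd ∉ (T.children d).biUnion T.below := by
  simp only [Finset.mem_biUnion, not_exists, not_and]
  intro d' hd'
  rw [← (T.mem_children.1 hd').1]
  exact T.fst_notMem_below d'

/-- The number of edges of a branch. -/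
noncomputable def branchEdges (d : T.graph.Dart) : ℕ := (T.below d).card

/-- The boundary vertices with a Dirichlet condition. -/
def IsDirichlet (v : V) : Prop := T.IsBoundary v ∧ T.bc v = .dirichlet

/-- The number of Dirichlet conditions in a branch. -/
noncomputable def branchDirichlet (d : T.graph.Dart) : ℕ := ((T.below d).filter T.IsDirichlet).card

/-- Each edge of a branch is counted by its end away from the root; the summand 1 is the edge of `d`
itself. -/
theorem branchEdges_eq (d : T.graph.Dart) :
    T.branchEdges d = 1 + ∑ d' ∈ T.children d, T.branchEdges d' := by
  rw [branchEdges, below_eq, Finset.card_insert_of_notMem (T.snd_notMem_biUnion d),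
    Finset.card_biUnion (T.below_pairwiseDisjoint d.snd _ fun d' hd' => (T.mem_children.1 hd').1),
    add_comm]
  rfl

theorem card_filter_biUnion_below (v : V) (s : Finset T.graph.Dart) (hs : ∀ d ∈ s, d.fst = v) :
    ((s.biUnion T.below).filter T.IsDirichlet).card = ∑ d ∈ s, T.branchDirichlet d := by
  rw [Finset.filter_biUnion, Finset.card_biUnion]
  · rfl
  · intro d hd d' hd' hne
    exact Finset.disjoint_filter_filter (T.below_pairwiseDisjoint v s hs hd hd' hne)

theorem branchDirichlet_eq (d : T.graph.Dart) (h : ¬ T.IsBoundary d.snd) :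
    T.branchDirichlet d = ∑ d' ∈ T.children d, T.branchDirichlet d' := by
  rw [branchDirichlet, below_eq, Finset.filter_insert, if_neg fun h' => h h'.1,
    T.card_filter_biUnion_below d.snd _ fun d' hd' => (T.mem_children.1 hd').1]

/-- The darts starting at `v` correspond to the edges incident to `v`. -/
theorem star_eq_image (v : V) :
    T.star v = (Finset.univ.filter fun d : T.graph.Dart => d.fst = v).image T.dartEdge := by
  ext e
  simp only [star, Finset.mem_filter, Finset.mem_univ, true_and, Finset.mem_image]
  constructor
  · intro hv
    obtain ⟨e, he⟩ := e
    obtain ⟨x, rfl⟩ := Sym2.mem_iff_exists.1 hv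
    exact ⟨⟨(v, x), he⟩, rfl, rfl⟩
  · rintro ⟨d, rfl, rfl⟩
    exact Sym2.mem_mk_left _ _

theorem dartEdge_injOn (v : V) :
    Set.InjOn T.dartEdge {d : T.graph.Dart | d.fst = v} := by
  intro d hd d' hd' h
  have h1 : d.edge = d'.edge := congrArg Subtype.val h
  rcases SimpleGraph.dart_edge_eq_iff d d' |>.1 h1 with h2 | h2
  · exact h2
  · exfalso
    have h3 : d'.snd = v := by
      have : d.fst = d'.symm.fst := by rw [h2]
      exact this.symm.trans hd
    exact d'.adj.ne (hd'.trans h3.symm)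

theorem filter_fst_eq (d : T.graph.Dart) :
    (Finset.univ.filter fun d' : T.graph.Dart => d'.fst = d.snd)
      = insert d.symm (T.children d) := by
  ext d'
  simp only [Finset.mem_filter, Finset.mem_univ, true_and, Finset.mem_insert, mem_children]
  constructor
  · intro h
    refine or_iff_not_imp_right.2 fun h2 => ?_
    have h3 : d'.snd = d.fst := by by_contra h3; exact h2 ⟨h, h3⟩
    exact SimpleGraph.Dart.ext _ _ (Prod.ext h h3)
  · rintro (rfl | h)
    · rfl
    · exact h.1

theorem symm_notMem_children (d : T.graph.Dart) : d.symm ∉ T.children d := fun h =>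
  (T.mem_children.1 h).2 rfl

theorem dartEdge_symm (d : T.graph.Dart) : T.dartEdge d.symm = T.dartEdge d :=
  Subtype.ext (SimpleGraph.Dart.edge_symm d)

/-- A sum over the edges at `d.snd` splits into the edge of `d` and the children of `d`. -/
theorem sum_star_snd (d : T.graph.Dart) (f : T.Edge → ℂ) :
    ∑ e ∈ T.star d.snd, f e = f (T.dartEdge d) + ∑ d' ∈ T.children d, f (T.dartEdge d') := by
  rw [star_eq_image, Finset.sum_image, filter_fst_eq, Finset.sum_insert (T.symm_notMem_children d),
    dartEdge_symm]
  simpa using T.dartEdge_injOn d.snd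

theorem card_star_snd (d : T.graph.Dart) : (T.star d.snd).card = 1 + (T.children d).card := by
  rw [star_eq_image, Finset.card_image_of_injOn, filter_fst_eq,
    Finset.card_insert_of_notMem (T.symm_notMem_children d), add_comm]
  simpa using T.dartEdge_injOn d.snd

theorem children_eq_empty (d : T.graph.Dart) (h : T.IsBoundary d.snd) : T.children d = ∅ := by
  have h1 := T.card_star_snd d
  rw [IsBoundary] at h
  rw [← Finset.card_eq_zero]
  omega

theorem branchDirichlet_of_isBoundary (d : T.graph.Dart) (h : T.IsBoundary d.snd) :
    T.branchDirichlet d = (T.bc d.snd).order := by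
  rw [branchDirichlet, below_eq, T.children_eq_empty d h, Finset.biUnion_empty, Finset.filter_insert]
  cases hb : T.bc d.snd <;> simp [IsDirichlet, hb, h, BC.order]

theorem admissible_dartChar {σ σ' : T.Edge → ℝ → ℝ}
    (hσ : ∀ e, MemLp (σ e) 2 (intervalMeasure Real.pi))
    (hσ' : ∀ e, MemLp (σ' e) 2 (intervalMeasure Real.pi)) (d : T.graph.Dart) (b b' : BC) :
    Admissible Real.pi (b.order + b'.order) (fun lam => T.dartChar σ lam d b b')
      (fun lam => T.dartChar σ' lam d b b') := by
  unfold dartChar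
  split_ifs
  · exact admissible_edgeChar (hσ _) (hσ' _) _ _ _
  · rw [add_comm]
    exact admissible_edgeChar (hσ _) (hσ' _) _ _ _

/-- The order of the characteristic function of a branch is determined by the number of the
Dirichlet conditions. -/
theorem admissible_branchChar {σ σ' : T.Edge → ℝ → ℝ}
    (hσ : ∀ e, MemLp (σ e) 2 (intervalMeasure Real.pi))
    (hσ' : ∀ e, MemLp (σ' e) 2 (intervalMeasure Real.pi)) (d : T.graph.Dart) :
    ∀ b : BC, Admissible (T.branchEdges d * Real.pi) (T.branchDirichlet d + b.order)
      (fun lam => T.branchChar σ lam d b) (fun lam => T.branchChar σ' lam d b) := by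
  have hpi := Real.pi_pos
  induction d using T.dart_induction with
  | h d ih =>
    intro b
    by_cases hd : T.IsBoundary d.snd
    · simp only [T.branchChar_of_isBoundary _ _ b hd]
      rw [T.branchDirichlet_of_isBoundary d hd, T.branchEdges_eq d, T.children_eq_empty d hd,
        add_comm _ b.order]
      simpa using T.admissible_dartChar hσ hσ' d b (T.bc d.snd)
    · simp only [T.branchChar_of_not_isBoundary _ _ b hd]
      have hnn : ∀ d' ∈ T.children d, 0 ≤ (T.branchEdges d' : ℝ) * Real.pi := fun d' _ => by
        positivity
      have e1 : (T.branchEdges d : ℝ) * Real.pi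
          = Real.pi + ∑ d' ∈ T.children d, (T.branchEdges d' : ℝ) * Real.pi := by
        rw [T.branchEdges_eq d]
        push_cast
        rw [add_mul, one_mul, Finset.sum_mul]
      have hP := Admissible.prod (T.children d) hnn fun d' hd' => ih d' hd' .dirichlet
      have hG := Admissible.glue (T.children d) hnn (fun d' hd' => ih d' hd' .neumann)
        (fun d' hd' => ih d' hd' .dirichlet)
      have hE := T.admissible_dartChar hσ hσ' d b
      rw [← T.branchDirichlet_eq d hd] at hP
      simp only [BC.order, add_zero] at hG
      rw [← T.branchDirichlet_eq d hd] at hG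
      rw [e1]
      refine Admissible.add ?_ ?_
      -- Orders: `b.order` from the edge and `branchDirichlet d + 1` from the product of Dirichlet
      -- branches, minus one for the multiplication.
      · have := (hE .neumann).mul hpi.le (Finset.sum_nonneg hnn) hP
        rwa [show b.order + BC.neumann.order + T.branchDirichlet d = T.branchDirichlet d + b.order by
          simp [BC.order, add_comm]] at this
      -- The second factor of `Admissible.mul` must have positive order. The glued function may have
      -- order 0, so it comes first; the edge with a Dirichlet end has order `b.order + 1`.
      · have := hG.mul (Finset.sum_nonneg hnn) hpi.le (hE .dirichlet)
        rw [add_comm Real.pi]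
        simpa only [mul_comm] using this

/-! ### Splittings -/

theorem mem_rootDarts {H : T.graph.Subgraph} {w : V} {d : T.graph.Dart} :
    d ∈ T.rootDarts H w ↔ d.fst = w ∧ H.Adj d.fst d.snd := by simp [rootDarts]

/-- In a connected subgraph, the first edge of the path from `w` to `a` belongs to the subgraph. -/
theorem exists_subgraph_adj_dist_lt {H : T.graph.Subgraph} (hH : H.Connected) {a w : V}
    (ha : a ∈ H.verts) (hw : w ∈ H.verts) (hne : a ≠ w) :
    ∃ x, H.Adj w x ∧ T.graph.dist a x < T.graph.dist a w := by
  obtain ⟨p, hp⟩ := (hH.preconnected.coe ⟨w, hw⟩ ⟨a, ha⟩).exists_isPath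
  cases p with
  | nil => exact absurd rfl hne
  | @cons _ x _ hadj q =>
    refine ⟨x.1, hadj, ?_⟩
    have hpath : ((SimpleGraph.Walk.cons hadj q).map H.hom).IsPath :=
      hp.map H.hom_injective
    obtain ⟨r, hr, hr'⟩ := (T.isTree.connected w a).exists_path_of_dist
    have := congrArg Subtype.val
      ((T.isTree.isAcyclic.subsingleton_path w a).elim ⟨_, hpath⟩ ⟨r, hr⟩)
    have hlen : ((SimpleGraph.Walk.cons hadj q).map H.hom).length = T.graph.dist w a := by
      rw [← hr']; exact congrArg SimpleGraph.Walk.length this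
    rw [SimpleGraph.Walk.length_map, SimpleGraph.Walk.length_cons] at hlen
    rw [SimpleGraph.dist_comm, SimpleGraph.dist_comm (u := a), ← hlen]
    refine Nat.lt_succ_of_le ?_
    have h1 := SimpleGraph.dist_le (q.map H.hom)
    rwa [SimpleGraph.Walk.length_map] at h1

variable {T}

namespace Splitting

variable (P : T.Splitting)

theorem w_mem_known : P.w ∈ P.known.verts := by
  have : P.w ∈ P.known.verts ∩ P.unknown.verts := by rw [P.common]; rfl
  exact this.1

theorem w_mem_unknown : P.w ∈ P.unknown.verts := by
  have : P.w ∈ P.known.verts ∩ P.unknown.verts := by rw [P.common]; rfl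
  exact this.2

theorem mem_verts_or (a : V) : a ∈ P.known.verts ∨ a ∈ P.unknown.verts := by
  have : a ∈ (P.known ⊔ P.unknown).verts := by rw [P.cover]; trivial
  exact this

theorem adj_or {a b : V} (h : T.graph.Adj a b) : P.known.Adj a b ∨ P.unknown.Adj a b := by
  have : (P.known ⊔ P.unknown).Adj a b := by rw [P.cover]; exact h
  exact this

theorem not_adj_and_adj {x : V} (h : P.known.Adj P.w x) (h' : P.unknown.Adj P.w x) : False := by
  have : x ∈ P.known.verts ∩ P.unknown.verts := ⟨h.snd_mem, h'.snd_mem⟩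
  rw [P.common] at this
  exact h.adj_sub.ne (Set.mem_singleton_iff.1 this).symm

/-- A branch at `w` that starts with an unknown edge stays unknown: a known vertex in it would be
joined to `w` inside the known part, through a known first edge, whereas that first edge is unique.
-/
theorem unknown_verts_eq :
    P.unknown.verts = insert P.w ((T.rootDarts P.unknown P.w).biUnion T.below : Finset V) := by
  ext a
  simp only [Finset.mem_coe, Finset.mem_insert, Finset.mem_biUnion]
  constructor
  · intro ha
    refine or_iff_not_imp_left.2 fun hne => ?_
    obtain ⟨x, hx, hlt⟩ := T.exists_subgraph_adj_dist_lt P.unknown_connected ha P.w_mem_unknown hne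
    exact ⟨⟨(P.w, x), hx.adj_sub⟩, T.mem_rootDarts.2 ⟨rfl, hx⟩, T.mem_below.2 hlt⟩
  · rintro (rfl | ⟨d, hd, ha⟩)
    · exact P.w_mem_unknown
    · obtain ⟨h1, h2⟩ := T.mem_rootDarts.1 hd
      refine (P.mem_verts_or a).resolve_left fun hk => ?_
      have hne : a ≠ P.w := by
        rintro rfl
        exact T.fst_notMem_below d (h1 ▸ ha)
      obtain ⟨x, hx, hlt⟩ := T.exists_subgraph_adj_dist_lt P.known_connected hk P.w_mem_known hne
      rw [mem_below, h1] at ha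
      rw [h1] at h2
      obtain rfl := T.eq_of_dist_lt hx.adj_sub h2.adj_sub hlt ha
      exact P.not_adj_and_adj hx h2

theorem w_notMem_biUnion : P.w ∉ (T.rootDarts P.unknown P.w).biUnion T.below := by
  simp only [Finset.mem_biUnion, not_exists, not_and]
  intro d hd
  rw [← (T.mem_rootDarts.1 hd).1]
  exact T.fst_notMem_below d

/-- An inequality is enough, since admissibility passes to larger intervals; it follows from the
bound on vertices by edges in a connected graph. -/
theorem sum_branchEdges_le :
    ∑ d ∈ T.rootDarts P.unknown P.w, T.branchEdges d ≤ T.numEdges P.unknown := by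
  have h1 : Nat.card P.unknown.verts ≤ Nat.card P.unknown.coe.edgeSet + 1 :=
    P.unknown_connected.coe.card_vert_le_card_edgeSet_add_one
  have h2 : Nat.card P.unknown.verts
      = ∑ d ∈ T.rootDarts P.unknown P.w, T.branchEdges d + 1 := by
    rw [Nat.card_coe_set_eq, P.unknown_verts_eq, Set.ncard_coe_finset,
      Finset.card_insert_of_notMem P.w_notMem_biUnion, Finset.card_biUnion
        (T.below_pairwiseDisjoint P.w _ fun d hd => (T.mem_rootDarts.1 hd).1)]
    rfl
  have h3 : Nat.card P.unknown.coe.edgeSet = T.numEdges P.unknown := by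
    rw [Nat.card_coe_set_eq, numEdges, ← P.unknown.image_coe_edgeSet_coe, Set.ncard_image_of_injective]
    exact Sym2.map.injective Subtype.val_injective
  omega

theorem sum_branchDirichlet_eq :
    ∑ d ∈ T.rootDarts P.unknown P.w, T.branchDirichlet d = T.numDirichlet P.unknown := by
  rw [← T.card_filter_biUnion_below P.w _ fun d hd => (T.mem_rootDarts.1 hd).1, numDirichlet,
    ← Set.ncard_coe_finset]
  congr 1
  ext a
  simp only [Finset.coe_filter, Set.mem_ofPred_eq, P.unknown_verts_eq,
    Finset.mem_coe, Finset.mem_insert, IsDirichlet]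
  constructor
  · rintro ⟨h1, h2⟩
    exact ⟨Or.inr h1, h2⟩
  · rintro ⟨rfl | h1, h2⟩
    -- The vertex `w` belongs to the unknown part but is internal, so it carries no Dirichlet
    -- condition.
    · exact absurd h2.1 P.w_internal
    · exact ⟨h1, h2⟩

theorem admissible_charK {σ σ' : T.Edge → ℝ → ℝ}
    (hσ : ∀ e, MemLp (σ e) 2 (intervalMeasure Real.pi))
    (hσ' : ∀ e, MemLp (σ' e) 2 (intervalMeasure Real.pi)) :
    Admissible (T.numEdges P.unknown * Real.pi) (T.numDirichlet P.unknown)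
      (T.charK σ P.unknown P.w) (T.charK σ' P.unknown P.w) := by
  have hpi := Real.pi_pos
  have hnn : ∀ d ∈ T.rootDarts P.unknown P.w, 0 ≤ (T.branchEdges d : ℝ) * Real.pi := fun d' _ => by
    positivity
  have := Admissible.glue (T.rootDarts P.unknown P.w) hnn
    (fun d _ => T.admissible_branchChar hσ hσ' d .neumann)
    (fun d _ => T.admissible_branchChar hσ hσ' d .dirichlet)
  simp only [BC.order, add_zero, P.sum_branchDirichlet_eq] at this
  refine this.mono (Finset.sum_nonneg hnn) ?_
  rw [← Finset.sum_mul]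
  exact mul_le_mul_of_nonneg_right (by exact_mod_cast P.sum_branchEdges_le) hpi.le

theorem admissible_charPi {σ σ' : T.Edge → ℝ → ℝ}
    (hσ : ∀ e, MemLp (σ e) 2 (intervalMeasure Real.pi))
    (hσ' : ∀ e, MemLp (σ' e) 2 (intervalMeasure Real.pi)) :
    Admissible (T.numEdges P.unknown * Real.pi) (T.numDirichlet P.unknown + 1)
      (T.charPi σ P.unknown P.w) (T.charPi σ' P.unknown P.w) := by
  have hpi := Real.pi_pos
  have hnn : ∀ d ∈ T.rootDarts P.unknown P.w, 0 ≤ (T.branchEdges d : ℝ) * Real.pi := fun d' _ => by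
    positivity
  have := Admissible.prod (T.rootDarts P.unknown P.w) hnn
    (fun d _ => T.admissible_branchChar hσ hσ' d .dirichlet)
  simp only [P.sum_branchDirichlet_eq] at this
  refine this.mono (Finset.sum_nonneg hnn) ?_
  rw [← Finset.sum_mul]
  exact mul_le_mul_of_nonneg_right (by exact_mod_cast P.sum_branchEdges_le) hpi.le

end Splitting

end MetricTree

end TreeSL

namespace TreeSL

namespace MetricTree

set_option linter.unusedSectionVars false

/-! ### Eigenvalues are zeros of the characteristic function -/

/-- Meant for an internal vertex: `α` is the common value of a solution, the `β j` are its
derivatives along the branches, and the matching condition fixes their sum. -/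
theorem mul_glue {ι : Type*} [DecidableEq ι] {s : Finset ι} {N D β : ι → ℂ} {α : ℂ}
    (h : ∀ j ∈ s, α * N j = β j * D j) :
    α * glue s N D = (∑ j ∈ s, β j) * ∏ j ∈ s, D j := by
  rw [glue, Finset.mul_sum, Finset.sum_mul]
  refine Finset.sum_congr rfl fun j hj => ?_
  rw [← mul_assoc, h j hj, mul_assoc, Finset.mul_prod_erase _ _ hj]

/-- The case of a solution vanishing at the vertex. If some `β j` is nonzero, the zero sum forces a
second one, so two of the `D` vanish and each product in `glue` contains one of them. If all `β j`
vanish, `h0` supplies a branch where both functions are zero. -/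
theorem glue_eq_zero {ι : Type*} [DecidableEq ι] {s : Finset ι} {N D β : ι → ℂ}
    (h : ∀ j ∈ s, β j * D j = 0) (hβ : ∑ j ∈ s, β j = 0)
    (h0 : (∀ j ∈ s, β j = 0) → ∃ j ∈ s, N j = 0 ∧ D j = 0) :
    glue s N D = 0 ∧ ∏ j ∈ s, D j = 0 := by
  have key : ∀ i ∈ s, D i = 0 → (N i = 0 ∨ ∃ k ∈ s, k ≠ i ∧ D k = 0) →
      glue s N D = 0 ∧ ∏ j ∈ s, D j = 0 := by
    intro i hi hD hN
    refine ⟨Finset.sum_eq_zero fun j hj => ?_, Finset.prod_eq_zero hi hD⟩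
    by_cases hji : j = i
    · subst hji
      rcases hN with hN | ⟨k, hk, hkj, hDk⟩
      · rw [hN, zero_mul]
      · rw [Finset.prod_eq_zero (Finset.mem_erase.2 ⟨hkj, hk⟩) hDk, mul_zero]
    · rw [Finset.prod_eq_zero (Finset.mem_erase.2 ⟨Ne.symm hji, hi⟩) hD, mul_zero]
  by_cases hall : ∀ j ∈ s, β j = 0
  · obtain ⟨i, hi, hN, hD⟩ := h0 hall
    exact key i hi hD (Or.inl hN)
  · push Not at hall
    obtain ⟨i, hi, hne⟩ := hall
    have hD : D i = 0 := (mul_eq_zero.1 (h i hi)).resolve_left hne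
    rw [← Finset.add_sum_erase _ _ hi] at hβ
    have : ∃ k ∈ s.erase i, β k ≠ 0 := by
      by_contra hcon
      push Not at hcon
      rw [Finset.sum_eq_zero hcon, add_zero] at hβ
      exact hne hβ
    obtain ⟨k, hk, hkne⟩ := this
    rw [Finset.mem_erase] at hk
    exact key i hi hD (Or.inr ⟨k, hk.2, hk.1, (mul_eq_zero.1 (h k hk.2)).resolve_left hkne⟩)

/-- The Leibniz rule: `glue` is formally the derivative of the product of the `D`. -/
theorem glue_union {ι : Type*} [DecidableEq ι] {s t : Finset ι} (h : Disjoint s t) (N D : ι → ℂ) :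
    glue (s ∪ t) N D = glue s N D * ∏ j ∈ t, D j + (∏ j ∈ s, D j) * glue t N D := by
  have aux : ∀ s t : Finset ι, Disjoint s t → ∑ j ∈ s, N j * ∏ k ∈ (s ∪ t).erase j, D k
      = glue s N D * ∏ j ∈ t, D j := by
    intro s t h
    rw [glue, Finset.sum_mul]
    refine Finset.sum_congr rfl fun j hj => ?_
    rw [Finset.erase_union_distrib, Finset.erase_eq_of_notMem (Finset.disjoint_left.1 h hj),
      Finset.prod_union (h.mono_left (Finset.erase_subset _ _)), mul_assoc]
  have h1 := aux s t h
  have h2 := aux t s h.symm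
  rw [Finset.union_comm] at h2
  rw [glue, Finset.sum_union h, h1, h2]
  ring

variable {V : Type*} (T : MetricTree V)

theorem tail_head_of_fst {d : T.graph.Dart} (h : d.fst = T.tail (T.dartEdge d)) :
    d.snd ≠ T.tail (T.dartEdge d) :=
  fun h' => d.adj.ne (h.trans h'.symm)

theorem snd_eq_tail {d : T.graph.Dart} (h : d.fst ≠ T.tail (T.dartEdge d)) :
    d.snd = T.tail (T.dartEdge d) := by
  have h1 : s(T.tail (T.dartEdge d), T.head (T.dartEdge d)) = s(d.fst, d.snd) := T.ends _
  rw [Sym2.eq_iff] at h1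
  rcases h1 with ⟨h1, -⟩ | ⟨h1, -⟩
  · exact absurd h1.symm h
  · exact h1.symm

section solution

variable {T} {σ : T.Edge → ℝ → ℝ} {lam : ℂ} {y z : T.Edge → ℝ → ℂ}

/-- The values of a solution at the end of an edge in terms of the values at its beginning. -/
theorem vertex_transfer (hσ : ∀ e, MemLp (σ e) 2 (intervalMeasure Real.pi))
    (hyz : ∀ e, IsSolution (σ e) lam (y e) (z e)) (d : T.graph.Dart) :
    T.vertexValue y (T.dartEdge d) d.snd
        = T.vertexValue y (T.dartEdge d) d.fst * T.dartChar σ lam d .neumann .dirichlet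
          - T.vertexDeriv y z (T.dartEdge d) d.fst * T.dartChar σ lam d .dirichlet .dirichlet ∧
      T.vertexDeriv y z (T.dartEdge d) d.snd
        = T.vertexValue y (T.dartEdge d) d.fst * T.dartChar σ lam d .neumann .neumann
          - T.vertexDeriv y z (T.dartEdge d) d.fst * T.dartChar σ lam d .dirichlet .neumann := by
  obtain ⟨h1, h2⟩ := (hyz (T.dartEdge d)).eq_cauchySolution (hσ _)
    (⟨Real.pi_pos.le, le_rfl⟩ : Real.pi ∈ Set.Icc 0 Real.pi)
  have h3 := solC_mul_solS1_sub (hσ (T.dartEdge d)) lam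
  change y (T.dartEdge d) Real.pi = y (T.dartEdge d) 0 * solC (σ (T.dartEdge d)) lam
    + z (T.dartEdge d) 0 * solS (σ (T.dartEdge d)) lam at h1
  change z (T.dartEdge d) Real.pi = y (T.dartEdge d) 0 * solC1 (σ (T.dartEdge d)) lam
    + z (T.dartEdge d) 0 * solS1 (σ (T.dartEdge d)) lam at h2
  by_cases h : d.fst = T.tail (T.dartEdge d)
  · simp only [vertexValue, vertexDeriv, dartChar, if_pos h, if_neg (T.tail_head_of_fst h), edgeChar]
    rw [h1, h2]
    constructor <;> ring
  · simp only [vertexValue, vertexDeriv, dartChar, if_neg h, if_pos (T.snd_eq_tail h), edgeChar]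
    rw [h1, h2]
    -- The edge is traversed against its parametrization, so the transfer matrix is inverted; its
    -- determinant is 1 by `h3`.
    constructor
    · linear_combination (-y (T.dartEdge d) 0) * h3
    · linear_combination (z (T.dartEdge d) 0) * h3

/-- A solution with zero initial data vanishes on the edge. -/
theorem eq_zero_of_vertex_eq_zero (hσ : ∀ e, MemLp (σ e) 2 (intervalMeasure Real.pi))
    (hyz : ∀ e, IsSolution (σ e) lam (y e) (z e)) {d : T.graph.Dart}
    (h1 : T.vertexValue y (T.dartEdge d) d.fst = 0)
    (h2 : T.vertexDeriv y z (T.dartEdge d) d.fst = 0) {x : ℝ} (hx : x ∈ Set.Icc 0 Real.pi) :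
    y (T.dartEdge d) x = 0 := by
  have h3 := vertex_transfer hσ hyz d
  rw [h1, h2, zero_mul, zero_mul, zero_mul, zero_mul, sub_zero] at h3
  have h0 : y (T.dartEdge d) 0 = 0 ∧ z (T.dartEdge d) 0 = 0 := by
    by_cases h : d.fst = T.tail (T.dartEdge d)
    · simp only [vertexValue, vertexDeriv, if_pos h] at h1 h2
      exact ⟨h1, neg_eq_zero.1 h2⟩
    · simp only [vertexValue, vertexDeriv, if_pos (T.snd_eq_tail h)] at h3
      exact ⟨h3.1, neg_eq_zero.1 h3.2⟩
  rw [((hyz _).eq_cauchySolution (hσ _) hx).1, h0.1, h0.2, zero_mul, zero_mul, add_zero]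

end solution

variable [Fintype V] {T} {σ : T.Edge → ℝ → ℝ} {lam : ℂ} {y z : T.Edge → ℝ → ℂ}

theorem dartEdge_mem_star_fst (d : T.graph.Dart) : T.dartEdge d ∈ T.star d.fst := by
  simp only [star, Finset.mem_filter, Finset.mem_univ, true_and]
  exact Sym2.mem_mk_left _ _

theorem dartEdge_mem_star_snd (d : T.graph.Dart) : T.dartEdge d ∈ T.star d.snd := by
  simp only [star, Finset.mem_filter, Finset.mem_univ, true_and]
  exact Sym2.mem_mk_right _ _

/-- The conditions behind an edge confine the data at its root to a line, described by the two
branch functions. Induction from the leaves: transfer along the edge, then `mul_glue` and the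
matching condition at its far end. -/
theorem vertexValue_mul_branchChar (hσ : ∀ e, MemLp (σ e) 2 (intervalMeasure Real.pi))
    (hyz : ∀ e, IsSolution (σ e) lam (y e) (z e))
    (hmatch : ∀ v, ¬ T.IsBoundary v →
      (∀ e ∈ T.star v, ∀ e' ∈ T.star v, T.vertexValue y e v = T.vertexValue y e' v) ∧
      ∑ e ∈ T.star v, T.vertexDeriv y z e v = 0)
    (hbc : ∀ v, T.IsBoundary v → ∀ e ∈ T.star v,
      match T.bc v with
      | .dirichlet => T.vertexValue y e v = 0
      | .neumann => T.vertexDeriv y z e v = 0) (d : T.graph.Dart) :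
    T.vertexValue y (T.dartEdge d) d.fst * T.branchChar σ lam d .neumann
      = T.vertexDeriv y z (T.dartEdge d) d.fst * T.branchChar σ lam d .dirichlet := by
  induction d using T.dart_induction with
  | h d ih =>
    obtain ⟨t1, t2⟩ := vertex_transfer hσ hyz d
    by_cases hd : T.IsBoundary d.snd
    · rw [T.branchChar_of_isBoundary _ _ _ hd, T.branchChar_of_isBoundary _ _ _ hd]
      have h1 := hbc d.snd hd _ (dartEdge_mem_star_snd d)
      cases hb : T.bc d.snd <;> rw [hb] at h1 <;> simp only at h1
      · rw [t1] at h1; exact sub_eq_zero.1 h1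
      · rw [t2] at h1; exact sub_eq_zero.1 h1
    · rw [T.branchChar_of_not_isBoundary _ _ _ hd, T.branchChar_of_not_isBoundary _ _ _ hd]
      obtain ⟨m1, m2⟩ := hmatch d.snd hd
      rw [T.sum_star_snd d] at m2
      have hc : ∀ d' ∈ T.children d,
          T.vertexValue y (T.dartEdge d) d.snd * T.branchChar σ lam d' .neumann
            = T.vertexDeriv y z (T.dartEdge d') d.snd * T.branchChar σ lam d' .dirichlet := by
        intro d' hd'
        have h1 := (T.mem_children.1 hd').1
        have h2 := ih d' hd'
        rw [h1] at h2
        rw [← h2, m1 _ (dartEdge_mem_star_snd d) (T.dartEdge d') (h1 ▸ dartEdge_mem_star_fst d')]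
      have hg := mul_glue hc
      rw [t1] at hg
      rw [t2] at m2
      linear_combination hg + (∏ d' ∈ T.children d, T.branchChar σ lam d' .dirichlet) * m2

/-- Handles eigenfunctions that vanish near the root. With zero data the solution is zero on the
first edge, so it is nonzero somewhere behind a child; there `glue_eq_zero` applies, with the
induction hypothesis in the case that all derivatives vanish too. -/
theorem branchChar_eq_zero (hσ : ∀ e, MemLp (σ e) 2 (intervalMeasure Real.pi))
    (hyz : ∀ e, IsSolution (σ e) lam (y e) (z e))
    (hmatch : ∀ v, ¬ T.IsBoundary v →
      (∀ e ∈ T.star v, ∀ e' ∈ T.star v, T.vertexValue y e v = T.vertexValue y e' v) ∧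
      ∑ e ∈ T.star v, T.vertexDeriv y z e v = 0)
    (hbc : ∀ v, T.IsBoundary v → ∀ e ∈ T.star v,
      match T.bc v with
      | .dirichlet => T.vertexValue y e v = 0
      | .neumann => T.vertexDeriv y z e v = 0) (d : T.graph.Dart) :
    T.vertexValue y (T.dartEdge d) d.fst = 0 → T.vertexDeriv y z (T.dartEdge d) d.fst = 0 →
    (∃ d', Relation.ReflTransGen (fun a b => b ∈ T.children a) d d' ∧
      ∃ x ∈ Set.Icc (0 : ℝ) Real.pi, y (T.dartEdge d') x ≠ 0) →
    T.branchChar σ lam d .neumann = 0 ∧ T.branchChar σ lam d .dirichlet = 0 := by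
  induction d using T.dart_induction with
  | h d ih =>
    rintro h1 h2 ⟨d', hdd', x, hx, hne⟩
    rcases hdd'.cases_head with rfl | ⟨c, hc, hcd'⟩
    · exact absurd (eq_zero_of_vertex_eq_zero hσ hyz h1 h2 hx) hne
    have hd : ¬ T.IsBoundary d.snd := fun h => by
      rw [T.children_eq_empty d h] at hc
      exact absurd hc (Finset.notMem_empty _)
    obtain ⟨t1, t2⟩ := vertex_transfer hσ hyz d
    rw [h1, h2, zero_mul, zero_mul, sub_zero] at t1 t2
    obtain ⟨m1, m2⟩ := hmatch d.snd hd
    rw [T.sum_star_snd d, t2, zero_add] at m2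
    have hα : ∀ c ∈ T.children d, T.vertexValue y (T.dartEdge c) c.fst = 0 := by
      intro c hc
      have e1 := (T.mem_children.1 hc).1
      rw [e1, ← t1]
      exact m1 _ (e1 ▸ dartEdge_mem_star_fst c) _ (dartEdge_mem_star_snd d)
    have hg := glue_eq_zero (s := T.children d) (N := fun c => T.branchChar σ lam c .neumann)
      (D := fun c => T.branchChar σ lam c .dirichlet)
      (β := fun c => T.vertexDeriv y z (T.dartEdge c) d.snd) (fun c hc => by
        have e2 := vertexValue_mul_branchChar hσ hyz hmatch hbc c
        rw [hα c hc, zero_mul, (T.mem_children.1 hc).1] at e2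
        exact e2.symm) m2 (fun hβ => ⟨c, hc, ih c hc (hα c hc)
          (by rw [(T.mem_children.1 hc).1]; exact hβ c hc) ⟨d', hcd', x, hx, hne⟩⟩)
    rw [T.branchChar_of_not_isBoundary _ _ _ hd, T.branchChar_of_not_isBoundary _ _ _ hd,
      hg.1, hg.2]
    simp

/-- Every edge, oriented away from `w`, belongs to a branch at `w`. -/
theorem exists_root (w : V) (d : T.graph.Dart)
    (h : T.graph.dist w d.fst < T.graph.dist w d.snd) :
    ∃ r : T.graph.Dart, r.fst = w ∧ Relation.ReflTransGen (fun a b => b ∈ T.children a) r d := by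
  induction hn : T.graph.dist w d.fst generalizing d with
  | zero =>
    exact ⟨d, ((T.isTree.connected.dist_eq_zero_iff).1 hn).symm, .refl⟩
  | succ n ih =>
    have hne : w ≠ d.fst := by
      rintro h'
      rw [← h', SimpleGraph.dist_self] at hn
      omega
    obtain ⟨x, hx, hlt⟩ := T.exists_adj_dist_lt hne
    have h1 := T.isTree.dist_eq_dist_add_one_of_adj w hx
    obtain ⟨r, hr, hrd⟩ := ih ⟨(x, d.fst), hx.symm⟩ hlt (by simp only; omega)
    refine ⟨r, hr, hrd.tail (T.mem_children.2 ⟨rfl, ?_⟩)⟩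
    simp only
    rintro rfl
    omega

theorem exists_dart_away (w : V) (e : T.Edge) :
    ∃ d : T.graph.Dart, T.dartEdge d = e ∧ T.graph.dist w d.fst < T.graph.dist w d.snd := by
  obtain ⟨e, he⟩ := e
  induction e using Sym2.ind with
  | _ a b =>
    have hab : T.graph.Adj a b := he
    rcases lt_or_gt_of_ne (T.isTree.dist_ne_of_adj w hab) with h | h
    · exact ⟨⟨(a, b), hab⟩, rfl, h⟩
    · exact ⟨⟨(b, a), hab.symm⟩, Subtype.ext Sym2.eq_swap, h⟩

/-- If the eigenfunction is nonzero at `w`, multiply by its value and use that the derivatives sum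
to zero. Otherwise `MetricTree.glue_eq_zero` applies, where the branch `r` contains an edge on which
the eigenfunction does not vanish. -/
theorem IsEigenvalue.glue_eq_zero (hσ : ∀ e, MemLp (σ e) 2 (intervalMeasure Real.pi))
    (h : T.IsEigenvalue σ lam) {w : V} (hw : ¬ T.IsBoundary w) :
    glue (Finset.univ.filter fun d : T.graph.Dart => d.fst = w)
      (fun d => T.branchChar σ lam d .neumann) (fun d => T.branchChar σ lam d .dirichlet) = 0 := by
  obtain ⟨y, z, hyz, hmatch, hbc, e, x, hx, hne⟩ := h
  obtain ⟨d, rfl, hd⟩ := exists_dart_away w e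
  obtain ⟨r, hr, hrd⟩ := exists_root w d hd
  obtain ⟨m1, m2⟩ := hmatch w hw
  rw [star_eq_image, Finset.sum_image (by simpa using T.dartEdge_injOn w)] at m2
  have hval : ∀ d : T.graph.Dart, d.fst = w →
      T.vertexValue y (T.dartEdge d) d.fst = T.vertexValue y (T.dartEdge r) w := by
    rintro d rfl
    exact m1 _ (dartEdge_mem_star_fst d) _ (hr ▸ dartEdge_mem_star_fst r)
  have hmul : ∀ d ∈ Finset.univ.filter fun d : T.graph.Dart => d.fst = w,
      T.vertexValue y (T.dartEdge r) w * T.branchChar σ lam d .neumann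
        = T.vertexDeriv y z (T.dartEdge d) w * T.branchChar σ lam d .dirichlet := by
    intro d hd
    have hd' : d.fst = w := (Finset.mem_filter.1 hd).2
    have e2 := vertexValue_mul_branchChar hσ hyz hmatch hbc d
    rw [hval d hd', hd'] at e2
    exact e2
  by_cases hα : T.vertexValue y (T.dartEdge r) w = 0
  · refine (MetricTree.glue_eq_zero (β := fun d => T.vertexDeriv y z (T.dartEdge d) w)
      (fun d hd => ?_) m2 fun hβ => ?_).1
    · rw [← hmul d hd, hα, zero_mul]
    · have hr' : r ∈ Finset.univ.filter fun d : T.graph.Dart => d.fst = w := by simp [hr]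
      refine ⟨r, hr', branchChar_eq_zero hσ hyz hmatch hbc r ?_ ?_ ⟨d, hrd, x, hx, hne⟩⟩
      · rw [hval r hr, hα]
      · have := hβ r hr'
        rwa [hr]
  · have hg := mul_glue hmul
    rw [m2, zero_mul] at hg
    exact (mul_eq_zero.1 hg).resolve_left hα

/-- At an eigenvalue, the characteristic functions of the two parts of the tree are related. -/
theorem IsEigenvalue.charK_mul_charPi_add (hσ : ∀ e, MemLp (σ e) 2 (intervalMeasure Real.pi))
    (h : T.IsEigenvalue σ lam) (P : T.Splitting) :
    T.charK σ P.known P.w lam * T.charPi σ P.unknown P.w lam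
      + T.charPi σ P.known P.w lam * T.charK σ P.unknown P.w lam = 0 := by
  have h1 := h.glue_eq_zero hσ P.w_internal
  have h2 : (Finset.univ.filter fun d : T.graph.Dart => d.fst = P.w)
      = T.rootDarts P.known P.w ∪ T.rootDarts P.unknown P.w := by
    ext d
    simp only [Finset.mem_filter, Finset.mem_univ, true_and, Finset.mem_union, mem_rootDarts]
    constructor
    · intro h
      rcases P.adj_or d.adj with h' | h'
      · exact Or.inl ⟨h, h'⟩
      · exact Or.inr ⟨h, h'⟩
    · rintro (h | h) <;> exact h.1
  have h3 : Disjoint (T.rootDarts P.known P.w) (T.rootDarts P.unknown P.w) := by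
    rw [Finset.disjoint_left]
    intro d hd hd'
    obtain ⟨h4, h5⟩ := T.mem_rootDarts.1 hd
    have h6 := (T.mem_rootDarts.1 hd').2
    rw [h4] at h5 h6
    exact P.not_adj_and_adj h5 h6
  rw [h2, glue_union h3] at h1
  exact h1

/-! ### Known part: independence of the potential and reality -/

theorem dartChar_congr {σ σ' : T.Edge → ℝ → ℝ} {d : T.graph.Dart}
    (h : σ (T.dartEdge d) =ᵐ[intervalMeasure Real.pi] σ' (T.dartEdge d)) (lam : ℂ) (b b' : BC) :
    T.dartChar σ lam d b b' = T.dartChar σ' lam d b b' := by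
  unfold dartChar
  rw [edgeChar_congr h, edgeChar_congr h]

theorem glue_congr {ι : Type*} [DecidableEq ι] {s : Finset ι} {N N' D D' : ι → ℂ}
    (hN : ∀ i ∈ s, N i = N' i) (hD : ∀ i ∈ s, D i = D' i) : glue s N D = glue s N' D' :=
  Finset.sum_congr rfl fun i hi => by
    rw [hN i hi, Finset.prod_congr rfl fun j hj => hD j (Finset.mem_of_mem_erase hj)]

theorem conj_glue {ι : Type*} [DecidableEq ι] {s : Finset ι} {N D : ι → ℂ}
    (hN : ∀ i ∈ s, starRingEnd ℂ (N i) = N i) (hD : ∀ i ∈ s, starRingEnd ℂ (D i) = D i) :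
    starRingEnd ℂ (glue s N D) = glue s N D := by
  unfold glue
  simp only [map_sum, map_mul, map_prod]
  exact glue_congr hN hD

theorem conj_branchChar (hσ : ∀ e, MemLp (σ e) 2 (intervalMeasure Real.pi)) (lam : ℝ)
    (d : T.graph.Dart) : ∀ b, starRingEnd ℂ (T.branchChar σ lam d b) = T.branchChar σ lam d b := by
  have hE : ∀ (d : T.graph.Dart) b b', starRingEnd ℂ (T.dartChar σ lam d b b')
      = T.dartChar σ lam d b b' := by
    intro d b b'
    unfold dartChar
    split_ifs <;> exact conj_edgeChar (hσ _) _ _ _ _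
  induction d using T.dart_induction with
  | h d ih =>
    intro b
    by_cases hd : T.IsBoundary d.snd
    · rw [T.branchChar_of_isBoundary _ _ _ hd, hE]
    · rw [T.branchChar_of_not_isBoundary _ _ _ hd, map_add, map_mul, map_mul, hE, hE, map_prod,
        conj_glue (fun i hi => ih i hi _) (fun i hi => ih i hi _),
        Finset.prod_congr rfl fun i hi => ih i hi _]

theorem conj_charK (hσ : ∀ e, MemLp (σ e) 2 (intervalMeasure Real.pi)) (H : T.graph.Subgraph)
    (w : V) (lam : ℝ) : starRingEnd ℂ (T.charK σ H w lam) = T.charK σ H w lam :=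
  conj_glue (fun _ _ => conj_branchChar hσ _ _ _) (fun _ _ => conj_branchChar hσ _ _ _)

theorem conj_charPi (hσ : ∀ e, MemLp (σ e) 2 (intervalMeasure Real.pi)) (H : T.graph.Subgraph)
    (w : V) (lam : ℝ) : starRingEnd ℂ (T.charPi σ H w lam) = T.charPi σ H w lam := by
  unfold charPi
  rw [map_prod]
  exact Finset.prod_congr rfl fun _ _ => conj_branchChar hσ _ _ _

/-- Unknown edges meet known ones only at `w`; since `w` is not in the branch, the recursion never
leaves the known part. -/
theorem Splitting.branchChar_known_congr (P : T.Splitting) {σ σ' : T.Edge → ℝ → ℝ}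
    (h : ∀ e : T.Edge, (e : Sym2 V) ∈ P.known.edgeSet →
      σ e =ᵐ[intervalMeasure Real.pi] σ' e) (lam : ℂ) (d : T.graph.Dart) :
    P.known.Adj d.fst d.snd → P.w ∉ T.below d →
      ∀ b, T.branchChar σ lam d b = T.branchChar σ' lam d b := by
  induction d using T.dart_induction with
  | h d ih =>
    intro hadj hw b
    have hE : ∀ b b', T.dartChar σ lam d b b' = T.dartChar σ' lam d b b' :=
      dartChar_congr (h _ hadj) lam
    by_cases hd : T.IsBoundary d.snd
    · rw [T.branchChar_of_isBoundary _ _ _ hd, T.branchChar_of_isBoundary _ _ _ hd, hE]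
    · have hc : ∀ d' ∈ T.children d, ∀ b, T.branchChar σ lam d' b = T.branchChar σ' lam d' b := by
        intro d' hd'
        have h1 := (T.mem_children.1 hd').1
        refine ih d' hd' ?_ fun h2 => hw ((T.below_ssubset hd').1 h2)
        refine (P.adj_or d'.adj).resolve_right fun h2 => hw ?_
        have h3 : d.snd ∈ P.known.verts ∩ P.unknown.verts := ⟨hadj.snd_mem, h1 ▸ h2.fst_mem⟩
        rw [P.common] at h3
        rw [← Set.mem_singleton_iff.1 h3]
        exact T.snd_mem_below d
      rw [T.branchChar_of_not_isBoundary _ _ _ hd, T.branchChar_of_not_isBoundary _ _ _ hd, hE, hE,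
        Finset.prod_congr rfl fun d' hd' => hc d' hd' _,
        glue_congr (fun d' hd' => hc d' hd' _) fun d' hd' => hc d' hd' _]

theorem Splitting.known_congr (P : T.Splitting) {σ σ' : T.Edge → ℝ → ℝ}
    (h : ∀ e : T.Edge, (e : Sym2 V) ∈ P.known.edgeSet →
      σ e =ᵐ[intervalMeasure Real.pi] σ' e) (lam : ℂ) :
    T.charK σ P.known P.w lam = T.charK σ' P.known P.w lam ∧
      T.charPi σ P.known P.w lam = T.charPi σ' P.known P.w lam := by
  have hd : ∀ d ∈ T.rootDarts P.known P.w, ∀ b,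
      T.branchChar σ lam d b = T.branchChar σ' lam d b := by
    intro d hd
    obtain ⟨h1, h2⟩ := T.mem_rootDarts.1 hd
    exact P.branchChar_known_congr h lam d h2 (h1 ▸ T.fst_notMem_below d)
  exact ⟨glue_congr (fun d h => hd d h _) fun d h => hd d h _,
    Finset.prod_congr rfl fun d h => hd d h _⟩

end MetricTree

end TreeSL

namespace TreeSL

/-! ### Representation of bounded symbols by kernels -/

/-- Bounds of symbols are stated for `B > 0`; the case of zero norm is recovered as a limit. -/
theorem norm_le_of_forall_pos_le {x M N : ℝ} (hN : 0 ≤ N)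
    (h : ∀ B, 0 < B → N ≤ B → x ≤ M * B) : x ≤ M * N := by
  rcases hN.eq_or_lt with h0 | h0
  · subst h0
    refine ge_of_tendsto (x := nhdsWithin (0 : ℝ) (Set.Ioi 0)) (f := fun B => M * B) ?_ ?_
    · exact ((continuous_const.mul continuous_id).tendsto 0).mono_left nhdsWithin_le_nhds
    · filter_upwards [self_mem_nhdsWithin] with B hB using h B hB (le_of_lt hB)
  · exact h N h0 le_rfl

theorem sum_smul_toLp {μ : Measure ℝ} {ι : Type*} (S : Finset ι) (c : ι → ℂ) {φ : ι → ℝ → ℂ}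
    (h : ∀ i, MemLp (φ i) 2 μ) (hs : MemLp (fun x => ∑ i ∈ S, c i * φ i x) 2 μ) :
    ∑ i ∈ S, c i • (h i).toLp (φ i) = hs.toLp _ := by
  have hS : ∀ T : Finset ι, ⇑(∑ i ∈ T, c i • (h i).toLp (φ i) : Lp ℂ 2 μ)
      =ᵐ[μ] fun x => ∑ i ∈ T, c i * φ i x := by
    intro T
    induction T using Finset.induction_on with
    | empty =>
      simp only [Finset.sum_empty]
      exact Lp.coeFn_zero ℂ 2 μ
    | insert i T hi ih =>
      rw [Finset.sum_insert hi]
      filter_upwards [Lp.coeFn_add (c i • (h i).toLp (φ i)) (∑ i ∈ T, c i • (h i).toLp (φ i)),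
        Lp.coeFn_smul (c i) ((h i).toLp (φ i)), (h i).coeFn_toLp, ih] with x h1 h2 h3 h4
      rw [h1, Pi.add_apply, h2, Pi.smul_apply, h3, h4, Finset.sum_insert hi, smul_eq_mul]
  exact Lp.ext ((hS S).trans hs.coeFn_toLp.symm)

/-- A bounded functional on exponential sums is given by a kernel from `L_2(-a, a)`. -/
theorem IsBoundedSymbol.exists_kernel {a : ℝ} (ha : 0 ≤ a) {F : ℂ → ℂ}
    (hF : IsBoundedSymbol .l2 a F) :
    ∃ f : ℝ → ℂ, MemLp f 2 (volume.restrict (Set.Ioc (-a) a)) ∧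
      ∀ ρ, F ρ = ∫ s in -a..a, f s * Complex.exp (Complex.I * ρ * s) := by
  obtain ⟨M, hM, h⟩ := hF
  set μ := volume.restrict (Set.Ioc (-a) a) with hμ
  have haa : -a ≤ a := by linarith
  have hcont : ∀ φ : ℝ → ℂ, Continuous φ → MemLp φ 2 μ := by
    intro φ hφ
    obtain ⟨C, hC⟩ := (isCompact_Icc (a := -a) (b := a)).exists_bound_of_continuousOn
      hφ.continuousOn
    refine MemLp.of_bound hφ.aestronglyMeasurable C ?_
    filter_upwards [ae_restrict_mem measurableSet_Ioc] with s hs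
    exact hC s (Set.Ioc_subset_Icc_self hs)
  have hm : ∀ ρ : ℂ, MemLp (fun s : ℝ => Complex.exp (Complex.I * ρ * s)) 2 μ := fun ρ =>
    hcont _ (by fun_prop)
  let e : ℂ → Lp ℂ 2 μ := fun ρ => (hm ρ).toLp _
  let Φ : (ℂ →₀ ℂ) →ₗ[ℂ] Lp ℂ 2 μ := Finsupp.linearCombination ℂ e
  let Ψ : (ℂ →₀ ℂ) →ₗ[ℂ] ℂ := Finsupp.linearCombination ℂ F
  have hΦ : ∀ c : ℂ →₀ ℂ, Φ c = (hcont _ (continuous_expSum c.support c)).toLp _ := by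
    intro c
    have e1 : Φ c = ∑ ρ ∈ c.support, c ρ • e ρ := by
      simp [Φ, Finsupp.linearCombination_apply, Finsupp.sum]
    rw [e1]
    exact sum_smul_toLp _ _ hm _
  have hnorm : ∀ c : ℂ →₀ ℂ, ∫ s in -a..a, ‖expSum c.support c s‖ ^ 2 = ‖Φ c‖ ^ 2 := by
    intro c
    rw [← inner_self_eq_norm_sq (𝕜 := ℂ) (Φ c), hΦ, L2.inner_def,
      ← integral_re (L2.integrable_inner _ _), intervalIntegral.integral_of_le haa]
    refine integral_congr_ae ?_
    filter_upwards [(hcont _ (continuous_expSum c.support c)).coeFn_toLp] with s hs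
    rw [hs, inner_self_eq_norm_sq]
  have hbound : ∀ c, ‖Ψ c‖ ≤ M * ‖Φ c‖ := by
    intro c
    refine norm_le_of_forall_pos_le (norm_nonneg _) fun B hB hle => ?_
    have := h c.support c B hB (by
      change ∫ s in -a..a, ‖expSum c.support c s‖ ^ 2 ≤ B ^ 2
      rw [hnorm]; gcongr)
    simpa [Ψ, Finsupp.linearCombination_apply, Finsupp.sum] using this
  have hker : LinearMap.ker Φ ≤ LinearMap.ker Ψ := by
    intro c hc
    have := hbound c
    rw [LinearMap.mem_ker.1 hc, norm_zero, mul_zero] at this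
    exact LinearMap.mem_ker.2 (norm_le_zero_iff.1 this)
  -- By the bound, `Ψ` depends only on the element of `L_2` defined by the exponential sum. It is
  -- extended from the range of `Φ` by Hahn-Banach and represented by Riesz's theorem.
  let g : LinearMap.range Φ →ₗ[ℂ] ℂ :=
    (LinearMap.ker Φ).liftQ Ψ hker ∘ₗ (Φ.quotKerEquivRange.symm : _ →ₗ[ℂ] _)
  have hg : ∀ c, g ⟨Φ c, c, rfl⟩ = Ψ c := by
    intro c
    have := Φ.quotKerEquivRange_symm_apply_image c ⟨c, rfl⟩
    simp only [g, LinearMap.comp_apply, LinearEquiv.coe_coe, this]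
    rfl
  let g' : StrongDual ℂ (LinearMap.range Φ) := g.mkContinuous M (by
    rintro ⟨_, c, rfl⟩
    rw [hg]
    exact hbound c)
  obtain ⟨G, hG, -⟩ := exists_extension_norm_eq _ g'
  set v := (InnerProductSpace.toDual ℂ (Lp ℂ 2 μ)).symm G with hv
  refine ⟨fun s => starRingEnd ℂ (v s), (Lp.memLp v).star, fun ρ => ?_⟩
  have h1 : Φ (Finsupp.single ρ 1) = e ρ := by simp [Φ]
  have h2 : G (e ρ) = F ρ := by
    have := hG ⟨Φ (Finsupp.single ρ 1), _, rfl⟩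
    rw [← h1]
    refine this.trans ((hg _).trans ?_)
    simp [Ψ]
  rw [← h2, ← InnerProductSpace.toDual_symm_apply, ← hv, L2.inner_def,
    intervalIntegral.integral_of_le haa]
  refine integral_congr_ae ?_
  filter_upwards [(hm ρ).coeFn_toLp] with s hs
  rw [hs, RCLike.inner_apply, mul_comm]

end TreeSL

namespace TreeSL

/-! ### Folding of the kernel, and its moments -/

section Kernel

variable {a : ℝ} {f : ℝ → ℂ}

theorem intervalIntegrable_kernel (ha : 0 ≤ a)
    (hf : MemLp f 2 (volume.restrict (Set.Ioc (-a) a))) :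
    IntervalIntegrable f volume (-a) a :=
  (intervalIntegrable_iff_integrableOn_Ioc_of_le (by linarith)).2 (hf.integrable (by norm_num))

theorem memLp_fold (hf : MemLp f 2 (volume.restrict (Set.Ioc (-a) a))) (κ : ℂ) :
    MemLp (fun t => f t + κ * f (-t)) 2 (intervalMeasure a) := by
  have h1 : MemLp f 2 (intervalMeasure a) := by
    refine hf.mono_measure (Measure.restrict_mono (fun t ht => ?_) le_rfl)
    exact ⟨by linarith [ht.1, ht.2], ht.2.le⟩
  have h2 : MemLp (fun t => f (-t)) 2 (intervalMeasure a) := by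
    have hp : MeasurePreserving (fun t : ℝ => -t) (volume.restrict (Set.Ioo 0 a))
        (volume.restrict (Set.Ioo (-a) 0)) := by
      have := (Measure.measurePreserving_neg (volume : Measure ℝ)).restrict_preimage
        (measurableSet_Ioo (a := -a) (b := 0))
      simpa using this
    have h3 : MemLp f 2 (volume.restrict (Set.Ioo (-a) 0)) := by
      refine hf.mono_measure (Measure.restrict_mono (fun t ht => ?_) le_rfl)
      exact ⟨ht.1, by linarith [ht.1, ht.2]⟩
    exact h3.comp_measurePreserving hp
  exact h1.add (h2.const_mul κ)

theorem integral_fold (ha : 0 ≤ a) (hf : MemLp f 2 (volume.restrict (Set.Ioc (-a) a))) {κ : ℂ}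
    {φ : ℝ → ℂ} (hφ : Continuous φ) (hφκ : ∀ t, φ (-t) = κ * φ t) :
    ∫ t in -a..a, f t * φ t = ∫ t in 0..a, (f t + κ * f (-t)) * φ t := by
  have hi := (intervalIntegrable_kernel ha hf).mul_continuousOn hφ.continuousOn
  have h1 : IntervalIntegrable (fun t => f t * φ t) volume (-a) 0 :=
    hi.mono_set (Set.uIcc_subset_uIcc (by simp) (by simp [ha]))
  have h2 : IntervalIntegrable (fun t => f t * φ t) volume 0 a :=
    hi.mono_set (Set.uIcc_subset_uIcc (by simp [ha]) (by simp))
  have h3 : IntervalIntegrable (fun t => f (-t) * φ (-t)) volume 0 a := by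
    simpa using h1.symm.comp_sub_left 0
  rw [← intervalIntegral.integral_add_adjacent_intervals h1 h2, add_comm]
  have h4 := intervalIntegral.integral_comp_neg (a := 0) (b := a) fun t => f t * φ t
  rw [neg_zero] at h4
  rw [← h4, ← intervalIntegral.integral_add h2 h3]
  refine intervalIntegral.integral_congr fun t _ => ?_
  simp only [hφκ]
  ring

/-- Flatness of the Fourier transform of the kernel at the origin means vanishing moments. -/
theorem integral_mul_pow_eq_zero (ha : 0 ≤ a)
    (hf : MemLp f 2 (volume.restrict (Set.Ioc (-a) a))) {m j : ℕ} (hj : j < m) {C : ℝ}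
    (hC : ∀ ε : ℝ, ‖∫ s in -a..a, f s * Complex.exp (Complex.I * ε * s)‖ ≤ C * |ε| ^ m) :
    ∫ s in -a..a, f s * (s : ℂ) ^ j = 0 := by
  have hi := intervalIntegrable_kernel ha hf
  -- A difference quotient of the exponential: it tends to `s` and is dominated by `|s|`, so `∫ f
  -- q^j` tends to the moment.
  set q : ℝ → ℝ → ℂ := fun ε s => (Complex.exp (Complex.I * ε * s) - 1) / (Complex.I * ε) with hq
  have hqc : ∀ ε, Continuous (q ε) := fun ε => by simp only [hq]; fun_prop
  have hqb : ∀ ε s, ‖q ε s‖ ≤ |s| := by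
    intro ε s
    simp only [hq]
    rw [norm_div, norm_mul, Complex.norm_I, one_mul, Complex.norm_real, Real.norm_eq_abs]
    rcases eq_or_ne ε 0 with h | h
    · simp [h]
    rw [div_le_iff₀ (abs_pos.2 h)]
    have := Real.norm_exp_I_mul_ofReal_sub_one_le (x := ε * s)
    rw [Real.norm_eq_abs, abs_mul] at this
    rw [mul_comm |s|]
    refine le_of_eq_of_le ?_ this
    push_cast
    rw [mul_assoc]
  have hqt : ∀ s, Filter.Tendsto (fun ε => q ε s) (nhdsWithin 0 {0}ᶜ) (nhds s) := by
    intro s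
    have hd : HasDerivAt (fun ε : ℝ => Complex.exp (Complex.I * ε * s)) (Complex.I * s) 0 := by
      have h1 : HasDerivAt (fun ε : ℝ => Complex.I * ε * s) (Complex.I * s) 0 := by
        simpa using ((Complex.ofRealCLM.hasDerivAt (x := (0 : ℝ))).const_mul Complex.I).mul_const
          (s : ℂ)
      simpa using h1.cexp
    have h2 := (hd.tendsto_slope).const_mul Complex.I⁻¹
    rw [← mul_assoc, inv_mul_cancel₀ Complex.I_ne_zero, one_mul] at h2
    refine h2.congr fun ε => ?_
    simp only [slope_def_module, hq, sub_zero]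
    rw [Complex.real_smul]
    push_cast
    simp only [mul_zero, zero_mul, Complex.exp_zero, div_eq_mul_inv, mul_inv]
    ring
  have hlim : Filter.Tendsto (fun ε => ∫ s in -a..a, f s * q ε s ^ j) (nhdsWithin 0 {0}ᶜ)
      (nhds (∫ s in -a..a, f s * (s : ℂ) ^ j)) := by
    refine intervalIntegral.tendsto_integral_filter_of_dominated_convergence
      (fun s => ‖f s‖ * |s| ^ j) ?_ ?_ ?_ ?_
    · refine Filter.Eventually.of_forall fun ε => ?_
      exact (hi.mul_continuousOn ((hqc ε).pow j).continuousOn).def'.aestronglyMeasurable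
    · refine Filter.Eventually.of_forall fun ε => Filter.Eventually.of_forall fun s _ => ?_
      rw [norm_mul, norm_pow]
      gcongr
      exact hqb ε s
    · exact hi.norm.mul_continuousOn (by fun_prop)
    · exact Filter.Eventually.of_forall fun s _ => ((hqt s).pow j).const_mul _
  -- The binomial expansion of `q^j` contains only the frequencies `kε` with `k ≤ j`. Each transform
  -- there is `O(|ε|^m)`, and the division by `ε^j` leaves a positive power of `ε`.
  have hbin : ∀ ε : ℝ, ε ≠ 0 → ‖∫ s in -a..a, f s * q ε s ^ j‖
      ≤ (∑ k ∈ Finset.range (j + 1), (j.choose k : ℝ) * (C * (k : ℝ) ^ m)) * |ε| ^ (m - j) := by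
    intro ε hε
    have e1 : ∀ s, f s * q ε s ^ j = (Complex.I * ε)⁻¹ ^ j *
        ∑ k ∈ Finset.range (j + 1), ((-1) ^ (j - k) * (j.choose k : ℂ)) *
          (f s * Complex.exp (Complex.I * ((k * ε : ℝ) : ℂ) * s)) := by
      intro s
      simp only [hq]
      rw [div_eq_mul_inv, mul_pow, sub_eq_add_neg, add_pow, Finset.mul_sum]
      rw [Finset.sum_mul, Finset.mul_sum]
      refine Finset.sum_congr rfl fun k _ => ?_
      rw [← Complex.exp_nat_mul]
      push_cast
      rw [show Complex.I * (k * ε) * s = k * (Complex.I * ε * s) by ring]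
      ring
    have hint : ∀ k : ℕ, IntervalIntegrable
        (fun s : ℝ => f s * Complex.exp (Complex.I * ((k * ε : ℝ) : ℂ) * s)) volume (-a) a :=
      fun k => hi.mul_continuousOn (by fun_prop)
    simp only [e1]
    rw [intervalIntegral.integral_const_mul, intervalIntegral.integral_finsetSum
      fun k _ => (hint k).const_mul _, norm_mul, norm_pow, norm_inv, norm_mul, Complex.norm_I,
      one_mul, Complex.norm_real, Real.norm_eq_abs]
    have hε' : 0 < |ε| := abs_pos.2 hε
    have h1 : ‖∑ k ∈ Finset.range (j + 1), ∫ s in -a..a, ((-1) ^ (j - k) * (j.choose k : ℂ)) *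
          (f s * Complex.exp (Complex.I * ((k * ε : ℝ) : ℂ) * s))‖
        ≤ (∑ k ∈ Finset.range (j + 1), (j.choose k : ℝ) * (C * (k : ℝ) ^ m)) * |ε| ^ m := by
      refine (norm_sum_le _ _).trans ?_
      rw [Finset.sum_mul]
      refine Finset.sum_le_sum fun k _ => ?_
      rw [intervalIntegral.integral_const_mul, norm_mul, norm_mul, norm_pow, norm_neg, norm_one,
        one_pow, one_mul, Complex.norm_natCast, mul_assoc]
      refine mul_le_mul_of_nonneg_left ?_ (by positivity)
      refine (hC (k * ε)).trans_eq ?_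
      rw [abs_mul, mul_pow, Nat.abs_cast, mul_assoc]
    calc _ ≤ |ε|⁻¹ ^ j * _ := mul_le_mul_of_nonneg_left h1 (by positivity)
      _ = _ := by
        rw [inv_pow, pow_sub₀ _ hε'.ne' hj.le]
        ring
  have hzero : Filter.Tendsto (fun ε => ∫ s in -a..a, f s * q ε s ^ j) (nhdsWithin 0 {0}ᶜ)
      (nhds 0) := by
    refine squeeze_zero_norm' (a := fun ε : ℝ => (∑ k ∈ Finset.range (j + 1),
      (j.choose k : ℝ) * (C * (k : ℝ) ^ m)) * |ε| ^ (m - j)) ?_ ?_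
    · filter_upwards [self_mem_nhdsWithin] with ε hε using hbin ε hε
    · refine Filter.Tendsto.mono_left (Continuous.tendsto' (by fun_prop) _ _ ?_)
        nhdsWithin_le_nhds
      rw [abs_zero, zero_pow (by omega), mul_zero]
  exact tendsto_nhds_unique hlim hzero

end Kernel

/-- The representation of `ρ^m Δ(ρ²)` by a kernel on `(0, a)`. -/
theorem HasOrder.exists_folded_kernel {a : ℝ} (ha : 0 ≤ a) {m : ℕ} {Δ : ℂ → ℂ}
    (h : HasOrder .l2 a (m + 1) Δ) :
    ∃ u : ℝ → ℂ, MemLp u 2 (intervalMeasure a) ∧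
      (∀ φ : ℂ → ℝ → ℂ, (∀ ρ t, φ ρ t = (Complex.exp (Complex.I * ρ * t)
          + (-1) ^ m * Complex.exp (-(Complex.I * ρ * t))) / 2) →
        ∀ ρ, ρ ^ m * Δ (ρ ^ 2) = ∫ t in 0..a, u t * φ ρ t) ∧
      ∀ j < m, (-1 : ℂ) ^ j = (-1) ^ m → ∫ t in 0..a, u t * (t : ℂ) ^ j = 0 := by
  obtain ⟨f, hf, hfF⟩ := (h.isBoundedSymbol le_rfl).exists_kernel ha
  -- The kernel of `Δ(ρ²)` itself. It bounds `Δ(ρ²)` for real `ρ`, so that `ρ^m Δ(ρ²)` vanishes to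
  -- order `m` at 0, and the moments of `f` vanish.
  obtain ⟨f₀, hf₀, hfF₀⟩ := (h.isBoundedSymbol (Nat.zero_le m)).exists_kernel ha
  have hi := intervalIntegrable_kernel ha hf
  have hκ : ((-1 : ℂ) ^ m) * (-1) ^ m = 1 := by rw [← mul_pow]; simp
  refine ⟨_, memLp_fold hf ((-1) ^ m), fun φ hφ ρ => ?_, fun j hj hjm => ?_⟩
  · rw [← integral_fold ha hf]
    · have h1 := hfF ρ
      have h2 := hfF (-ρ)
      -- `ρ^m Δ(ρ²)` has the parity of `m`, so averaging over `ρ` and `-ρ` replaces the exponential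
      -- by its even or odd part.
      have e : ρ ^ m * Δ (ρ ^ 2)
          = (ρ ^ m * Δ (ρ ^ 2) + (-1) ^ m * ((-ρ) ^ m * Δ ((-ρ) ^ 2))) / 2 := by
        rw [neg_pow ρ m, neg_sq, ← mul_assoc, ← mul_assoc ((-1 : ℂ) ^ m), hκ]
        ring
      rw [e, h1, h2, ← intervalIntegral.integral_const_mul, ← intervalIntegral.integral_add,
        ← intervalIntegral.integral_div]
      · refine intervalIntegral.integral_congr fun t _ => ?_
        simp only [hφ, mul_neg, neg_mul]
        ring
      · exact hi.mul_continuousOn (by fun_prop)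
      · exact (hi.mul_continuousOn (by fun_prop)).const_mul _
    · have : φ ρ = fun t : ℝ => (Complex.exp (Complex.I * ρ * t)
          + (-1) ^ m * Complex.exp (-(Complex.I * ρ * t))) / 2 := funext (hφ ρ)
      rw [this]
      fun_prop
    · intro t
      simp only [hφ]
      push_cast
      rw [mul_neg, neg_neg, mul_div_assoc', mul_add, ← mul_assoc, hκ]
      ring
  · rw [← integral_fold ha hf (by fun_prop)]
    · refine integral_mul_pow_eq_zero ha hf hj (C := ∫ s in -a..a, ‖f₀ s‖) fun ε => ?_
      rw [← hfF, norm_mul, norm_pow, Complex.norm_real, Real.norm_eq_abs, mul_comm]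
      refine mul_le_mul_of_nonneg_right ?_ (by positivity)
      have h1 := hfF₀ ε
      rw [pow_zero, one_mul] at h1
      rw [h1]
      refine (intervalIntegral.norm_integral_le_integral_norm (by linarith)).trans_eq ?_
      refine intervalIntegral.integral_congr fun s _ => ?_
      simp only [norm_mul]
      rw [show Complex.I * ε * s = ((ε * s : ℝ) : ℂ) * Complex.I by push_cast; ring,
        Complex.norm_exp_ofReal_mul_I, mul_one]
    · intro t
      push_cast
      rw [neg_pow, hjm]

theorem HasOrder.exists_cos_kernel {a : ℝ} (ha : 0 ≤ a) {m : ℕ} (hm : Even m) {Δ : ℂ → ℂ}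
    (h : HasOrder .l2 a (m + 1) Δ) :
    ∃ u : ℝ → ℂ, MemLp u 2 (intervalMeasure a) ∧
      (∀ ρ, ρ ^ m * Δ (ρ ^ 2) = ∫ t in 0..a, u t * Complex.cos (ρ * t)) ∧
      ∀ j < m, Even j → ∫ t in 0..a, u t * (t : ℂ) ^ j = 0 := by
  obtain ⟨u, hu, h1, h2⟩ := h.exists_folded_kernel ha
  refine ⟨u, hu, h1 (fun ρ t => Complex.cos (ρ * t)) fun ρ t => ?_, fun j hj he =>
    h2 j hj (by rw [he.neg_one_pow, hm.neg_one_pow])⟩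
  rw [hm.neg_one_pow, one_mul, Complex.cos]
  congr 3 <;> ring

theorem HasOrder.exists_sin_kernel {a : ℝ} (ha : 0 ≤ a) {m : ℕ} (hm : Odd m) {Δ : ℂ → ℂ}
    (h : HasOrder .l2 a (m + 1) Δ) :
    ∃ u : ℝ → ℂ, MemLp u 2 (intervalMeasure a) ∧
      (∀ ρ, ρ ^ m * Δ (ρ ^ 2) = ∫ t in 0..a, u t * Complex.sin (ρ * t)) ∧
      ∀ j < m, Odd j → ∫ t in 0..a, u t * (t : ℂ) ^ j = 0 := by
  obtain ⟨u, hu, h1, h2⟩ := h.exists_folded_kernel ha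
  -- The odd part of the exponential is `i sin`; the factor `i` is moved into the kernel.
  refine ⟨fun t => Complex.I * u t, hu.const_mul _, fun ρ => ?_, fun j hj ho => ?_⟩
  · rw [h1 (fun ρ t => Complex.I * Complex.sin (ρ * t)) (fun ρ t => ?_) ρ]
    · refine intervalIntegral.integral_congr fun t _ => ?_
      simp only
      ring
    · have e1 : Complex.I * ρ * t = ρ * t * Complex.I := by ring
      have e2 : -(Complex.I * ρ * t) = -(ρ * t) * Complex.I := by ring
      rw [hm.neg_one_pow, Complex.sin, e2, e1]
      linear_combination ((Complex.exp (-(ρ * t) * Complex.I)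
        - Complex.exp (ρ * t * Complex.I)) / 2) * Complex.I_mul_I
  · simp only [mul_assoc]
    rw [intervalIntegral.integral_const_mul, h2 j hj (by rw [ho.neg_one_pow, hm.neg_one_pow]),
      mul_zero]

/-- Division by `ρ^m` leaves only `lam = 0` open. There the kernel representation of `Δ(ρ²)` gives
continuity along real `ρ`. -/
theorem HasOrder.eq_zero {a : ℝ} (ha : 0 ≤ a) {m : ℕ} {Δ : ℂ → ℂ}
    (h : HasOrder .l2 a (m + 1) Δ) (h0 : ∀ ρ : ℂ, ρ ^ m * Δ (ρ ^ 2) = 0) (lam : ℂ) :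
    Δ lam = 0 := by
  have h1 : ∀ ρ : ℂ, ρ ≠ 0 → Δ (ρ ^ 2) = 0 := fun ρ hρ =>
    (mul_eq_zero.1 (h0 ρ)).resolve_left (pow_ne_zero _ hρ)
  obtain ⟨f, hf, hfF⟩ := (h.isBoundedSymbol (Nat.zero_le m)).exists_kernel ha
  have hi := intervalIntegrable_kernel ha hf
  have hc : Continuous fun ε : ℝ => ∫ s in -a..a, f s * Complex.exp (Complex.I * ε * s) := by
    refine intervalIntegral.continuous_of_dominated_interval (bound := fun s => ‖f s‖)
      (fun ε => (hi.mul_continuousOn (g := fun s : ℝ => Complex.exp (Complex.I * ε * s))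
        (by fun_prop)).def'.aestronglyMeasurable)
      (fun ε => Filter.Eventually.of_forall fun s _ => ?_) hi.norm
      (Filter.Eventually.of_forall fun s _ => by fun_prop)
    rw [norm_mul, show Complex.I * ε * s = ((ε * s : ℝ) : ℂ) * Complex.I by push_cast; ring,
        Complex.norm_exp_ofReal_mul_I, mul_one]
  simp only [← hfF, pow_zero, one_mul] at hc
  have h2 : Δ 0 = 0 := by
    have h3 := (hc.tendsto 0).mono_left (nhdsWithin_le_nhds (s := {0}ᶜ))
    have h4 : Filter.Tendsto (fun ε : ℝ => Δ ((ε : ℂ) ^ 2)) (nhdsWithin 0 {0}ᶜ) (nhds 0) := by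
      refine tendsto_const_nhds.congr' ?_
      filter_upwards [self_mem_nhdsWithin] with ε hε
      exact (h1 _ (Complex.ofReal_ne_zero.2 hε)).symm
    simpa using tendsto_nhds_unique h3 h4
  rcases eq_or_ne lam 0 with rfl | hlam
  · exact h2
  · obtain ⟨ρ, rfl⟩ := IsAlgClosed.exists_pow_nat_eq lam two_pos
    exact h1 ρ fun hρ => hlam (by rw [hρ, zero_pow two_ne_zero])

end TreeSL

namespace TreeSL

/-! ### Completeness -/

theorem VecL2.Represents.inner_eq {a : ℝ} {h k : VecL2 a} {f g p q : ℝ → ℝ}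
    (hh : h.Represents f g) (hk : k.Represents p q) :
    inner ℝ k h = (∫ t in Set.Ioo 0 a, f t * p t) + ∫ t in Set.Ioo 0 a, g t * q t := by
  rw [WithLp.prod_inner_apply, L2.inner_def, L2.inner_def]
  congr 1
  · refine integral_congr_ae ?_
    filter_upwards [hh.1, hk.1] with t h1 h2
    simp only [← h1, ← h2]
    rfl
  · refine integral_congr_ae ?_
    filter_upwards [hh.2, hk.2] with t h1 h2
    simp only [← h1, ← h2]
    rfl

theorem IsCompleteSystem.eq_zero {a : ℝ} {S : Set (VecL2 a)} (hS : IsCompleteSystem S)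
    {k : VecL2 a} (hk : ∀ h ∈ S, inner ℝ k h = 0) : k = 0 := by
  have h1 : ∀ h ∈ (Submodule.span ℝ S).topologicalClosure, inner ℝ k h = 0 := by
    intro h hh
    refine closure_minimal (s := (Submodule.span ℝ S : Set (VecL2 a)))
      (t := {h | inner ℝ k h = 0}) (fun x hx => ?_)
      (isClosed_eq (by fun_prop) continuous_const) hh
    induction hx using Submodule.span_induction with
    | mem x hx => exact hk x hx
    | zero => exact inner_zero_right _
    | add x y _ _ hx hy =>
      change inner ℝ k (x + y) = 0
      rw [inner_add_right, show inner ℝ k x = 0 from hx, show inner ℝ k y = 0 from hy, add_zero]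
    | smul c x _ hx =>
      change inner ℝ k (c • x) = 0
      rw [real_inner_smul_right, show inner ℝ k x = 0 from hx, mul_zero]
  rw [hS] at h1
  exact inner_self_eq_zero.1 (h1 k trivial)

theorem IsCompleteSystem.ae_eq_zero_real {a : ℝ} {S : Set (VecL2 a)} (hS : IsCompleteSystem S)
    {p q : ℝ → ℝ} (hp : MemLp p 2 (intervalMeasure a)) (hq : MemLp q 2 (intervalMeasure a))
    (h : ∀ s ∈ S, ∃ f g, s.Represents f g ∧
      (∫ t in Set.Ioo 0 a, f t * p t) + ∫ t in Set.Ioo 0 a, g t * q t = 0) :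
    p =ᵐ[intervalMeasure a] 0 ∧ q =ᵐ[intervalMeasure a] 0 := by
  let k : VecL2 a := WithLp.toLp 2 (hp.toLp p, hq.toLp q)
  have hk : k.Represents p q := ⟨hp.coeFn_toLp, hq.coeFn_toLp⟩
  have h0 : k = 0 := hS.eq_zero fun s hs => by
    obtain ⟨f, g, h1, h2⟩ := h s hs
    rw [h1.inner_eq hk, h2]
  rw [h0] at hk
  exact ⟨hk.1.symm.trans (Lp.coeFn_zero ℝ 2 _), hk.2.symm.trans (Lp.coeFn_zero ℝ 2 _)⟩

/-- The kernels are complex and the Hilbert space is real: the real and the imaginary part of the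
orthogonality relations are used separately. -/
theorem IsCompleteSystem.ae_eq_zero {a : ℝ} (ha : 0 ≤ a) {S : Set (VecL2 a)}
    (hS : IsCompleteSystem S) {p q : ℝ → ℂ} (hp : MemLp p 2 (intervalMeasure a))
    (hq : MemLp q 2 (intervalMeasure a))
    (h : ∀ s ∈ S, ∃ f g : ℝ → ℝ, Continuous f ∧ Continuous g ∧ s.Represents f g ∧
      ((∫ t in 0..a, p t * f t) + ∫ t in 0..a, q t * g t) = 0) :
    p =ᵐ[intervalMeasure a] 0 ∧ q =ᵐ[intervalMeasure a] 0 := by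
  have hcl : ∀ (L : ℂ →L[ℝ] ℝ) {u : ℝ → ℂ} {f : ℝ → ℝ}, MemLp u 2 (intervalMeasure a) →
      Continuous f → L (∫ t in 0..a, u t * f t) = ∫ t in Set.Ioo 0 a, f t * L (u t) := by
    intro L u f hu hf
    have hi : IntervalIntegrable (fun t => u t * (f t : ℂ)) volume 0 a := by
      refine IntervalIntegrable.mul_continuousOn ?_ (by fun_prop)
      rw [intervalIntegrable_iff_integrableOn_Ioo_of_le ha]
      exact hu.integrable (by norm_num)
    rw [intervalIntegral.integral_of_le ha, integral_Ioc_eq_integral_Ioo,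
      ← L.integral_comp_comm ((intervalIntegrable_iff_integrableOn_Ioo_of_le ha).1 hi)]
    refine integral_congr_ae (ae_of_all _ fun t => ?_)
    beta_reduce
    rw [mul_comm, ← Complex.real_smul, L.map_smul, smul_eq_mul]
  have key : ∀ L : ℂ →L[ℝ] ℝ, (fun t => L (p t)) =ᵐ[intervalMeasure a] 0 ∧
      (fun t => L (q t)) =ᵐ[intervalMeasure a] 0 := by
    intro L
    refine hS.ae_eq_zero_real (L.comp_memLp' hp) (L.comp_memLp' hq) fun s hs => ?_
    obtain ⟨f, g, hf, hg, h1, h2⟩ := h s hs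
    refine ⟨f, g, h1, ?_⟩
    rw [← hcl L hp hf, ← hcl L hq hg, ← map_add, h2, map_zero]
  constructor
  · filter_upwards [(key Complex.reCLM).1, (key Complex.imCLM).1] with t h1 h2
    exact Complex.ext h1 h2
  · filter_upwards [(key Complex.reCLM).2, (key Complex.imCLM).2] with t h1 h2
    exact Complex.ext h1 h2

theorem intervalIntegral_mul_eq_zero {a : ℝ} (ha : 0 ≤ a) {u : ℝ → ℂ}
    (hu : u =ᵐ[intervalMeasure a] 0) (φ : ℝ → ℂ) : ∫ t in 0..a, u t * φ t = 0 := by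
  rw [intervalIntegral.integral_of_le ha, integral_Ioc_eq_integral_Ioo]
  refine integral_eq_zero_of_ae ?_
  filter_upwards [hu] with t ht
  simp [ht]

/-! ### The differences of the unknown characteristic functions vanish -/

namespace MetricTree

variable {V : Type*} [Fintype V] {T : MetricTree V}

theorem Splitting.char_unknown_congr (P : T.Splitting) {σ σ' : T.Edge → ℝ → ℝ}
    (hσ : ∀ e, MemLp (σ e) 2 (intervalMeasure Real.pi))
    (hσ' : ∀ e, MemLp (σ' e) 2 (intervalMeasure Real.pi))
    (hr : 1 ≤ T.numDirichlet P.unknown)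
    (hknown : ∀ e : T.Edge, (e : Sym2 V) ∈ P.known.edgeSet →
      σ e =ᵐ[intervalMeasure Real.pi] σ' e)
    {Λ : Set ℝ} (hpos : ∀ lam ∈ Λ, 0 < lam)
    (hΛ : ∀ lam ∈ Λ, T.IsEigenvalue σ (lam : ℂ)) (hΛ' : ∀ lam ∈ Λ, T.IsEigenvalue σ' (lam : ℂ))
    (hcomplete : IsCompleteSystem (T.vecSystem σ P Λ)) :
    (∀ lam : ℂ, T.charK σ P.unknown P.w lam = T.charK σ' P.unknown P.w lam) ∧
      ∀ lam : ℂ, T.charPi σ P.unknown P.w lam = T.charPi σ' P.unknown P.w lam := by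
  set a := T.numEdges P.unknown * Real.pi with hadef
  have ha : 0 ≤ a := by positivity
  have hK := (P.admissible_charK hσ hσ').diff
  have hPi := (P.admissible_charPi hσ hσ').diff
  rw [← hadef] at hK hPi
  set r := T.numDirichlet P.unknown with hrdef
  -- With `m = r - 1`, the largest admissible powers are `ρ^m` for `δK` and `ρ^(m + 1)` for `δP`;
  -- this is where `r ≥ 1` enters.
  obtain ⟨m, hm⟩ : ∃ m, r = m + 1 := ⟨r - 1, by omega⟩
  rw [hm] at hK hPi
  set δK : ℂ → ℂ := fun lam => T.charK σ P.unknown P.w lam - T.charK σ' P.unknown P.w lam with hδK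
  set δP : ℂ → ℂ := fun lam => T.charPi σ P.unknown P.w lam - T.charPi σ' P.unknown P.w lam
    with hδP
  have hEq : ∀ lam ∈ Λ, ((T.charK σ P.known P.w (lam : ℂ)).re : ℂ) * δP lam
      + ((T.charPi σ P.known P.w (lam : ℂ)).re : ℂ) * δK lam = 0 := by
    intro lam hlam
    have h1 := (hΛ lam hlam).charK_mul_charPi_add hσ P
    have h2 := (hΛ' lam hlam).charK_mul_charPi_add hσ' P
    obtain ⟨h3, h4⟩ := P.known_congr hknown (lam : ℂ)
    rw [Complex.conj_eq_iff_re.1 (conj_charK hσ P.known P.w lam),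
      Complex.conj_eq_iff_re.1 (conj_charPi hσ P.known P.w lam)]
    rw [← h3, ← h4] at h2
    simp only [hδK, hδP]
    linear_combination h1 - h2
  suffices h : (∀ ρ : ℂ, ρ ^ m * δK (ρ ^ 2) = 0) ∧ ∀ ρ : ℂ, ρ ^ (m + 1) * δP (ρ ^ 2) = 0 from
    ⟨fun lam => sub_eq_zero.1 (hK.eq_zero ha h.1 lam),
      fun lam => sub_eq_zero.1 (hPi.eq_zero ha h.2 lam)⟩
  have hsqrt : ∀ lam ∈ Λ, (Real.sqrt lam : ℂ) ≠ 0 ∧ (Real.sqrt lam : ℂ) ^ 2 = lam := by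
    intro lam hlam
    refine ⟨Complex.ofReal_ne_zero.2 (Real.sqrt_pos.2 (hpos lam hlam)).ne', ?_⟩
    rw [← Complex.ofReal_pow, Real.sq_sqrt (hpos lam hlam).le]
  rcases Nat.even_or_odd m with hme | hmo
  · have hodd : Odd (m + 1) := hme.add_one
    obtain ⟨u, hu, huF, hu0⟩ := hK.exists_cos_kernel ha hme
    obtain ⟨v, hv, hvF, hv0⟩ := hPi.exists_sin_kernel ha hodd
    -- The kernel `v` of `δP` comes first, since the first component of `s(t, λ)` carries
    -- `Δ^K_known`, the coefficient of `δP` in `hEq`.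
    obtain ⟨hvz, huz⟩ := hcomplete.ae_eq_zero ha hv hu (by
      rintro s (⟨lam, hlam, hs⟩ | ⟨j, hj, hs⟩)
      · rw [IsSpectralVec, ← hrdef, hm] at hs
        simp only [hodd, if_true] at hs
        refine ⟨_, _, by fun_prop, by fun_prop, hs, ?_⟩
        obtain ⟨h1, h2⟩ := hsqrt lam hlam
        have h3 := huF (Real.sqrt lam)
        have h4 := hvF (Real.sqrt lam)
        have e1 : ∀ (c : ℝ) (t : ℝ), v t * ((c * (Real.sin (√lam * t) / √lam) : ℝ) : ℂ)
            = (c / √lam : ℂ) * (v t * Complex.sin (√lam * t)) := by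
          intro c t; push_cast; ring
        have e2 : ∀ (c : ℝ) (t : ℝ), u t * ((c * Real.cos (√lam * t) : ℝ) : ℂ)
            = (c : ℂ) * (u t * Complex.cos (√lam * t)) := by
          intro c t; push_cast; ring
        simp only [e1, e2]
        rw [intervalIntegral.integral_const_mul, intervalIntegral.integral_const_mul, ← h3, ← h4,
          h2, pow_succ]
        have h5 := hEq lam hlam
        field_simp
        -- The extra power of `ρ` at `δP` is compensated by the `1/ρ` in the sine component.
        linear_combination (√lam : ℂ) ^ m * h5
      · rw [IsPowerVec, ← hrdef, hm] at hs
        rw [← hrdef] at hj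
        rcases Nat.even_or_odd j with hje | hjo
        -- Here `s_j = (0, t^j)` is tested against `u`, whose even moments below `m` vanish; `j + 2
        -- ≤ m + 1` is exactly `j < m`.
        · rw [if_pos (by simp [hodd, hje])] at hs
          refine ⟨_, _, by fun_prop, by fun_prop, hs, ?_⟩
          have := hu0 j (by omega) hje
          simpa using this
        · rw [if_neg (by simp [hodd, hjo])] at hs
          refine ⟨_, _, by fun_prop, by fun_prop, hs, ?_⟩
          have := hv0 j (by omega) hjo
          simpa using this)
    exact ⟨fun ρ => by rw [huF, intervalIntegral_mul_eq_zero ha huz],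
      fun ρ => by rw [hvF, intervalIntegral_mul_eq_zero ha hvz]⟩
  · have heven : Even (m + 1) := hmo.add_one
    have hodd : ¬ Odd (m + 1) := Nat.not_odd_iff_even.2 heven
    obtain ⟨u, hu, huF, hu0⟩ := hK.exists_sin_kernel ha hmo
    obtain ⟨v, hv, hvF, hv0⟩ := hPi.exists_cos_kernel ha heven
    obtain ⟨hvz, huz⟩ := hcomplete.ae_eq_zero ha hv hu (by
      rintro s (⟨lam, hlam, hs⟩ | ⟨j, hj, hs⟩)
      · rw [IsSpectralVec, ← hrdef, hm] at hs
        simp only [hodd, if_false] at hs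
        refine ⟨_, _, by fun_prop, by fun_prop, hs, ?_⟩
        obtain ⟨h1, h2⟩ := hsqrt lam hlam
        have h3 := huF (Real.sqrt lam)
        have h4 := hvF (Real.sqrt lam)
        have e1 : ∀ (c : ℝ) (t : ℝ), v t * ((c * Real.cos (√lam * t) : ℝ) : ℂ)
            = (c : ℂ) * (v t * Complex.cos (√lam * t)) := by
          intro c t; push_cast; ring
        have e2 : ∀ (c : ℝ) (t : ℝ), u t * ((c * (√lam * Real.sin (√lam * t)) : ℝ) : ℂ)
            = (c * √lam : ℂ) * (u t * Complex.sin (√lam * t)) := by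
          intro c t; push_cast; ring
        simp only [e1, e2]
        rw [intervalIntegral.integral_const_mul, intervalIntegral.integral_const_mul, ← h3, ← h4,
          h2, pow_succ]
        -- Now the factor `ρ` in front of the sine brings `δK` to the same power `ρ^(m + 1)` as
        -- `δP`.
        linear_combination (√lam : ℂ) ^ m * (√lam : ℂ) * hEq lam hlam
      · rw [IsPowerVec, ← hrdef, hm] at hs
        rw [← hrdef] at hj
        rcases Nat.even_or_odd j with hje | hjo
        · rw [if_neg (by simp [hodd, hje])] at hs
          refine ⟨_, _, by fun_prop, by fun_prop, hs, ?_⟩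
          have := hv0 j (by omega) hje
          simpa using this
        · rw [if_pos (by simp [hodd, hjo])] at hs
          refine ⟨_, _, by fun_prop, by fun_prop, hs, ?_⟩
          have := hu0 j (by omega) hjo
          simpa using this)
    exact ⟨fun ρ => by rw [huF, intervalIntegral_mul_eq_zero ha huz],
      fun ρ => by rw [hvF, intervalIntegral_mul_eq_zero ha hvz]⟩

end MetricTree

end TreeSL

theorem theorem1 {V : Type*} [Fintype V] (T : TreeSL.MetricTree V) (P : T.Splitting)
    (σ σ' : T.Edge → ℝ → ℝ)
    (hσ : ∀ e, MeasureTheory.MemLp (σ e) 2 (TreeSL.intervalMeasure Real.pi))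
    (hσ' : ∀ e, MeasureTheory.MemLp (σ' e) 2 (TreeSL.intervalMeasure Real.pi))
    (hr : 1 ≤ T.numDirichlet P.unknown)
    (hknown : ∀ e : T.Edge, (e : Sym2 V) ∈ P.known.edgeSet →
      σ e =ᵐ[TreeSL.intervalMeasure Real.pi] σ' e)
    (Λ : Set ℝ) (hpos : ∀ lam ∈ Λ, 0 < lam)
    (hΛ : ∀ lam ∈ Λ, T.IsEigenvalue σ (lam : ℂ))
    (hΛ' : ∀ lam ∈ Λ, T.IsEigenvalue σ' (lam : ℂ))
    (hcomplete : TreeSL.IsCompleteSystem (T.vecSystem σ P Λ)) :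
    (∀ lam : ℂ, T.charK σ P.unknown P.w lam = T.charK σ' P.unknown P.w lam) ∧
      ∀ lam : ℂ, T.charPi σ P.unknown P.w lam = T.charPi σ' P.unknown P.w lam :=
  P.char_unknown_congr hσ hσ' hr hknown hpos hΛ hΛ' hcomplete
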